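/- A circuit over $\{CCX, CX, X\}$ on $m$ qubits is a finite sequence of gates, each a Toffoli ($CCX$), controlled-NOT ($CX$) or NOT ($X$) gate on distinct qubits (any choice of qubits is allowed); its gate count is the length of the sequence, and its depth is the number of layers when every gate is executed as soon as possible, gates on disjoint qubits being allowed to run in parallel. For every $n \ge 0$ there is a circuit $C_n$ over $\{CCX, CX, X\}$ on $n+1$ qubits that implements the $n$-bit increment operator $U_n : |x\rangle \mapsto |(x+1) \bmod 2^n\rangle$ ($x \in \{0,1\}^n$ read as a binary number) using one dirty ancilla qubit, that is, $$C_n(|\varphi\rangle \otimes |\psi\rangle) = U_n|\varphi\rangle \otimes |\psi\rangle$$ for every $n$-qubit state $|\varphi\rangle$ and every one-qubit state $|\psi\rangle$, and such that, as $n \to \infty$, $C_n$ has $\Theta(n)$ gates and depth $\Theta(\log n)$. -/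

import Mathlib

open Filter Asymptotics

noncomputable section

namespace QCircuit

/-- The Hilbert space of `m` qubits, with the computational basis indexed by bit strings. -/
abbrev State (m : ℕ) : Type := EuclideanSpace ℂ (Fin m → Bool)

/-- The computational basis state `|b⟩`. -/
def ket {m : ℕ} (b : Fin m → Bool) : State m := EuclideanSpace.single b 1

/-- The linear operator determined by `|b⟩ ↦ |f b⟩`. -/
def basisOp {m : ℕ} (f : (Fin m → Bool) → (Fin m → Bool)) : State m →ₗ[ℂ] State m :=
  (EuclideanSpace.basisFun (Fin m → Bool) ℂ).toBasis.constr ℂ (fun b => ket (f b))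

/-- The product state `φ ⊗ ψ`; `φ` sits on the first `n` wires and `ψ` on the last `k` wires. -/
def tensor {n k : ℕ} (φ : State n) (ψ : State k) : State (n + k) :=
  WithLp.toLp 2 (fun b => φ (fun i => b (Fin.castAdd k i)) * ψ (fun j => b (Fin.natAdd n j)))

/-- The action of a multi-controlled `X` gate on bit strings: the target bit is XORed with the
conjunction of the control bits. -/
def ckxMap {m : ℕ} (controls : Finset (Fin m)) (target : Fin m) (b : Fin m → Bool) :
    Fin m → Bool :=
  Function.update b target (xor (b target) (decide (∀ c ∈ controls, b c = true)))

/-- A gate of the gate set `{CCX, CX, X}` placed on `m` wires: a multi-controlled `X` gate with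
`2`, `1` or `0` controls. -/
structure Gate (m : ℕ) where
  controls : Finset (Fin m)
  target : Fin m
  target_notMem : target ∉ controls
  card_controls_le : controls.card ≤ 2

/-- The wires on which a gate acts. -/
def Gate.wires {m : ℕ} (g : Gate m) : Finset (Fin m) := insert g.target g.controls

/-- The operator of a gate, tensored with the identity on all other wires. -/
def Gate.op {m : ℕ} (g : Gate m) : State m →ₗ[ℂ] State m :=
  basisOp (ckxMap g.controls g.target)

/-- A circuit over `{CCX, CX, X}` on `m` wires: a finite sequence of gates, the head of the list
being applied first. -/
abbrev Circuit (m : ℕ) : Type := List (Gate m)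

/-- The operator implemented by a circuit. -/
def Circuit.op {m : ℕ} : Circuit m → (State m →ₗ[ℂ] State m)
  | [] => LinearMap.id
  | g :: C => Circuit.op C ∘ₗ g.op

/-- The number of gates of a circuit. -/
def Circuit.gateCount {m : ℕ} (C : Circuit m) : ℕ := C.length

/-- One step of as-soon-as-possible scheduling. Here `d w` is the number of time steps after which
wire `w` becomes free; the gate `g` starts when all its wires are free and takes one time step. -/
def Gate.schedule {m : ℕ} (d : Fin m → ℕ) (g : Gate m) : Fin m → ℕ :=
  fun w => if w ∈ g.wires then g.wires.sup d + 1 else d w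

/-- The depth of a circuit: the number of layers of gates on pairwise disjoint wires when every
gate is executed as soon as possible (equivalently, the length of a longest chain of successive
gates that share wires). -/
def Circuit.depth {m : ℕ} (C : Circuit m) : ℕ :=
  Finset.univ.sup (C.foldl Gate.schedule (fun _ => 0))

/-- The number with binary digits `x`, where `x 0` is the least significant bit. -/
def bitsVal {n : ℕ} (x : Fin n → Bool) : ℕ := ∑ i, (x i).toNat * 2 ^ (i : ℕ)

/-- The `n` lowest binary digits of `v`, least significant bit first. -/
def natBits (n v : ℕ) : Fin n → Bool := fun i => v.testBit i

/-- The `n`-bit increment operator `|x⟩ ↦ |(x + 1) mod 2 ^ n⟩`. -/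
def incrementOp (n : ℕ) : State n →ₗ[ℂ] State n :=
  basisOp (fun x => natBits n ((bitsVal x + 1) % 2 ^ n))

/-- The circuit `C` on `n + 1` wires implements the `n`-qubit operator `U` using the last wire as
a dirty ancilla: the ancilla starts in an arbitrary state and is restored to that state. -/
def ImplementsWithDirtyAncilla {n : ℕ} (C : Circuit (n + 1)) (U : State n →ₗ[ℂ] State n) : Prop :=
  ∀ (φ : State n) (ψ : State 1), C.op (tensor φ ψ) = tensor (U φ) ψ

end QCircuit

end

/-! Every gate permutes the computational basis, so a circuit is described by its action `ev` on bit
strings, and the claim about states follows by bilinearity (`implements_of_ev`). On bit strings the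
increment is `addc` with carry 1.

Upper bounds. A carry reaches a bit only if all lower bits are 1. So whenever a bit has to change,
the bits below it are known and, once negated, are clean workspace. When it need not change the
workspace is dirty, and the circuits are arranged so that computation and uncomputation then cancel.

The register is cut into a low part `lo` of O(log n) bits and the rest `hi`, and `z` is the dirty
ancilla (`exists_inc_of_short`). Increments of `lo` and of `lo ++ [z]`, obtained recursively with a
bit of `hi` as their dirty ancilla, combine to XOR the conjunction of `lo` into `z`. A circuit F
increments `hi` if `z` is set and `lo` is all ones, and does nothing if `z` is unset. F is run while
`z` is toggled, F⁻¹ after `z` is restored, and both are enclosed in complementations of `hi`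
controlled by `z`. If `lo` is all ones, exactly one of the two is effective, and it increments `hi`
in either case because complementing turns a decrement into an increment; otherwise F and F⁻¹
cancel.

To build F (`exists_ctrlInc`), `hi` is cut into levels of doubling size, each of at most six pieces,
whose workspace is the preceding level (`Shape.exists_shape`); every piece also gets three cells in
`lo`. The conjunctions of the pieces feed a ladder of O(log n) gates that computes the carries into
the pieces, and each piece is incremented by a carry-lookahead tree (`PTree.exists_core`). Levels of
equal parity use disjoint wires and run in parallel, so the depth is O(log n). Carries are erased
after the increment because the complement of the result has the same carries as the original
(`PTree.DownOK.flp_addc`, `CarryOK.flp_addc`).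

One step costs O(log n) depth, O(n) gates and five increments of length O(log n), and the recursion
is summed up in `exists_inc_log`.

Lower bounds. On the all-ones input every register bit changes, so each is a target (`le_length`).
The top output bit depends on all n register bits, while d layers of gates on at most three wires
reach at most 3^d bits (`exists_lightCone`). -/

namespace QCircuit

variable {m : ℕ}

/-! ### Circuits as permutations of bit strings -/

/-- The action of a circuit on bit strings. -/
def ev : Circuit m → (Fin m → Bool) → (Fin m → Bool)
  | [], b => b
  | g :: C, b => ev C (ckxMap g.controls g.target b)

@[simp] theorem ev_nil (b : Fin m → Bool) : ev [] b = b := rfl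

@[simp] theorem ev_append (C D : Circuit m) (b : Fin m → Bool) :
    ev (C ++ D) b = ev D (ev C b) := by
  induction C generalizing b with
  | nil => rfl
  | cons g C ih => exact ih _

theorem basisOp_ket (f : (Fin m → Bool) → (Fin m → Bool)) (b : Fin m → Bool) :
    basisOp f (ket b) = ket (f b) := by
  have h : ket b = (EuclideanSpace.basisFun (Fin m → Bool) ℂ).toBasis b := by
    simp [ket]
  rw [h, basisOp, Module.Basis.constr_basis]

theorem ext_ket {E : Type*} [AddCommGroup E] [Module ℂ E] {f g : State m →ₗ[ℂ] E}
    (h : ∀ b, f (ket b) = g (ket b)) : f = g := by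
  refine (EuclideanSpace.basisFun (Fin m → Bool) ℂ).toBasis.ext fun b => ?_
  have := h b
  simpa [ket] using this

theorem op_ket (C : Circuit m) (b : Fin m → Bool) : C.op (ket b) = ket (ev C b) := by
  induction C generalizing b with
  | nil => rfl
  | cons g C ih => simp [Circuit.op, Gate.op, basisOp_ket, ih, ev]

/-- The target is not a control, so the second application XORs the same bit again. -/
theorem ckxMap_ckxMap (g : Gate m) (b : Fin m → Bool) :
    ckxMap g.controls g.target (ckxMap g.controls g.target b) = b := by
  have h : ∀ c ∈ g.controls, ckxMap g.controls g.target b c = b c := fun c hc =>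
    Function.update_of_ne (fun h : c = g.target => g.target_notMem (h ▸ hc)) _ _
  funext w
  by_cases hw : w = g.target
  · subst hw
    rw [ckxMap, Function.update_self]
    have : (∀ c ∈ g.controls, ckxMap g.controls g.target b c = true) ↔
        ∀ c ∈ g.controls, b c = true :=
      forall₂_congr fun c hc => by rw [h c hc]
    simp only [this]
    rw [ckxMap, Function.update_self]
    cases b g.target <;> cases decide (∀ c ∈ g.controls, b c = true) <;> rfl
  · simp [ckxMap, Function.update_of_ne hw]

@[simp] theorem ev_reverse_ev (C : Circuit m) (b : Fin m → Bool) : ev C.reverse (ev C b) = b := by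
  induction C generalizing b with
  | nil => rfl
  | cons g C ih => simp [ev, ih, ckxMap_ckxMap]

@[simp] theorem ev_ev_reverse (C : Circuit m) (b : Fin m → Bool) : ev C (ev C.reverse b) = b := by
  simpa using ev_reverse_ev C.reverse b

theorem ev_injective (C : Circuit m) : Function.Injective (ev C) :=
  Function.LeftInverse.injective (ev_reverse_ev C)

/-! ### Supports, targets and conjugation of circuits -/

/-- All gates of `C` act on wires in `S`. -/
def On (C : Circuit m) (S : Set (Fin m)) : Prop := ∀ g ∈ C, ∀ w ∈ g.wires, w ∈ S

theorem On.mono {C : Circuit m} {S T : Set (Fin m)} (h : On C S) (hST : S ⊆ T) : On C T :=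
  fun g hg w hw => hST (h g hg w hw)

theorem On.append {C D : Circuit m} {S : Set (Fin m)} (hC : On C S) (hD : On D S) :
    On (C ++ D) S := fun g hg => (List.mem_append.1 hg).elim (hC g) (hD g)

theorem On.reverse {C : Circuit m} {S : Set (Fin m)} (hC : On C S) : On C.reverse S :=
  fun g hg => hC g (List.mem_reverse.1 hg)

/-- All targets of gates of `C` are in `S`. -/
def Tgt (C : Circuit m) (S : Set (Fin m)) : Prop := ∀ g ∈ C, g.target ∈ S

theorem On.tgt {C : Circuit m} {S : Set (Fin m)} (h : On C S) : Tgt C S :=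
  fun g hg => h g hg _ (Finset.mem_insert_self _ _)

theorem Tgt.mono {C : Circuit m} {S T : Set (Fin m)} (h : Tgt C S) (hST : S ⊆ T) : Tgt C T :=
  fun g hg => hST (h g hg)

theorem Tgt.append {C D : Circuit m} {S : Set (Fin m)} (hC : Tgt C S) (hD : Tgt D S) :
    Tgt (C ++ D) S := fun g hg => (List.mem_append.1 hg).elim (hC g) (hD g)

theorem Tgt.reverse {C : Circuit m} {S : Set (Fin m)} (hC : Tgt C S) : Tgt C.reverse S :=
  fun g hg => hC g (List.mem_reverse.1 hg)

theorem Tgt.ev_eq {C : Circuit m} {S : Set (Fin m)} (h : Tgt C S) (b : Fin m → Bool) {w : Fin m}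
    (hw : w ∉ S) : ev C b w = b w := by
  induction C generalizing b with
  | nil => rfl
  | cons g C ih =>
    rw [ev, ih (fun g' hg' => h g' (List.mem_cons_of_mem _ hg'))]
    exact Function.update_of_ne (fun e : w = g.target => hw (e ▸ h g List.mem_cons_self)) _ _

theorem On.ev_eq {C : Circuit m} {S : Set (Fin m)} (h : On C S) (b : Fin m → Bool) {w : Fin m}
    (hw : w ∉ S) : ev C b w = b w := h.tgt.ev_eq b hw

theorem On.ev_congr {C : Circuit m} {S : Set (Fin m)} (h : On C S) {b b' : Fin m → Bool}
    (hb : ∀ w ∈ S, b w = b' w) : ∀ w ∈ S, ev C b w = ev C b' w := by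
  induction C generalizing b b' with
  | nil => exact hb
  | cons g C ih =>
    refine ih (fun g' hg' => h g' (List.mem_cons_of_mem _ hg')) fun w hw => ?_
    have hg : ∀ w ∈ g.wires, b w = b' w := fun w hw => hb w (h g List.mem_cons_self w hw)
    have hc : (∀ c ∈ g.controls, b c = true) ↔ ∀ c ∈ g.controls, b' c = true :=
      forall₂_congr fun c hc => by rw [hg c (Finset.mem_insert_of_mem hc)]
    by_cases e : w = g.target
    · subst e
      simp only [ckxMap, Function.update_self, hc, hb _ hw]
    · simp only [ckxMap, Function.update_of_ne e, hb _ hw]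

/-- Conjugating a circuit `D`, whose targets are not used by `U`, by `U`. -/
theorem ev_conj {U D : Circuit m} {S T : Set (Fin m)} (hU : On U S) (hD : Tgt D T)
    (hST : Disjoint S T) (b : Fin m → Bool) (w : Fin m) :
    (w ∈ S → ev (U ++ D ++ U.reverse) b w = b w) ∧
      (w ∉ S → ev (U ++ D ++ U.reverse) b w = ev D (ev U b) w) := by
  simp only [ev_append]
  refine ⟨fun hw => ?_, fun hw => ?_⟩
  · have := hU.reverse.ev_congr (b := ev D (ev U b)) (b' := ev U b)
      (fun w hw => hD.ev_eq _ (Set.disjoint_left.1 hST hw)) w hw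
    rw [this, ev_reverse_ev]
  · exact hU.reverse.ev_eq _ hw

/-! ### Bookkeeping of depth and size -/

/-- `Cost C S k s`: the circuit `C` on the wires `S` is built from `s` gates by sequential
composition and by parallel composition on disjoint wires, in at most `k` layers. -/
inductive Cost : Circuit m → Set (Fin m) → ℕ → ℕ → Prop
  | nil (S : Set (Fin m)) : Cost [] S 0 0
  | gate (g : Gate m) : Cost [g] {w | w ∈ g.wires} 1 1
  | seq {C D : Circuit m} {S : Set (Fin m)} {k s k' s' : ℕ} :
      Cost C S k s → Cost D S k' s' → Cost (C ++ D) S (k + k') (s + s')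
  | par {C D : Circuit m} {S T : Set (Fin m)} {k s s' : ℕ} : Disjoint S T →
      Cost C S k s → Cost D T k s' → Cost (C ++ D) (S ∪ T) k (s + s')
  | mono {C : Circuit m} {S T : Set (Fin m)} {k s k' s' : ℕ} :
      Cost C S k s → S ⊆ T → k ≤ k' → s ≤ s' → Cost C T k' s'

namespace Cost

theorem on {C : Circuit m} {S : Set (Fin m)} {k s : ℕ} (h : Cost C S k s) : On C S := by
  induction h with
  | nil S => intro g hg; simp at hg
  | gate g => intro g' hg'; rw [List.mem_singleton.1 hg']; exact fun w hw => hw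
  | seq _ _ ih ih' => exact ih.append ih'
  | par _ _ _ ih ih' =>
    exact (ih.mono Set.subset_union_left).append (ih'.mono Set.subset_union_right)
  | mono _ hS _ _ ih => exact ih.mono hS

theorem length_le {C : Circuit m} {S : Set (Fin m)} {k s : ℕ} (h : Cost C S k s) :
    C.length ≤ s := by
  induction h with
  | nil S => simp
  | gate g => simp
  | seq _ _ ih ih' => simp; omega
  | par _ _ _ ih ih' => simp; omega
  | mono _ _ _ hs ih => omega

theorem reverse {C : Circuit m} {S : Set (Fin m)} {k s : ℕ} (h : Cost C S k s) :
    Cost C.reverse S k s := by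
  induction h with
  | nil S => exact nil S
  | gate g => exact gate g
  | seq _ _ ih ih' =>
    rw [List.reverse_append]
    exact (ih'.seq ih).mono subset_rfl (by omega) (by omega)
  | par hd _ _ ih ih' =>
    rw [List.reverse_append]
    exact (ih'.par hd.symm ih).mono (Set.union_comm _ _).subset le_rfl (by omega)
  | mono _ hS hk hs ih => exact ih.mono hS hk hs

/-- The starting time `β` is arbitrary so that `seq` can start the second circuit when the first is
done. Wires outside `S` keep their times, so in `par` both circuits start at `β`. -/
theorem foldl_schedule {C : Circuit m} {S : Set (Fin m)} {k s : ℕ} (h : Cost C S k s) :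
    ∀ (d : Fin m → ℕ) (β : ℕ), (∀ w ∈ S, d w ≤ β) →
      (∀ w ∈ S, C.foldl Gate.schedule d w ≤ β + k) ∧
      ∀ w ∉ S, C.foldl Gate.schedule d w = d w := by
  induction h with
  | nil S => exact fun d β h => ⟨h, fun _ _ => rfl⟩
  | gate g =>
    intro d β h
    refine ⟨fun w hw => ?_, fun w hw => ?_⟩
    · have hw' : w ∈ g.wires := hw
      have : g.wires.sup d ≤ β := Finset.sup_le h
      simp only [List.foldl, Gate.schedule, if_pos hw']
      omega
    · have hw' : w ∉ g.wires := hw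
      simp only [List.foldl, Gate.schedule, if_neg hw']
  | seq _ _ ih ih' =>
    intro d β h
    rw [List.foldl_append]
    have h1 := ih d β h
    have h2 := ih' _ _ h1.1
    refine ⟨fun w hw => (h2.1 w hw).trans (by omega), fun w hw => ?_⟩
    rw [h2.2 w hw, h1.2 w hw]
  | @par C D S T k s s' hd _ _ ih ih' =>
    intro d β h
    rw [List.foldl_append]
    have h1 := ih d β fun w hw => h w (Or.inl hw)
    have h2 := ih' (C.foldl Gate.schedule d) β fun w hw => by
      rw [h1.2 w (Set.disjoint_right.1 hd hw)]; exact h w (Or.inr hw)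
    refine ⟨fun w hw => ?_, fun w hw => ?_⟩
    · by_cases hT : w ∈ T
      · exact h2.1 w hT
      · rw [h2.2 w hT]
        exact h1.1 w (hw.resolve_right hT)
    · rw [h2.2 w fun h => hw (Or.inr h), h1.2 w fun h => hw (Or.inl h)]
  | @mono C S T k s k' s' _ hS hk _ ih =>
    intro d β h
    have h1 := ih d β fun w hw => h w (hS hw)
    refine ⟨fun w hw => ?_, fun w hw => h1.2 w fun h => hw (hS h)⟩
    by_cases hw' : w ∈ S
    · exact (h1.1 w hw').trans (by omega)
    · rw [h1.2 w hw']
      exact (h w hw).trans (by omega)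

theorem depth_le {C : Circuit m} {S : Set (Fin m)} {k s : ℕ} (h : Cost C S k s) :
    C.depth ≤ k := by
  refine Finset.sup_le fun w _ => ?_
  have := h.foldl_schedule (fun _ => 0) 0 (fun _ _ => le_rfl)
  by_cases hw : w ∈ S
  · simpa using this.1 w hw
  · simp [this.2 w hw]

theorem of_length (C : Circuit m) : Cost C Set.univ C.length C.length := by
  induction C with
  | nil => exact nil _
  | cons g C ih =>
    exact (((gate g).mono (Set.subset_univ _) le_rfl le_rfl).seq ih).mono subset_rfl
      (by simp; omega) (by simp; omega)

/-- Parallel composition of a family of circuits on pairwise disjoint sets of wires. -/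
theorem flatMap {ι : Type*} {l : List ι} {F : ι → Circuit m} {S : ι → Set (Fin m)} {k : ℕ}
    {s : ι → ℕ} (hF : ∀ i ∈ l, Cost (F i) (S i) k (s i))
    (hl : l.Pairwise fun i j => Disjoint (S i) (S j)) :
    Cost (l.flatMap F) {w | ∃ i ∈ l, w ∈ S i} k (l.map s).sum := by
  induction l with
  | nil => exact (nil _).mono subset_rfl (Nat.zero_le _) le_rfl
  | cons i l ih =>
    rw [List.pairwise_cons] at hl
    have h1 := ih (fun j hj => hF j (List.mem_cons_of_mem _ hj)) hl.2
    have h2 := hF i List.mem_cons_self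
    rw [List.flatMap_cons]
    refine (h2.par ?_ h1).mono ?_ le_rfl (by simp)
    · rw [Set.disjoint_right]
      rintro w ⟨j, hj, hw⟩
      exact Set.disjoint_right.1 (hl.1 j hj) hw
    · rintro w (hw | ⟨j, hj, hw⟩)
      · exact ⟨i, List.mem_cons_self, hw⟩
      · exact ⟨j, List.mem_cons_of_mem _ hj, hw⟩

/-- Sequential composition of a family of circuits. -/
theorem flatMap_seq {ι : Type*} {l : List ι} {F : ι → Circuit m} {S : Set (Fin m)} {k : ℕ}
    {s : ι → ℕ} (hF : ∀ i ∈ l, Cost (F i) S k (s i)) :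
    Cost (l.flatMap F) S (l.length * k) (l.map s).sum := by
  induction l with
  | nil => exact (nil _).mono subset_rfl (Nat.zero_le _) le_rfl
  | cons i l ih =>
    have h1 := ih (fun j hj => hF j (List.mem_cons_of_mem _ hj))
    have h2 := hF i List.mem_cons_self
    rw [List.flatMap_cons]
    exact (h2.seq h1).mono subset_rfl (by simp; ring_nf; omega) (by simp)

end Cost

/-! ### Single gates, negations and fan-out -/

/-- The gate with the given controls and target; empty if there is no such gate. -/
def gt (cs : Finset (Fin m)) (t : Fin m) : Circuit m :=
  if h : t ∉ cs ∧ cs.card ≤ 2 then [⟨cs, t, h.1, h.2⟩] else []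

theorem gt_cost (cs : Finset (Fin m)) (t : Fin m) : Cost (gt cs t) {w | w = t ∨ w ∈ cs} 1 1 := by
  unfold gt
  split_ifs with h
  · exact (Cost.gate _).mono (fun w hw => by simpa [Gate.wires] using hw) le_rfl le_rfl
  · exact (Cost.nil _).mono subset_rfl (by omega) (by omega)

theorem gt_tgt (cs : Finset (Fin m)) (t : Fin m) : Tgt (gt cs t) {t} := by
  unfold gt
  split_ifs with h
  · intro g hg; rw [List.mem_singleton.1 hg]; rfl
  · intro g hg; simp at hg

theorem ev_gt {cs : Finset (Fin m)} {t : Fin m} (h : t ∉ cs) (h' : cs.card ≤ 2)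
    (b : Fin m → Bool) (w : Fin m) :
    ev (gt cs t) b w = if w = t then xor (b t) (decide (∀ c ∈ cs, b c = true)) else b w := by
  rw [gt, dif_pos ⟨h, h'⟩]
  simp only [ev, ckxMap, Function.update_apply]

theorem ev_gt_of_false {cs : Finset (Fin m)} {t c : Fin m} (hc : c ∈ cs)
    (b : Fin m → Bool) (hb : b c = false) : ev (gt cs t) b = b := by
  unfold gt
  split_ifs with h
  · have : ¬ ∀ c ∈ cs, b c = true := fun H => by simp [H c hc] at hb
    simp [ev, ckxMap, this]
  · rfl

/-- Complement the bits in the list `xs`. -/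
def flp (xs : List (Fin m)) (b : Fin m → Bool) : Fin m → Bool :=
  fun w => if w ∈ xs then !b w else b w

theorem flp_mem {xs : List (Fin m)} {b : Fin m → Bool} {w : Fin m} (h : w ∈ xs) :
    flp xs b w = !b w := if_pos h

theorem flp_notMem {xs : List (Fin m)} {b : Fin m → Bool} {w : Fin m} (h : w ∉ xs) :
    flp xs b w = b w := if_neg h

@[simp] theorem flp_flp (xs : List (Fin m)) (b : Fin m → Bool) : flp xs (flp xs b) = b := by
  funext w; unfold flp; split_ifs <;> simp

/-- Negations of all the bits in a list. -/
def nots (xs : List (Fin m)) : Circuit m := xs.flatMap fun x => gt ∅ x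

theorem nots_cost {xs : List (Fin m)} (h : xs.Nodup) :
    Cost (nots xs) {w | w ∈ xs} 1 xs.length := by
  refine (Cost.flatMap (S := fun x => {x}) (s := fun _ => 1)
    (fun x _ => (gt_cost ∅ x).mono (by simp) le_rfl le_rfl) ?_).mono ?_ le_rfl ?_
  · exact h.imp fun hab => by simpa using hab
  · rintro w ⟨i, hi, rfl⟩; exact hi
  · simp

theorem ev_nots {xs : List (Fin m)} (h : xs.Nodup) (b : Fin m → Bool) :
    ev (nots xs) b = flp xs b := by
  induction xs generalizing b with
  | nil => funext w; simp [nots, flp]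
  | cons x xs ih =>
    rw [List.nodup_cons] at h
    have : nots (x :: xs) = gt ∅ x ++ nots xs := rfl
    rw [this, ev_append, ih h.2]
    funext w
    have hg := ev_gt (Finset.notMem_empty x) (by simp) b w
    by_cases hw : w ∈ xs
    · have : w ≠ x := fun e => h.1 (e ▸ hw)
      simp [flp, hw, hg, this]
    · by_cases hx : w = x <;> simp_all [flp]

theorem On.ev_flp {C : Circuit m} {S : Set (Fin m)} (h : On C S) {xs : List (Fin m)}
    (hx : ∀ x ∈ xs, x ∉ S) (b : Fin m → Bool) : ev C (flp xs b) = flp xs (ev C b) := by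
  funext w
  by_cases hw : w ∈ S
  · rw [flp_notMem fun h => hx w h hw]
    exact h.ev_congr (fun w hw => flp_notMem fun h => hx w h hw) w hw
  · rw [h.ev_eq _ hw]
    simp only [flp, h.ev_eq _ hw]

/-- A binary tree of CNOTs: the gate with control `x` and target `y` copies a flip of `x` to `y`,
and each of the two then spreads it over its part of the list in parallel. `exists_fan` conjugates a
single CNOT by this circuit. -/
theorem exists_spread (k : ℕ) : ∀ (x : Fin m) (xs : List (Fin m)), (x :: xs).Nodup →
    (x :: xs).length ≤ 2 ^ k →
    ∃ C, Cost C {w | w ∈ x :: xs} k xs.length ∧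
      ∀ b, ev C (flp [x] b) = flp (x :: xs) (ev C b) := by
  induction k with
  | zero =>
    intro x xs _ h
    obtain rfl : xs = [] := by
      apply List.eq_nil_of_length_eq_zero
      simp at h; simp [h]
    exact ⟨[], (Cost.nil _).mono subset_rfl le_rfl (by simp), fun b => rfl⟩
  | succ k ih =>
    intro x xs hn hl
    by_cases hs : (x :: xs).length ≤ 2 ^ k
    · obtain ⟨C, hC, h⟩ := ih x xs hn hs
      exact ⟨C, hC.mono subset_rfl (by omega) le_rfl, h⟩
    have hpos : 1 ≤ 2 ^ k := Nat.one_le_two_pow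
    rw [pow_succ] at hl
    -- `x :: l` has exactly 2^k elements, and `y :: r` contains the at most 2^k others.
    obtain ⟨l, y, r, rfl, hll⟩ : ∃ l y r, xs = l ++ y :: r ∧ l.length + 1 = 2 ^ k := by
      have hlen : 2 ^ k - 1 < xs.length := by simp at hs; omega
      refine ⟨xs.take (2 ^ k - 1), xs[2 ^ k - 1], xs.drop (2 ^ k - 1 + 1), ?_, ?_⟩
      · rw [← List.drop_eq_getElem_cons, List.take_append_drop]
      · rw [List.length_take]; omega
    rw [← List.cons_append, List.nodup_append] at hn
    obtain ⟨h1, h2, h3⟩ := hn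
    obtain ⟨C, hC, hCe⟩ := ih x l h1 (by simp; omega)
    obtain ⟨D, hD, hDe⟩ := ih y r h2 (by simp only [List.length_cons, List.length_append] at hl ⊢; omega)
    have hxy : x ≠ y := h3 x List.mem_cons_self y List.mem_cons_self
    have hdis : Disjoint {w | w ∈ x :: l} {w | w ∈ y :: r} :=
      Set.disjoint_left.2 fun w hw hw' => h3 w hw w hw' rfl
    refine ⟨gt {x} y ++ (C ++ D), ?_, fun b => ?_⟩
    · refine (Cost.seq ((gt_cost {x} y).mono ?_ le_rfl le_rfl)
        ((Cost.par hdis hC hD).mono ?_ le_rfl le_rfl)).mono subset_rfl (by omega) ?_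
      · rintro w (rfl | hw)
        · simp
        · simp at hw
          simp [hw]
      · rintro w (hw | hw)
        · simp at hw ⊢; tauto
        · simp at hw ⊢; tauto
      · simp only [List.length_append, List.length_cons]
        omega
    · have e1 : ev (gt {x} y) (flp [x] b) = flp [x] (flp [y] (ev (gt {x} y) b)) := by
        funext w
        simp only [ev_gt (show y ∉ ({x} : Finset (Fin m)) by simpa using hxy.symm)
          (by simp : ({x} : Finset (Fin m)).card ≤ 2), flp]
        by_cases hwx : w = x
        · subst hwx; simp [hxy]
        · by_cases hwy : w = y
          · subst hwy; simp [hwx]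
          · simp [hwx, hwy]
      simp only [ev_append, e1, hCe]
      rw [hC.on.ev_flp (xs := [y]) (by
        intro z hz; rw [List.mem_singleton.1 hz]
        exact fun h => h3 y h y List.mem_cons_self rfl)]
      rw [hD.on.ev_flp (xs := x :: l) (fun z hz h => h3 z hz z h rfl), hDe]
      funext w
      simp only [flp, List.mem_append, ← List.cons_append]
      by_cases hw : w ∈ x :: l
      · have h4 : w ∉ y :: r := fun h => h3 w hw w h rfl
        simp only [hw, h4, if_true, if_false, true_or]
      · simp [hw]

/-- Fan-out: complement all bits of `xs` if the bit `v` is set. -/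
theorem exists_fan (k : ℕ) {v : Fin m} {xs : List (Fin m)} (hn : xs.Nodup) (hv : v ∉ xs)
    (hl : xs.length ≤ 2 ^ k) :
    ∃ C, Cost C {w | w = v ∨ w ∈ xs} (2 * k + 1) (2 * xs.length + 1) ∧
      Tgt C {w | w ∈ xs} ∧
      ∀ b, ev C b = if b v = true then flp xs b else b := by
  rcases xs with _ | ⟨x, xs⟩
  · refine ⟨[], (Cost.nil _).mono subset_rfl (by omega) (by omega), fun g hg => by simp at hg,
      fun b => ?_⟩
    split_ifs
    · funext w; simp [flp]
    · rfl
  obtain ⟨C, hC, hCe⟩ := exists_spread k x xs hn hl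
  have hvx : v ≠ x := fun h => hv (h ▸ List.mem_cons_self)
  have hg := gt_cost {v} x
  -- A flip of `x` between C⁻¹ and C amounts to a flip of the whole list.
  refine ⟨C.reverse ++ gt {v} x ++ C, ?_, ?_, fun b => ?_⟩
  · have hC' : Cost C {w | w = v ∨ w ∈ x :: xs} k xs.length :=
      hC.mono (fun w hw => Or.inr hw) le_rfl le_rfl
    refine (Cost.seq (hC'.reverse.seq (hg.mono ?_ le_rfl le_rfl)) hC').mono subset_rfl
      (by omega) (by simp; omega)
    rintro w (rfl | hw)
    · exact Or.inr List.mem_cons_self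
    · left; simpa using hw
  · exact (hC.on.reverse.tgt.append ((gt_tgt {v} x).mono (by simp))).append hC.on.tgt
  · have hbv : ev C.reverse b v = b v := hC.on.reverse.ev_eq b hv
    simp only [ev_append]
    split_ifs with h
    · have : ev (gt {v} x) (ev C.reverse b) = flp [x] (ev C.reverse b) := by
        funext w
        rw [ev_gt (by simpa using hvx.symm) (by simp)]
        by_cases hw : w = x <;> simp [flp, hw, hbv, h]
      rw [this, hCe, ev_ev_reverse]
    · rw [ev_gt_of_false (c := v) (by simp) _ (by simpa [hbv] using h), ev_ev_reverse]

/-! ### Adding a carry to a register -/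

/-- Add the carry `κ` to the number whose binary digits are the bits `xs`, least significant bit
first. -/
def addc : List (Fin m) → Bool → (Fin m → Bool) → (Fin m → Bool)
  | [], _, b => b
  | x :: xs, κ, b => addc xs (κ && b x) (Function.update b x (xor (b x) κ))

theorem addc_notMem {xs : List (Fin m)} {κ : Bool} {b : Fin m → Bool} {w : Fin m}
    (h : w ∉ xs) : addc xs κ b w = b w := by
  induction xs generalizing κ b with
  | nil => rfl
  | cons x xs ih =>
    rw [List.mem_cons, not_or] at h
    rw [addc, ih h.2, Function.update_of_ne h.1]

theorem addc_congr {xs : List (Fin m)} {κ : Bool} {b b' : Fin m → Bool}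
    (h : ∀ w ∈ xs, b w = b' w) : ∀ w ∈ xs, addc xs κ b w = addc xs κ b' w := by
  have key : ∀ (xs : List (Fin m)) (κ : Bool) (b b' : Fin m → Bool) (S : Set (Fin m)),
      (∀ w ∈ xs, w ∈ S) → (∀ w ∈ S, b w = b' w) →
      ∀ w ∈ S, addc xs κ b w = addc xs κ b' w := by
    intro xs
    induction xs with
    | nil => exact fun _ _ _ _ _ h => h
    | cons x xs ih =>
      intro κ b b' S hS h
      have hx := h x (hS x List.mem_cons_self)
      rw [addc, addc, hx]
      refine ih _ _ _ S (fun w hw => hS w (List.mem_cons_of_mem _ hw)) fun w hw => ?_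
      simp only [Function.update_apply, h w hw]
  exact key xs κ b b' {w | w ∈ xs} (fun _ h => h) h

@[simp] theorem addc_false (xs : List (Fin m)) (b : Fin m → Bool) : addc xs false b = b := by
  induction xs generalizing b with
  | nil => rfl
  | cons x xs ih => simp [addc, ih]

theorem all_congr {xs : List (Fin m)} {b b' : Fin m → Bool} (h : ∀ w ∈ xs, b w = b' w) :
    xs.all b = xs.all b' := by
  induction xs with
  | nil => rfl
  | cons x xs ih =>
    rw [List.all_cons, List.all_cons, h x List.mem_cons_self,
      ih fun w hw => h w (List.mem_cons_of_mem _ hw)]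

theorem addc_cons_self {x : Fin m} {xs : List (Fin m)} (h : x ∉ xs) (κ : Bool)
    (b : Fin m → Bool) : addc (x :: xs) κ b x = xor (b x) κ := by
  rw [addc, addc_notMem h, Function.update_self]

theorem addc_cons_mem {x w : Fin m} {xs : List (Fin m)} (h : x ∉ xs) (hw : w ∈ xs) (κ : Bool)
    (b : Fin m → Bool) : addc (x :: xs) κ b w = addc xs (κ && b x) b w := by
  rw [addc]
  refine addc_congr (fun v hv => Function.update_of_ne (fun e : v = x => h (e ▸ hv)) _ _) w hw

/-- The carry reaches `ys` only through ones; this is what allows a register to be cut into pieces.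
-/
theorem addc_append {xs ys : List (Fin m)} (h : (xs ++ ys).Nodup) (κ : Bool)
    (b : Fin m → Bool) :
    addc (xs ++ ys) κ b = addc ys (κ && xs.all b) (addc xs κ b) := by
  induction xs generalizing κ b with
  | nil => simp [addc]
  | cons x xs ih =>
    rw [List.cons_append, List.nodup_cons] at h
    have hx : x ∉ xs := fun e => h.1 (List.mem_append_left _ e)
    rw [List.cons_append, addc, ih h.2, addc, List.all_cons, Bool.and_assoc]
    congr 3
    exact all_congr fun w hw => Function.update_of_ne (fun e : w = x => hx (e ▸ hw)) _ _

theorem addc_true_of_all {xs : List (Fin m)} (h : xs.Nodup) {b : Fin m → Bool}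
    (hb : xs.all b = true) : ∀ w ∈ xs, addc xs true b w = false := by
  induction xs with
  | nil => simp
  | cons x xs ih =>
    rw [List.nodup_cons] at h
    rw [List.all_cons, Bool.and_eq_true] at hb
    intro w hw
    by_cases hwx : w ∈ xs
    · rw [addc_cons_mem h.1 hwx, hb.1]
      exact ih h.2 hb.2 w hwx
    · obtain rfl : w = x := by simpa [hwx] using hw
      rw [addc_cons_self h.1, hb.1]; rfl

/-- The carry out of an addition can be computed from the complemented result. -/
theorem and_all_flp_addc {xs : List (Fin m)} (h : xs.Nodup) (κ : Bool) (b : Fin m → Bool) :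
    (κ && xs.all (flp xs (addc xs κ b))) = (κ && xs.all b) := by
  induction xs generalizing κ with
  | nil => rfl
  | cons x xs ih =>
    rw [List.nodup_cons] at h
    have h1 : xs.all (flp (x :: xs) (addc (x :: xs) κ b)) =
        xs.all (flp xs (addc xs (κ && b x) b)) := all_congr fun w hw => by
      rw [flp_mem hw, flp_mem (List.mem_cons_of_mem _ hw), addc_cons_mem h.1 hw]
    have h2 := ih h.2 (κ && b x)
    rw [List.all_cons, List.all_cons, h1, flp_mem List.mem_cons_self, addc_cons_self h.1]
    -- If `κ` is set, the complemented sum bit is `b x` again; if not, both sides are false.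
    cases κ <;> cases hb : b x <;> simp_all

/-- Complementing before and after turns addition of `κ` into its subtraction. -/
theorem flp_addc_flp_addc {xs : List (Fin m)} (h : xs.Nodup) (κ : Bool) (b : Fin m → Bool) :
    flp xs (addc xs κ (flp xs (addc xs κ b))) = b := by
  have key : ∀ w ∈ xs, flp xs (addc xs κ (flp xs (addc xs κ b))) w = b w := by
    induction xs generalizing κ with
    | nil => simp
    | cons x xs ih =>
      rw [List.nodup_cons] at h
      intro w hw
      rw [flp_mem hw]
      by_cases hwx : w ∈ xs
      · rw [addc_cons_mem h.1 hwx, flp_mem List.mem_cons_self, addc_cons_self h.1]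
        have h1 : (κ && !(b x ^^ κ)) = (κ && b x) := by cases κ <;> cases b x <;> rfl
        have h2 := ih h.2 (κ && b x) w hwx
        rw [flp_mem hwx] at h2
        rw [h1, ← h2]
        congr 1
        refine addc_congr (fun v hv => ?_) w hwx
        rw [flp_mem hv, flp_mem (List.mem_cons_of_mem _ hv), addc_cons_mem h.1 hv]
      · obtain rfl : w = x := by simpa [hwx] using hw
        rw [addc_cons_self h.1, flp_mem List.mem_cons_self, addc_cons_self h.1]
        cases κ <;> cases b w <;> rfl
  funext w
  by_cases hw : w ∈ xs
  · exact key w hw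
  · rw [flp_notMem hw, addc_notMem hw, flp_notMem hw, addc_notMem hw]

/-! ### Carry lookahead on a tree -/

/-- A register `x` with a workspace for carry lookahead: a leaf holds a bit `x` and a cell `d` for
a copy of the control, an inner node a cell `y` for the conjunction of its leaves and a cell `t`
for the carry into its right subtree. -/
inductive PTree (α : Type*)
  | leaf (x d : α)
  | node (y t : α) (l r : PTree α)

namespace PTree

variable {α : Type*}

/-- The register bits, least significant bit first. -/
def xs : PTree α → List α
  | leaf x _ => [x]
  | node _ _ l r => xs l ++ xs r

/-- The cells for the copies of the control. -/
def ds : PTree α → List α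
  | leaf _ d => [d]
  | node _ _ l r => ds l ++ ds r

/-- The cells for conjunctions. -/
def ys : PTree α → List α
  | leaf _ _ => []
  | node y _ l r => y :: (ys l ++ ys r)

/-- The cells for carries. -/
def ts : PTree α → List α
  | leaf _ _ => []
  | node _ t l r => t :: (ts l ++ ts r)

/-- All wires of the tree. -/
def wires : PTree α → List α
  | leaf x d => [x, d]
  | node y t l r => y :: t :: (wires l ++ wires r)

/-- The height of the tree. -/
def height : PTree α → ℕ
  | leaf _ _ => 0
  | node _ _ l r => max (height l) (height r) + 1

/-- The wire that carries the conjunction of the register bits after the up-sweep. -/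
def root : PTree α → α
  | leaf x _ => x
  | node y _ _ _ => y

theorem wires_perm (T : PTree α) : T.wires.Perm (T.xs ++ (T.ds ++ (T.ys ++ T.ts))) := by
  classical
  induction T with
  | leaf x d => simp [wires, xs, ds, ys, ts]
  | node y t l r ihl ihr =>
    rw [List.perm_iff_count] at ihl ihr ⊢
    intro a
    have h1 := ihl a
    have h2 := ihr a
    simp only [wires, xs, ds, ys, ts, List.count_append, List.count_cons] at h1 h2 ⊢
    omega

theorem mem_wires {T : PTree α} {w : α} :
    w ∈ T.wires ↔ w ∈ T.xs ∨ w ∈ T.ds ∨ w ∈ T.ys ∨ w ∈ T.ts := by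
  rw [T.wires_perm.mem_iff]; simp

theorem xs_length_pos (T : PTree α) : 0 < T.xs.length := by
  induction T with
  | leaf x d => simp [xs]
  | node y t l r ihl ihr => simp [xs]; omega

theorem ds_length (T : PTree α) : T.ds.length = T.xs.length := by
  induction T with
  | leaf x d => simp [xs, ds]
  | node y t l r ihl ihr => simp [xs, ds, ihl, ihr]

theorem xs_length_le (T : PTree α) : T.xs.length ≤ 2 ^ T.height := by
  induction T with
  | leaf x d => simp [xs, height]
  | node y t l r ihl ihr =>
    have h1 : 2 ^ l.height ≤ 2 ^ max l.height r.height :=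
      Nat.pow_le_pow_right (by norm_num) (le_max_left _ _)
    have h2 : 2 ^ r.height ≤ 2 ^ max l.height r.height :=
      Nat.pow_le_pow_right (by norm_num) (le_max_right _ _)
    simp only [xs, height, List.length_append, pow_succ]
    omega

theorem root_mem (T : PTree α) : T.root ∈ T.xs ∨ T.root ∈ T.ys := by
  cases T <;> simp [root, xs, ys]

/-- Distinctness of the wires. -/
structure Distinct (T : PTree α) : Prop where
  nodup_xs : T.xs.Nodup
  nodup_ds : T.ds.Nodup
  xs_ds : ∀ w ∈ T.xs, w ∉ T.ds
  xs_ys : ∀ w ∈ T.xs, w ∉ T.ys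
  xs_ts : ∀ w ∈ T.xs, w ∉ T.ts
  ds_ys : ∀ w ∈ T.ds, w ∉ T.ys
  ds_ts : ∀ w ∈ T.ds, w ∉ T.ts
  ys_ts : ∀ w ∈ T.ys, w ∉ T.ts

theorem distinct {T : PTree α} (h : T.wires.Nodup) : T.Distinct := by
  rw [T.wires_perm.nodup_iff, List.nodup_append, List.nodup_append, List.nodup_append] at h
  obtain ⟨h1, ⟨h2, ⟨h3, h4, h5⟩, h6⟩, h7⟩ := h
  refine ⟨h1, h2, ?_, ?_, ?_, ?_, ?_, ?_⟩
  · exact fun w hw hw' => h7 w hw w (by simp [hw']) rfl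
  · exact fun w hw hw' => h7 w hw w (by simp [hw']) rfl
  · exact fun w hw hw' => h7 w hw w (by simp [hw']) rfl
  · exact fun w hw hw' => h6 w hw w (by simp [hw']) rfl
  · exact fun w hw hw' => h6 w hw w (by simp [hw']) rfl
  · exact fun w hw hw' => h5 w hw w hw' rfl

theorem nodup_node {y t : α} {l r : PTree α} (h : (node y t l r).wires.Nodup) :
    y ≠ t ∧ y ∉ l.wires ∧ y ∉ r.wires ∧ t ∉ l.wires ∧ t ∉ r.wires ∧ l.wires.Nodup ∧
      r.wires.Nodup ∧ ∀ w ∈ l.wires, w ∉ r.wires := by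
  simp only [wires, List.nodup_cons, List.mem_cons, List.mem_append, not_or,
    List.nodup_append] at h
  obtain ⟨⟨h1, h2, h3⟩, ⟨h4, h5⟩, h6, h7, h8⟩ := h
  exact ⟨h1, h2, h3, h4, h5, h6, h7, fun w hw hw' => h8 w hw w hw' rfl⟩

theorem root_mem_wires (T : PTree α) : T.root ∈ T.wires := by
  cases T <;> simp [root, wires]

theorem xs_sub {T : PTree α} {w : α} (h : w ∈ T.xs) : w ∈ T.wires := mem_wires.2 (Or.inl h)
theorem ds_sub {T : PTree α} {w : α} (h : w ∈ T.ds) : w ∈ T.wires :=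
  mem_wires.2 (Or.inr (Or.inl h))
theorem ys_sub {T : PTree α} {w : α} (h : w ∈ T.ys) : w ∈ T.wires :=
  mem_wires.2 (Or.inr (Or.inr (Or.inl h)))
theorem ts_sub {T : PTree α} {w : α} (h : w ∈ T.ts) : w ∈ T.wires :=
  mem_wires.2 (Or.inr (Or.inr (Or.inr h)))

/-- The up-sweep: compute the conjunctions of the leaves below every node. -/
def up : PTree (Fin m) → Circuit m
  | leaf _ _ => []
  | node y _ l r => up l ++ up r ++ gt {root l, root r} y

/-- The down-sweep: compute the carry into every right subtree, from a carry into the tree which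
is the conjunction of `cs`. -/
def down : PTree (Fin m) → Finset (Fin m) → Circuit m
  | leaf _ _, _ => []
  | node _ t l r, cs => gt (insert (root l) cs) t ++ (down l cs ++ down r {t})

/-- XOR into every register bit the conjunction of its carry and its cell `d`. -/
def tog : PTree (Fin m) → Finset (Fin m) → Circuit m
  | leaf x d, cs => gt (insert d cs) x
  | node _ t l r, cs => tog l cs ++ tog r {t}

/-- The cells `y` hold the conjunctions. -/
def UpOK : PTree (Fin m) → (Fin m → Bool) → Prop
  | leaf _ _, _ => True
  | node y _ l r, b => b y = (l.xs.all b && r.xs.all b) ∧ UpOK l b ∧ UpOK r b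

/-- The cells `t` hold the carries, if `κ` is the carry into the tree. -/
def DownOK : PTree (Fin m) → Bool → (Fin m → Bool) → Prop
  | leaf _ _, _, _ => True
  | node _ t l r, κ, b => b t = (κ && l.xs.all b) ∧ DownOK l κ b ∧ DownOK r (κ && l.xs.all b) b

theorem UpOK.congr {T : PTree (Fin m)} {b b' : Fin m → Bool} (h : T.UpOK b)
    (hx : ∀ w ∈ T.xs, b w = b' w) (hy : ∀ w ∈ T.ys, b w = b' w) : T.UpOK b' := by
  induction T with
  | leaf x d => trivial
  | node y t l r ihl ihr =>
    simp only [xs, ys, List.mem_append, List.mem_cons] at hx hy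
    have hl := all_congr fun w hw => hx w (Or.inl hw)
    have hr := all_congr fun w hw => hx w (Or.inr hw)
    refine ⟨?_, ihl h.2.1 (fun w hw => hx w (Or.inl hw)) (fun w hw => hy w (by simp [hw])),
      ihr h.2.2 (fun w hw => hx w (Or.inr hw)) (fun w hw => hy w (by simp [hw]))⟩
    rw [← hy y (Or.inl rfl), h.1, hl, hr]

theorem DownOK.congr {T : PTree (Fin m)} {κ : Bool} {b b' : Fin m → Bool} (h : T.DownOK κ b)
    (hx : ∀ w ∈ T.xs, b w = b' w) (ht : ∀ w ∈ T.ts, b w = b' w) : T.DownOK κ b' := by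
  induction T generalizing κ with
  | leaf x d => trivial
  | node y t l r ihl ihr =>
    simp only [xs, ts, List.mem_append, List.mem_cons] at hx ht
    have hl := all_congr fun w hw => hx w (Or.inl hw)
    refine ⟨?_, ihl h.2.1 (fun w hw => hx w (Or.inl hw)) (fun w hw => ht w (by simp [hw])),
      hl ▸ ihr h.2.2 (fun w hw => hx w (Or.inr hw)) (fun w hw => ht w (by simp [hw]))⟩
    rw [← ht t (Or.inl rfl), h.1, hl]

/-- The carries are a function of the register and the carry in. This identifies carries recomputed
from the complemented result with those already stored. -/
theorem DownOK.unique {T : PTree (Fin m)} {κ : Bool} {b b' : Fin m → Bool} (h : T.DownOK κ b)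
    (h' : T.DownOK κ b') (hx : ∀ w ∈ T.xs, b w = b' w) : ∀ w ∈ T.ts, b w = b' w := by
  induction T generalizing κ with
  | leaf x d => simp [ts]
  | node y t l r ihl ihr =>
    simp only [xs, List.mem_append] at hx
    have hl := all_congr fun w hw => hx w (Or.inl hw)
    intro w hw
    simp only [ts, List.mem_cons, List.mem_append] at hw
    rcases hw with rfl | hw | hw
    · rw [h.1, h'.1, hl]
    · exact ihl h.2.1 h'.2.1 (fun w hw => hx w (Or.inl hw)) w hw
    · exact ihr h.2.2 (hl ▸ h'.2.2) (fun w hw => hx w (Or.inr hw)) w hw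

theorem UpOK.root_eq {T : PTree (Fin m)} {b : Fin m → Bool} (h : T.UpOK b) :
    b T.root = T.xs.all b := by
  cases T with
  | leaf x d => simp [root, xs]
  | node y t l r => simp only [root, xs, List.all_append]; exact h.1

theorem up_on (T : PTree (Fin m)) : On T.up {w | w ∈ T.xs ∨ w ∈ T.ys} := by
  induction T with
  | leaf x d => intro g hg; simp [up] at hg
  | node y t l r ihl ihr =>
    refine ((ihl.mono ?_).append (ihr.mono ?_)).append ((gt_cost _ _).on.mono ?_)
    · intro w hw; simp [xs, ys] at hw ⊢; tauto
    · intro w hw; simp [xs, ys] at hw ⊢; tauto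
    · have h1 := root_mem l
      have h2 := root_mem r
      intro w hw
      simp [xs, ys] at hw ⊢
      rcases hw with rfl | rfl | rfl <;> tauto

theorem up_tgt (T : PTree (Fin m)) : Tgt T.up {w | w ∈ T.ys} := by
  induction T with
  | leaf x d => intro g hg; simp [up] at hg
  | node y t l r ihl ihr =>
    refine ((ihl.mono ?_).append (ihr.mono ?_)).append ((gt_tgt _ _).mono ?_)
    · intro w hw; simp [ys] at hw ⊢; tauto
    · intro w hw; simp [ys] at hw ⊢; tauto
    · intro w hw; simp [ys] at hw ⊢; tauto

theorem down_tgt (T : PTree (Fin m)) (cs : Finset (Fin m)) : Tgt (T.down cs) {w | w ∈ T.ts} := by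
  induction T generalizing cs with
  | leaf x d => intro g hg; simp [down] at hg
  | node y t l r ihl ihr =>
    refine ((gt_tgt _ _).mono ?_).append (((ihl _).mono ?_).append ((ihr _).mono ?_))
    · intro w hw; simp [ts] at hw ⊢; tauto
    · intro w hw; simp [ts] at hw ⊢; tauto
    · intro w hw; simp [ts] at hw ⊢; tauto

theorem tog_tgt (T : PTree (Fin m)) (cs : Finset (Fin m)) : Tgt (T.tog cs) {w | w ∈ T.xs} := by
  induction T generalizing cs with
  | leaf x d => exact (gt_tgt _ _).mono (by simp [xs])
  | node y t l r ihl ihr =>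
    refine ((ihl _).mono ?_).append ((ihr _).mono ?_)
    · intro w hw; simp [xs] at hw ⊢; tauto
    · intro w hw; simp [xs] at hw ⊢; tauto

theorem up_cost {T : PTree (Fin m)} (h : T.wires.Nodup) :
    Cost T.up {w | w ∈ T.wires} T.height (T.xs.length - 1) := by
  induction T with
  | leaf x d => exact (Cost.nil _).mono subset_rfl le_rfl (by simp)
  | node y t l r ihl ihr =>
    obtain ⟨h1, h2, h3, h4, h5, h6, h7, h8⟩ := nodup_node h
    have pl := l.xs_length_pos
    have pr := r.xs_length_pos
    refine (Cost.seq (((Cost.par (Set.disjoint_left.2 h8)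
      ((ihl h6).mono subset_rfl (le_max_left _ _) le_rfl)
      ((ihr h7).mono subset_rfl (le_max_right _ _) le_rfl))).mono ?_ le_rfl le_rfl)
      ((gt_cost _ _).mono ?_ le_rfl le_rfl)).mono subset_rfl le_rfl ?_
    · intro w hw; simp [wires] at hw ⊢; tauto
    · have h1 := root_mem_wires l
      have h2 := root_mem_wires r
      intro w hw
      simp [wires] at hw ⊢
      rcases hw with rfl | rfl | rfl <;> tauto
    · simp only [xs, List.length_append]; omega

/-- The left subtree reads its carry from `cs` and the right one from `t`, so after the gate on `t`
both sweeps run on disjoint wires. -/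
theorem down_cost {T : PTree (Fin m)} (h : T.wires.Nodup) {cs : Finset (Fin m)}
    (hcs : ∀ c ∈ cs, c ∉ T.wires) :
    Cost (T.down cs) {w | w ∈ T.wires ∨ w ∈ cs} T.height (T.xs.length - 1) := by
  induction T generalizing cs with
  | leaf x d => exact (Cost.nil _).mono subset_rfl le_rfl (by simp)
  | node y t l r ihl ihr =>
    obtain ⟨h1, h2, h3, h4, h5, h6, h7, h8⟩ := nodup_node h
    have pl := l.xs_length_pos
    have pr := r.xs_length_pos
    have hcs' : ∀ c ∈ cs, c ≠ y ∧ c ≠ t ∧ c ∉ l.wires ∧ c ∉ r.wires := fun c hc => by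
      simpa [wires] using hcs c hc
    refine (Cost.seq ((gt_cost _ _).mono ?_ le_rfl le_rfl) (((Cost.par ?_
      ((ihl h6 fun c hc => (hcs' c hc).2.2.1).mono subset_rfl (le_max_left _ _) le_rfl)
      ((ihr h7 (cs := {t}) (by simpa using h5)).mono subset_rfl (le_max_right _ _) le_rfl))).mono
        ?_ le_rfl le_rfl)).mono subset_rfl (by simp only [height]; omega) ?_
    · have h1 := root_mem_wires l
      intro w hw
      simp [wires] at hw ⊢
      rcases hw with rfl | rfl | hw <;> tauto
    · refine Set.disjoint_left.2 fun w hw hw' => ?_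
      simp only [Set.mem_ofPred_eq, Finset.mem_singleton] at hw hw'
      rcases hw with hw | hw <;> rcases hw' with hw' | rfl
      · exact h8 w hw hw'
      · exact h4 hw
      · exact (hcs' w hw).2.2.2 hw'
      · exact (hcs' w hw).2.1 rfl
    · intro w hw; simp [wires] at hw ⊢; tauto
    · simp only [xs, List.length_append]; omega

/-- Each carry wire controls one leaf only: `cs` the first leaf of the tree, `t` the first leaf of
the right subtree. Hence a single layer. -/
theorem tog_cost {T : PTree (Fin m)} (h : T.wires.Nodup) {cs : Finset (Fin m)}
    (hcs : ∀ c ∈ cs, c ∉ T.wires) :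
    Cost (T.tog cs) {w | w ∈ T.wires ∨ w ∈ cs} 1 T.xs.length := by
  induction T generalizing cs with
  | leaf x d =>
    refine (gt_cost _ _).mono ?_ le_rfl le_rfl
    intro w hw; simp [wires] at hw ⊢; tauto
  | node y t l r ihl ihr =>
    obtain ⟨h1, h2, h3, h4, h5, h6, h7, h8⟩ := nodup_node h
    have hcs' : ∀ c ∈ cs, c ≠ y ∧ c ≠ t ∧ c ∉ l.wires ∧ c ∉ r.wires := fun c hc => by
      simpa [wires] using hcs c hc
    refine (Cost.par ?_ (ihl h6 fun c hc => (hcs' c hc).2.2.1)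
      (ihr h7 (cs := {t}) (by simpa using h5))).mono ?_ le_rfl ?_
    · refine Set.disjoint_left.2 fun w hw hw' => ?_
      simp only [Set.mem_ofPred_eq, Finset.mem_singleton] at hw hw'
      rcases hw with hw | hw <;> rcases hw' with hw' | rfl
      · exact h8 w hw hw'
      · exact h4 hw
      · exact (hcs' w hw).2.2.2 hw'
      · exact (hcs' w hw).2.1 rfl
    · intro w hw; simp [wires] at hw ⊢; tauto
    · simp only [xs, List.length_append]; omega

theorem up_spec {T : PTree (Fin m)} (h : T.wires.Nodup) {b : Fin m → Bool}
    (hb : ∀ w ∈ T.ys, b w = false) : T.UpOK (ev T.up b) := by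
  induction T generalizing b with
  | leaf x d => trivial
  | node y t l r ihl ihr =>
    obtain ⟨h1, h2, h3, h4, h5, h6, h7, h8⟩ := nodup_node h
    simp only [ys, List.mem_cons, List.mem_append] at hb
    rw [up, ev_append, ev_append]
    set b1 := ev l.up b with e1
    set b2 := ev r.up b1 with e2
    set b3 := ev (gt {l.root, r.root} y) b2 with e3
    have f1 : ∀ w, w ∉ l.ys → b1 w = b w := fun w hw => l.up_tgt.ev_eq _ hw
    have f2 : ∀ w, w ∉ r.ys → b2 w = b1 w := fun w hw => r.up_tgt.ev_eq _ hw
    have f3 : ∀ w, w ≠ y → b3 w = b2 w := fun w hw => (gt_tgt _ _).ev_eq _ hw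
    have ul : l.UpOK b1 := ihl h6 fun w hw => hb w (by simp [hw])
    have ur : r.UpOK b2 := ihr h7 fun w hw => by
      rw [f1 w fun h => h8 w (ys_sub h) (ys_sub hw)]
      exact hb w (by simp [hw])
    have g1 : ∀ w ∈ l.wires, b1 w = b3 w := fun w hw => by
      rw [f3 w (fun e => h2 (e ▸ hw)), f2 w fun h => h8 w hw (ys_sub h)]
    have g2 : ∀ w ∈ r.wires, b2 w = b3 w := fun w hw => by
      rw [f3 w (fun e => h3 (e ▸ hw))]
    have ul' : l.UpOK b3 := ul.congr (fun w hw => g1 w (xs_sub hw)) (fun w hw => g1 w (ys_sub hw))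
    have ur' : r.UpOK b3 := ur.congr (fun w hw => g2 w (xs_sub hw)) (fun w hw => g2 w (ys_sub hw))
    refine ⟨?_, ul', ur'⟩
    rw [← ul'.root_eq, ← ur'.root_eq, ← g1 _ l.root_mem_wires, ← g2 _ r.root_mem_wires, e3, ev_gt]
    · have : b1 l.root = b2 l.root := (f2 _ fun h => h8 _ l.root_mem_wires (ys_sub h)).symm
      rw [if_pos rfl, f2 y fun h => h3 (ys_sub h), f1 y fun h => h2 (ys_sub h), hb y (Or.inl rfl),
        this]
      simp
    · have n1 : y ≠ l.root := fun e => h2 (e ▸ l.root_mem_wires)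
      have n2 : y ≠ r.root := fun e => h3 (e ▸ r.root_mem_wires)
      simp [n1, n2]
    · exact Finset.card_le_two

/-- Holding the carry in at most one control leaves room for `root l` in a Toffoli gate. An empty
`cs` stands for the carry 1. -/
theorem down_spec {T : PTree (Fin m)} (h : T.wires.Nodup) {cs : Finset (Fin m)}
    (hcs : ∀ c ∈ cs, c ∉ T.wires) (hc : cs.card ≤ 1) {b : Fin m → Bool}
    (hu : T.UpOK b) (hb : ∀ w ∈ T.ts, b w = false) :
    T.DownOK (decide (∀ c ∈ cs, b c = true)) (ev (T.down cs) b) := by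
  induction T generalizing b cs with
  | leaf x d => trivial
  | node y t l r ihl ihr =>
    obtain ⟨h1, h2, h3, h4, h5, h6, h7, h8⟩ := nodup_node h
    have hcs' : ∀ c ∈ cs, c ≠ y ∧ c ≠ t ∧ c ∉ l.wires ∧ c ∉ r.wires := fun c hc => by
      simpa [wires] using hcs c hc
    simp only [ts, List.mem_cons, List.mem_append] at hb
    rw [down, ev_append, ev_append]
    set b1 := ev (gt (insert l.root cs) t) b with e1
    set b2 := ev (l.down cs) b1 with e2
    set b3 := ev (r.down {t}) b2 with e3
    have f1 : ∀ w, w ≠ t → b1 w = b w := fun w hw => (gt_tgt _ _).ev_eq _ hw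
    have f2 : ∀ w, w ∉ l.ts → b2 w = b1 w := fun w hw => (l.down_tgt _).ev_eq _ hw
    have f3 : ∀ w, w ∉ r.ts → b3 w = b2 w := fun w hw => (r.down_tgt _).ev_eq _ hw
    have k1 : ∀ c ∈ cs, b1 c = b c := fun c hc => f1 c (hcs' c hc).2.1
    have q1 : decide (∀ c ∈ cs, b1 c = true) = decide (∀ c ∈ cs, b c = true) :=
      decide_eq_decide.2 (forall₂_congr fun c hc => by rw [k1 c hc])
    have ht : b1 t = (decide (∀ c ∈ cs, b c = true) && l.xs.all b) := by
      rw [e1, ev_gt, if_pos rfl, hb t (Or.inl rfl), ← hu.2.1.root_eq]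
      · simp [Bool.and_comm]
      · rw [Finset.mem_insert, not_or]
        exact ⟨fun e => h4 (e ▸ l.root_mem_wires), fun h => (hcs' t h).2.1 rfl⟩
      · exact (Finset.card_insert_le _ _).trans (by omega)
    have lx : ∀ w ∈ l.wires, b1 w = b w := fun w hw => f1 w fun e => h4 (e ▸ hw)
    have rx : ∀ w ∈ r.wires, b2 w = b w := fun w hw => by
      rw [f2 w fun h => h8 w (ts_sub h) hw, f1 w fun e => h5 (e ▸ hw)]
    have dl := ihl h6 (fun c hc => (hcs' c hc).2.2.1) hc (b := b1)
      (hu.2.1.congr (fun w hw => (lx w (xs_sub hw)).symm) fun w hw => (lx w (ys_sub hw)).symm)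
      (fun w hw => by rw [lx w (ts_sub hw)]; exact hb w (by simp [hw]))
    have dr := ihr h7 (cs := {t}) (by simpa using h5) (by simp) (b := b2)
      (hu.2.2.congr (fun w hw => (rx w (xs_sub hw)).symm) fun w hw => (rx w (ys_sub hw)).symm)
      (fun w hw => by rw [rx w (ts_sub hw)]; exact hb w (by simp [hw]))
    have t2 : b2 t = b1 t := f2 t fun h => h4 (ts_sub h)
    have lall : l.xs.all b3 = l.xs.all b := all_congr fun w hw => by
      rw [f3 w fun h => h8 w (xs_sub hw) (ts_sub h),
        f2 w fun h => (distinct h6).xs_ts w hw h, lx w (xs_sub hw)]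
    have hκ : decide (∀ c ∈ ({t} : Finset (Fin m)), b2 c = true) =
        (decide (∀ c ∈ cs, b c = true) && l.xs.all b3) := by
      rw [lall, ← ht, ← t2]; simp
    refine ⟨?_, ?_, ?_⟩
    · rw [f3 t fun h => h5 (ts_sub h), t2, ht, lall]
    · rw [q1] at dl
      exact dl.congr (fun w hw => (f3 w fun h => h8 w (xs_sub hw) (ts_sub h)).symm)
        (fun w hw => (f3 w fun h => h8 w (ts_sub hw) (ts_sub h)).symm)
    · rw [← hκ]; exact dr

theorem tog_false {T : PTree (Fin m)} (cs : Finset (Fin m)) {b : Fin m → Bool}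
    (hb : ∀ d ∈ T.ds, b d = false) : ev (T.tog cs) b = b := by
  induction T generalizing cs with
  | leaf x d => exact ev_gt_of_false (c := d) (by simp) _ (hb d (by simp [ds]))
  | node y t l r ihl ihr =>
    simp only [ds, List.mem_append] at hb
    rw [tog, ev_append, ihl _ fun d hd => hb d (Or.inl hd), ihr _ fun d hd => hb d (Or.inr hd)]

theorem tog_spec {T : PTree (Fin m)} (h : T.wires.Nodup) {cs : Finset (Fin m)}
    (hcs : ∀ c ∈ cs, c ∉ T.wires) (hc : cs.card ≤ 1) {b : Fin m → Bool}
    (hd : T.DownOK (decide (∀ c ∈ cs, b c = true)) b) (hb : ∀ w ∈ T.ds, b w = true) :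
    ev (T.tog cs) b = addc T.xs (decide (∀ c ∈ cs, b c = true)) b := by
  induction T generalizing b cs with
  | leaf x d =>
    simp only [wires, List.mem_cons, List.not_mem_nil, or_false, not_or] at hcs
    have hdx : x ≠ d := by simpa [wires] using h
    funext w
    rw [tog, ev_gt]
    · have : b d = true := hb d (by simp [ds])
      simp only [xs, addc, Function.update_apply, Finset.forall_mem_insert, this, true_and]
    · simp [hdx]; exact fun h => (hcs x h).1 rfl
    · exact (Finset.card_insert_le _ _).trans (by omega)
  | node y t l r ihl ihr =>
    obtain ⟨h1, h2, h3, h4, h5, h6, h7, h8⟩ := nodup_node h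
    have hcs' : ∀ c ∈ cs, c ≠ y ∧ c ≠ t ∧ c ∉ l.wires ∧ c ∉ r.wires := fun c hc => by
      simpa [wires] using hcs c hc
    simp only [ds, List.mem_append] at hb
    rw [tog, ev_append, ihl h6 (fun c hc => (hcs' c hc).2.2.1) hc hd.2.1
      fun w hw => hb w (Or.inl hw)]
    set κ := decide (∀ c ∈ cs, b c = true)
    set b1 := addc l.xs κ b with e1
    have f1 : ∀ w, w ∉ l.xs → b1 w = b w := fun w hw => addc_notMem hw
    have q : decide (∀ c ∈ ({t} : Finset (Fin m)), b1 c = true) = (κ && l.xs.all b) := by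
      rw [← hd.1]
      simp [f1 t fun h => h4 (xs_sub h)]
    have := ihr h7 (cs := {t}) (by simpa using h5) (by simp) (b := b1)
      (by
        rw [q]
        exact hd.2.2.congr (fun w hw => (f1 w fun h => h8 w (xs_sub h) (xs_sub hw)).symm)
          (fun w hw => (f1 w fun h => h8 w (xs_sub h) (ts_sub hw)).symm))
      (fun w hw => by
        rw [f1 w fun h => h8 w (xs_sub h) (ds_sub hw)]; exact hb w (Or.inr hw))
    rw [this, q, xs, addc_append (distinct h).nodup_xs]

/-- The carries can be computed from the complemented result. -/
theorem DownOK.flp_addc {T : PTree (Fin m)} (h : T.wires.Nodup) {κ : Bool} {b : Fin m → Bool}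
    (hd : T.DownOK κ b) : T.DownOK κ (flp T.xs (addc T.xs κ b)) := by
  induction T generalizing κ b with
  | leaf x d => trivial
  | node y t l r ihl ihr =>
    obtain ⟨h1, h2, h3, h4, h5, h6, h7, h8⟩ := nodup_node h
    have hn := (distinct h).nodup_xs
    simp only [xs] at hn ⊢
    have hxl : ∀ w ∈ l.xs, w ∉ r.xs := fun w hw hw' => h8 w (xs_sub hw) (xs_sub hw')
    rw [addc_append hn]
    set c := addc r.xs (κ && l.xs.all b) (addc l.xs κ b) with hc
    have cl : ∀ w, w ∉ r.xs → c w = addc l.xs κ b w := fun w hw => addc_notMem hw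
    have cr : ∀ w ∈ r.xs, c w = addc r.xs (κ && l.xs.all b) b w :=
      addc_congr fun v hv => addc_notMem fun h => hxl v h hv
    have gl : ∀ w, w ∈ l.wires → flp l.xs (addc l.xs κ b) w = flp (l.xs ++ r.xs) c w := by
      intro w hw
      have hwr : w ∉ r.xs := fun h => h8 w hw (xs_sub h)
      simp only [flp, List.mem_append, hwr, or_false, cl w hwr]
    have gr : ∀ w, w ∈ r.wires →
        flp r.xs (addc r.xs (κ && l.xs.all b) b) w = flp (l.xs ++ r.xs) c w := by
      intro w hw
      have hwl : w ∉ l.xs := fun h => h8 w (xs_sub h) hw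
      simp only [flp, List.mem_append, hwl, false_or]
      by_cases hr : w ∈ r.xs
      · simp only [hr, if_true, cr w hr]
      · simp only [hr, if_false, cl w hr, addc_notMem hr, addc_notMem hwl]
    -- The carry into the right subtree survives the passage to the complemented sum.
    have hall : (κ && l.xs.all (flp (l.xs ++ r.xs) c)) = (κ && l.xs.all b) := by
      rw [← and_all_flp_addc (distinct h6).nodup_xs κ b,
        all_congr fun w hw => (gl w (xs_sub hw)).symm]
    refine ⟨?_, ?_, ?_⟩
    · rw [hall, ← hd.1, flp_notMem, cl, addc_notMem]
      · exact fun h => h4 (xs_sub h)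
      · exact fun h => h5 (xs_sub h)
      · simp only [List.mem_append, not_or]
        exact ⟨fun h => h4 (xs_sub h), fun h => h5 (xs_sub h)⟩
    · exact (ihl h6 hd.2.1).congr (fun w hw => gl w (xs_sub hw)) fun w hw => gl w (ts_sub hw)
    · rw [hall]
      exact (ihr h7 hd.2.2).congr (fun w hw => gr w (xs_sub hw)) fun w hw => gr w (ts_sub hw)

end PTree

/-! ### Controlled increment of one tree -/

/-- A fan-out is an involution. -/
theorem ev_reverse_of_fan {C : Circuit m} {v : Fin m} {xs : List (Fin m)} (hv : v ∉ xs)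
    (hC : ∀ b, ev C b = if b v = true then flp xs b else b) (b : Fin m → Bool) :
    ev C.reverse b = if b v = true then flp xs b else b := by
  apply ev_injective C
  rw [ev_ev_reverse, hC]
  by_cases h : b v = true
  · rw [if_pos h, if_pos (by rw [flp_notMem hv, h]), flp_flp]
  · rw [if_neg h, if_neg h]

namespace PTree

/-- Compute all carries of an increment, restoring the cells for conjunctions. -/
def pre (T : PTree (Fin m)) : Circuit m := T.up ++ T.down ∅ ++ T.up.reverse

theorem pre_cost {T : PTree (Fin m)} (h : T.wires.Nodup) :
    Cost T.pre {w | w ∈ T.wires} (3 * T.height) (3 * T.xs.length) :=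
  (((up_cost h).seq ((down_cost h (cs := ∅) (by simp)).mono (T := {w | w ∈ T.wires}) (by simp)
    le_rfl le_rfl)).seq (up_cost h).reverse).mono subset_rfl (by omega) (by omega)

theorem pre_spec {T : PTree (Fin m)} (h : T.wires.Nodup) {b : Fin m → Bool}
    (hy : ∀ w ∈ T.ys, b w = false) (ht : ∀ w ∈ T.ts, b w = false) :
    T.DownOK true (ev T.pre b) ∧ ∀ w, w ∉ T.ts → ev T.pre b w = b w := by
  have hD := distinct h
  have hdis : Disjoint {w | w ∈ T.xs ∨ w ∈ T.ys} {w | w ∈ T.ts} := by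
    rw [Set.disjoint_left]
    rintro w (hw | hw)
    · exact hD.xs_ts w hw
    · exact hD.ys_ts w hw
  have key := ev_conj T.up_on (T.down_tgt ∅) hdis b
  have ku : ∀ w, w ∉ T.ys → ev T.up b w = b w := fun w hw => T.up_tgt.ev_eq _ hw
  have kd : ∀ w, w ∉ T.ts → ev (T.down ∅) (ev T.up b) w = ev T.up b w :=
    fun w hw => (T.down_tgt _).ev_eq _ hw
  have hd := down_spec h (cs := ∅) (by simp) (by simp) (up_spec h hy)
    (fun w hw => by rw [ku w fun h => hD.ys_ts w h hw]; exact ht w hw)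
  simp only [Finset.notMem_empty, false_imp_iff, implies_true, decide_true] at hd
  refine ⟨hd.congr (fun w hw => ?_) fun w hw => ?_, fun w hw => ?_⟩
  · rw [kd w (hD.xs_ts w hw), ku w (hD.xs_ys w hw)]
    exact ((key w).1 (Or.inl hw)).symm
  · refine ((key w).2 ?_).symm
    rintro (hw' | hw')
    · exact hD.xs_ts w hw' hw
    · exact hD.ys_ts w hw' hw
  · by_cases hw' : w ∈ T.xs ∨ w ∈ T.ys
    · exact (key w).1 hw'
    · rw [pre, (key w).2 hw', kd w hw, ku w fun h => hw' (Or.inr h)]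

/-- An increment controlled by `v`, correct if the workspace is clean, and without any effect if
`v` is not set. -/
theorem exists_core {T : PTree (Fin m)} (h : T.wires.Nodup) {v : Fin m} (hv : v ∉ T.wires) :
    ∃ C, Cost C {w | w = v ∨ w ∈ T.wires} (14 * T.height + 6) (20 * T.xs.length) ∧
      Tgt C {w | w ∈ T.wires} ∧
      (∀ b, b v = false → ev C b = b) ∧
      ∀ b, b v = true → (∀ w ∈ T.ds, b w = false) → (∀ w ∈ T.ys, b w = false) →
        (∀ w ∈ T.ts, b w = false) → ev C b = addc T.xs true b := by
  have hD := distinct h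
  obtain ⟨FX, fxc, fxt, fxe⟩ := exists_fan T.height (v := v) hD.nodup_xs
    (fun h => hv (xs_sub h)) T.xs_length_le
  obtain ⟨FD, fdc, fdt, fde⟩ := exists_fan T.height (v := v) hD.nodup_ds
    (fun h => hv (ds_sub h)) (T.ds_length ▸ T.xs_length_le)
  have fxr := ev_reverse_of_fan (fun h => hv (xs_sub h)) fxe
  have fdr := ev_reverse_of_fan (fun h => hv (ds_sub h)) fde
  have sub : {w | w ∈ T.wires} ⊆ {w | w = v ∨ w ∈ T.wires} := fun w hw => Or.inr hw
  have cP := (pre_cost h).mono sub le_rfl le_rfl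
  have cT := (tog_cost h (cs := ∅) (by simp)).mono (T := {w | w = v ∨ w ∈ T.wires})
    (by intro w hw; simp at hw ⊢; exact Or.inr hw) le_rfl le_rfl
  have cX := fxc.mono (T := {w | w = v ∨ w ∈ T.wires})
    (by rintro w (hw | hw); exacts [Or.inl hw, Or.inr (xs_sub hw)]) le_rfl le_rfl
  have cD := fdc.mono (T := {w | w = v ∨ w ∈ T.wires})
    (by rintro w (hw | hw); exacts [Or.inl hw, Or.inr (ds_sub hw)]) le_rfl le_rfl
  have tP : Tgt T.pre {w | w ∈ T.wires} := (pre_cost h).on.tgt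
  have tT : Tgt (T.tog ∅) {w | w ∈ T.wires} := (T.tog_tgt ∅).mono fun w hw => xs_sub hw
  have tX : Tgt FX {w | w ∈ T.wires} := fxt.mono fun w hw => xs_sub hw
  have tD : Tgt FD {w | w ∈ T.wires} := fdt.mono fun w hw => ds_sub hw
  have hN := T.xs_length_pos
  -- If `v` is unset, the fan-outs are idle and the rest cancels, whatever the workspace holds. If
  -- `v` is set and the workspace is clean, the first `tog` is idle because the cells `ds` are 0,
  -- the second adds the carries because they are 1, and after complementing the register `pre`
  -- backwards erases the carries.
  refine ⟨T.pre ++ ((T.tog ∅).reverse ++ (FD ++ (T.tog ∅ ++ (FD.reverse ++ (FX ++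
    (T.pre.reverse ++ FX.reverse)))))), ?_, ?_, fun b hb => ?_, fun b hb hd hy ht => ?_⟩
  · refine (cP.seq (cT.reverse.seq (cD.seq (cT.seq (cD.reverse.seq (cX.seq
      (cP.reverse.seq cX.reverse))))))).mono subset_rfl (by omega) ?_
    rw [T.ds_length]; omega
  · exact tP.append (tT.reverse.append (tD.append (tT.append (tD.reverse.append (tX.append
      (tP.reverse.append tX.reverse))))))
  · simp only [ev_append]
    have e1 : ev T.pre b v = false := by rw [tP.ev_eq _ hv, hb]
    have e2 : ev (T.tog ∅).reverse (ev T.pre b) v = false := by rw [tT.reverse.ev_eq _ hv, e1]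
    simp only [fde, fxe, fxr, fdr, e1, e2, ev_ev_reverse, ev_reverse_ev, hb, Bool.false_eq_true,
      if_false]
  · simp only [ev_append]
    obtain ⟨p1, p2⟩ := pre_spec h hy ht
    set s1 := ev T.pre b with hs1
    have v1 : s1 v = true := by rw [p2 v fun h => hv (ts_sub h), hb]
    have d1 : ∀ w ∈ T.ds, s1 w = false := fun w hw => by rw [p2 w (hD.ds_ts w hw), hd w hw]
    have q1 : ev (T.tog ∅).reverse s1 = s1 := by
      apply ev_injective (T.tog ∅); rw [ev_ev_reverse, tog_false _ d1]
    rw [q1, fde, if_pos v1]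
    have fd : ∀ w ∈ T.ds, flp T.ds s1 w = true := fun w hw => by rw [flp_mem hw, d1 w hw]; rfl
    have q2 : ev (T.tog ∅) (flp T.ds s1) = addc T.xs true (flp T.ds s1) := by
      have := tog_spec h (cs := ∅) (by simp) (by simp) (b := flp T.ds s1)
        (by
          simp only [Finset.notMem_empty, false_imp_iff, implies_true, decide_true]
          exact p1.congr (fun w hw => (flp_notMem (hD.xs_ds w hw)).symm)
            (fun w hw => (flp_notMem fun h => hD.ds_ts w h hw).symm)) fd
      simpa using this
    have q3 : addc T.xs true (flp T.ds s1) = flp T.ds (addc T.xs true s1) := by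
      funext w
      by_cases hw : w ∈ T.xs
      · rw [flp_notMem (hD.xs_ds w hw)]
        exact addc_congr (fun w hw => flp_notMem (hD.xs_ds w hw)) w hw
      · rw [addc_notMem hw]
        simp only [flp, addc_notMem hw]
    have v2 : addc T.xs true s1 v = true := by rw [addc_notMem fun h => hv (xs_sub h), v1]
    rw [q2, q3, fdr, if_pos (by rw [flp_notMem fun h => hv (ds_sub h), v2]), flp_flp, fxe,
      if_pos v2]
    set s4 := flp T.xs (addc T.xs true b) with hs4
    have s4n : ∀ w, w ∉ T.xs → s4 w = b w := fun w hw => by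
      rw [hs4, flp_notMem hw, addc_notMem hw]
    obtain ⟨r1, r2⟩ := pre_spec h (b := s4)
      (fun w hw => by rw [s4n w fun h => hD.xs_ys w h hw, hy w hw])
      (fun w hw => by rw [s4n w fun h => hD.xs_ts w h hw, ht w hw])
    have s13 : ∀ w, w ∉ T.ts → flp T.xs (addc T.xs true s1) w = s4 w := fun w hw => by
      by_cases hx : w ∈ T.xs
      · rw [hs4, flp_mem hx, flp_mem hx,
          addc_congr (fun v hv => p2 v (hD.xs_ts v hv)) w hx]
      · rw [s4n w hx, flp_notMem hx, addc_notMem hx, p2 w hw]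
    -- Off `ts` the two states agree by `s13`; on `ts` both hold the carries belonging to the
    -- complemented sum.
    have q4 : flp T.xs (addc T.xs true s1) = ev T.pre s4 := by
      funext w
      by_cases hw : w ∈ T.ts
      · refine (p1.flp_addc h).unique r1 (fun w hw => ?_) w hw
        rw [s13 w (hD.xs_ts w hw), r2 w (hD.xs_ts w hw)]
      · rw [s13 w hw, r2 w hw]
    have v4 : s4 v = true := by rw [s4n v fun h => hv (xs_sub h), hb]
    rw [q4, ev_reverse_ev, fxr, if_pos v4, hs4, flp_flp]

/-! ### Conjunction of one tree, with a possibly dirty workspace -/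

/-- XOR the conjunction of a register into the cell `a`, if the workspace is clean. -/
def conj (T : PTree (Fin m)) (a : Fin m) : Circuit m := T.up ++ gt {T.root} a ++ T.up.reverse

theorem conj_cost {T : PTree (Fin m)} (h : T.wires.Nodup) (a : Fin m) :
    Cost (T.conj a) {w | w = a ∨ w ∈ T.wires} (2 * T.height + 1) (2 * T.xs.length) := by
  have sub : {w | w ∈ T.wires} ⊆ {w | w = a ∨ w ∈ T.wires} := fun w hw => Or.inr hw
  have cU := (up_cost h).mono sub le_rfl le_rfl
  have hN := T.xs_length_pos
  refine ((cU.seq ((gt_cost _ _).mono ?_ le_rfl le_rfl)).seq cU.reverse).mono subset_rfl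
    (by omega) (by omega)
  rintro w (hw | hw)
  · exact Or.inl hw
  · right; rw [Finset.mem_singleton.1 hw]; exact T.root_mem_wires

/-- The bit that `conj` XORs into its target. -/
def conjVal (T : PTree (Fin m)) (b : Fin m → Bool) : Bool := ev T.up b T.root

theorem conjVal_congr {T : PTree (Fin m)} {b b' : Fin m → Bool}
    (hx : ∀ w ∈ T.xs, b w = b' w) (hy : ∀ w ∈ T.ys, b w = b' w) : T.conjVal b = T.conjVal b' :=
  T.up_on.ev_congr (fun w hw => hw.elim (hx w) (hy w)) _ T.root_mem

theorem conjVal_clean {T : PTree (Fin m)} (h : T.wires.Nodup) {b : Fin m → Bool}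
    (hy : ∀ w ∈ T.ys, b w = false) : T.conjVal b = T.xs.all b := by
  rw [conjVal, (up_spec h hy).root_eq]
  exact all_congr fun w hw => T.up_tgt.ev_eq _ ((distinct h).xs_ys w hw)

/-- The target `a` is not touched by `up`, so `up` is undone exactly. Dirt in the workspace can only
falsify the bit `conjVal` that is XORed into `a`. -/
theorem conj_spec {T : PTree (Fin m)} {a : Fin m} (hx : a ∉ T.xs) (hy : a ∉ T.ys)
    (b : Fin m → Bool) :
    ev (T.conj a) b = Function.update b a (xor (b a) (T.conjVal b)) := by
  have hdis : Disjoint {w | w ∈ T.xs ∨ w ∈ T.ys} {a} := by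
    rw [Set.disjoint_right]
    rintro w rfl (hw | hw)
    · exact hx hw
    · exact hy hw
  have key := ev_conj T.up_on (gt_tgt {T.root} a) hdis b
  have har : a ≠ T.root := fun e => (T.root_mem).elim (fun h => hx (e ▸ h)) fun h => hy (e ▸ h)
  funext w
  rw [conj]
  by_cases hw : w ∈ T.xs ∨ w ∈ T.ys
  · rw [(key w).1 hw, Function.update_of_ne]
    rintro rfl
    exact hw.elim hx hy
  · rw [(key w).2 hw, ev_gt (by simpa using har) (by simp), Function.update_apply]
    split_ifs with h
    · rw [T.up_on.ev_eq (w := a) b fun h => h.elim hx hy]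
      simp [conjVal]
    · exact T.up_on.ev_eq b hw

end PTree

/-! ### Registers cut into pieces, and the carries between them -/

/-- A piece of a register, with a workspace, a cell `a` for the conjunction of its bits, a cell `c`
for the carry into it and a cell `v` for a copy of that carry. Pieces with the same parity and
index are processed in parallel. -/
structure Piece (m : ℕ) where
  tree : PTree (Fin m)
  a : Fin m
  c : Fin m
  v : Fin m
  par : Bool
  idx : ℕ

namespace Piece

/-- The register bits of a piece. -/
abbrev xs (p : Piece m) : List (Fin m) := p.tree.xs

end Piece

/-- The register bits of a list of pieces. -/
abbrev bits (ps : List (Piece m)) : List (Fin m) := ps.flatMap Piece.xs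

/-- A decomposition of a register into pieces. The workspace of a piece consists of the cell `a`
and of bits of earlier pieces of opposite parity. -/
structure Layout (ps : List (Piece m)) : Prop where
  tree_nodup : ∀ p ∈ ps, p.tree.wires.Nodup
  bits_nodup : (bits ps).Nodup
  cells_nodup : (ps.map Piece.a ++ (ps.map Piece.c ++ ps.map Piece.v)).Nodup
  a_bits : ∀ p ∈ ps, p.a ∉ bits ps
  c_bits : ∀ p ∈ ps, p.c ∉ bits ps
  v_bits : ∀ p ∈ ps, p.v ∉ bits ps
  a_mem : ∀ p ∈ ps, p.a ∈ p.tree.ds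
  work : ∀ l p r, ps = l ++ p :: r → ∀ w ∈ p.tree.wires,
    w ∈ p.xs ∨ w = p.a ∨ ∃ q ∈ l, q.par ≠ p.par ∧ w ∈ q.xs
  idx_lt : ∀ p ∈ ps, p.idx < 6
  parallel : ps.Pairwise fun p q => p.par = q.par → p.idx = q.idx →
    ∀ w ∈ p.tree.wires, w ∉ q.tree.wires

theorem mem_bits {ps : List (Piece m)} {w : Fin m} : w ∈ bits ps ↔ ∃ p ∈ ps, w ∈ p.xs := by
  simp [bits]

/-- The carries into the pieces. -/
def CarryOK : Bool → List (Piece m) → (Fin m → Bool) → Prop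
  | _, [], _ => True
  | κ, p :: ps, b => b p.c = κ ∧ CarryOK (κ && p.xs.all b) ps b

theorem CarryOK.congr {κ : Bool} {ps : List (Piece m)} {b b' : Fin m → Bool}
    (h : CarryOK κ ps b) (hc : ∀ p ∈ ps, b p.c = b' p.c)
    (hx : ∀ w ∈ bits ps, b w = b' w) : CarryOK κ ps b' := by
  induction ps generalizing κ with
  | nil => trivial
  | cons p ps ih =>
    have hp : p.xs.all b = p.xs.all b' :=
      all_congr fun w hw => hx w (mem_bits.2 ⟨p, List.mem_cons_self, hw⟩)
    refine ⟨(hc p List.mem_cons_self).symm.trans h.1, ?_⟩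
    rw [← hp]
    refine ih h.2 (fun q hq => hc q (List.mem_cons_of_mem _ hq)) fun w hw => hx w ?_
    exact List.mem_append_right _ hw

theorem CarryOK.unique {κ : Bool} {ps : List (Piece m)} {b b' : Fin m → Bool}
    (h : CarryOK κ ps b) (h' : CarryOK κ ps b') (hx : ∀ w ∈ bits ps, b w = b' w) :
    ∀ p ∈ ps, b p.c = b' p.c := by
  induction ps generalizing κ with
  | nil => simp
  | cons p ps ih =>
    have hp : p.xs.all b = p.xs.all b' :=
      all_congr fun w hw => hx w (mem_bits.2 ⟨p, List.mem_cons_self, hw⟩)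
    intro q hq
    rcases List.mem_cons.1 hq with rfl | hq
    · rw [h.1, h'.1]
    · exact ih h.2 (hp ▸ h'.2) (fun w hw => hx w (List.mem_append_right _ hw)) q hq

theorem CarryOK.split {κ : Bool} {l r : List (Piece m)} {p : Piece m} {b : Fin m → Bool}
    (h : CarryOK κ (l ++ p :: r) b) : b p.c = (κ && (bits l).all b) := by
  induction l generalizing κ with
  | nil => simpa using h.1
  | cons q l ih => rw [ih h.2]; simp [bits, Bool.and_assoc]

/-- Once the carries are stored, the pieces can be incremented independently of each other. -/
theorem CarryOK.addc_eq {κ : Bool} {ps : List (Piece m)} {b : Fin m → Bool}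
    (h : CarryOK κ ps b) (hn : (bits ps).Nodup) {p : Piece m} (hp : p ∈ ps) {w : Fin m}
    (hw : w ∈ p.xs) : addc (bits ps) κ b w = addc p.xs (b p.c) b w := by
  induction ps generalizing κ with
  | nil => simp at hp
  | cons q ps ih =>
    have hn' : (q.xs ++ bits ps).Nodup := hn
    have : bits (q :: ps) = q.xs ++ bits ps := rfl
    rw [this, addc_append hn']
    rw [List.nodup_append] at hn'
    rcases List.mem_cons.1 hp with rfl | hp
    · rw [addc_notMem fun h => hn'.2.2 w hw w h rfl, h.1]
    · have hwb : w ∈ bits ps := mem_bits.2 ⟨p, hp, hw⟩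
      rw [← ih h.2 hn'.2.1 hp]
      exact addc_congr (fun v hv => addc_notMem fun h => hn'.2.2 v h v hv rfl) w hwb

/-- The counterpart of `PTree.DownOK.flp_addc` for the carries between pieces; it allows these to be
erased after the increment. -/
theorem CarryOK.flp_addc {κ : Bool} {ps : List (Piece m)} {b : Fin m → Bool}
    (h : CarryOK κ ps b) (hn : (bits ps).Nodup) (hc : ∀ p ∈ ps, p.c ∉ bits ps) :
    CarryOK κ ps (flp (bits ps) (addc (bits ps) κ b)) := by
  -- Induction over the suffixes `r` with `ps` fixed, since the sum involves the whole register.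
  have key : ∀ (l r : List (Piece m)), ps = l ++ r → ∀ κ', κ' = (κ && (bits l).all b) →
      CarryOK κ' r b → CarryOK κ' r (flp (bits ps) (addc (bits ps) κ b)) := by
    intro l r
    induction r generalizing l with
    | nil => intros; trivial
    | cons p r ih =>
      intro e κ' hκ hr
      have hp : p ∈ ps := by rw [e]; simp
      refine ⟨?_, ?_⟩
      · rw [flp_notMem (hc p hp), addc_notMem (hc p hp)]; exact hr.1
      · have hall : (κ' && p.xs.all (flp (bits ps) (addc (bits ps) κ b))) =
            (κ' && p.xs.all b) := by
          have hpn : p.xs.Nodup := (List.nodup_flatMap.1 hn).1 p hp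
          rw [← and_all_flp_addc hpn κ' b]
          congr 1
          refine all_congr fun w hw => ?_
          rw [flp_mem hw, flp_mem (mem_bits.2 ⟨p, hp, hw⟩), h.addc_eq hn hp hw, hr.1]
        rw [hall]
        refine ih (l ++ [p]) (by simp [e]) _ ?_ hr.2
        simp [bits, hκ, Bool.and_assoc]
  exact key [] ps rfl κ (by simp) h

namespace Layout

variable {ps : List (Piece m)}

theorem nodup (L : Layout ps) : ps.Nodup := (List.nodup_append.1 L.cells_nodup).1.of_map

theorem a_inj (L : Layout ps) {p q : Piece m} (hp : p ∈ ps) (hq : q ∈ ps) (h : p.a = q.a) : p = q :=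
  List.inj_on_of_nodup_map (List.nodup_append.1 L.cells_nodup).1 hp hq h

theorem v_inj (L : Layout ps) {p q : Piece m} (hp : p ∈ ps) (hq : q ∈ ps) (h : p.v = q.v) : p = q :=
  List.inj_on_of_nodup_map
    (List.nodup_append.1 (List.nodup_append.1 L.cells_nodup).2.1).2.1 hp hq h

theorem a_ne_c (L : Layout ps) {p q : Piece m} (hp : p ∈ ps) (hq : q ∈ ps) : p.a ≠ q.c :=
  (List.nodup_append.1 L.cells_nodup).2.2 _ (List.mem_map_of_mem hp) _
    (List.mem_append_left _ (List.mem_map_of_mem hq))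

theorem a_ne_v (L : Layout ps) {p q : Piece m} (hp : p ∈ ps) (hq : q ∈ ps) : p.a ≠ q.v :=
  (List.nodup_append.1 L.cells_nodup).2.2 _ (List.mem_map_of_mem hp) _
    (List.mem_append_right _ (List.mem_map_of_mem hq))

theorem c_ne_v (L : Layout ps) {p q : Piece m} (hp : p ∈ ps) (hq : q ∈ ps) : p.c ≠ q.v :=
  (List.nodup_append.1 (List.nodup_append.1 L.cells_nodup).2.1).2.2 _ (List.mem_map_of_mem hp) _
    (List.mem_map_of_mem hq)

theorem eq_of_mem (L : Layout ps) {p q : Piece m} (hp : p ∈ ps) (hq : q ∈ ps) {w : Fin m}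
    (h : w ∈ p.xs) (h' : w ∈ q.xs) : p = q := by
  by_contra hne
  have h2 := (List.nodup_flatMap.1 L.bits_nodup).2
  have : Std.Symm (Function.onFun List.Disjoint (Piece.xs (m := m))) := ⟨fun _ _ h => h.symm⟩
  have := h2.forall hp hq hne
  exact this h h'

theorem mem_wires (L : Layout ps) {p : Piece m} (hp : p ∈ ps) {w : Fin m} (hw : w ∈ p.tree.wires) :
    w ∈ p.xs ∨ w = p.a ∨ ∃ q ∈ ps, q.par ≠ p.par ∧ w ∈ q.xs := by
  obtain ⟨l, r, e⟩ := List.append_of_mem hp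
  rcases L.work l p r e w hw with h | h | ⟨q, hq, h⟩
  · exact Or.inl h
  · exact Or.inr (Or.inl h)
  · exact Or.inr (Or.inr ⟨q, by rw [e]; exact List.mem_append_left _ hq, h⟩)

theorem wires_sub (L : Layout ps) {p : Piece m} (hp : p ∈ ps) {w : Fin m} (hw : w ∈ p.tree.wires) :
    w ∈ bits ps ∨ w = p.a := by
  rcases L.mem_wires hp hw with h | h | ⟨q, hq, _, h⟩
  · exact Or.inl (mem_bits.2 ⟨p, hp, h⟩)
  · exact Or.inr h
  · exact Or.inl (mem_bits.2 ⟨q, hq, h⟩)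

theorem v_notMem (L : Layout ps) {p q : Piece m} (hp : p ∈ ps) (hq : q ∈ ps) :
    p.v ∉ q.tree.wires := fun h =>
  (L.wires_sub hq h).elim (L.v_bits p hp) fun e => L.a_ne_v hq hp e.symm

theorem a_notMem_xs (L : Layout ps) {p q : Piece m} (hp : p ∈ ps) (hq : q ∈ ps) :
    p.a ∉ q.xs := fun h =>
  L.a_bits p hp (mem_bits.2 ⟨q, hq, h⟩)

theorem a_notMem_ys (L : Layout ps) {p q : Piece m} (hp : p ∈ ps) (hq : q ∈ ps) :
    p.a ∉ q.tree.ys := fun h => by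
  rcases L.wires_sub hq (PTree.ys_sub h) with h' | h'
  · exact L.a_bits p hp h'
  · obtain rfl := L.a_inj hp hq h'
    exact (PTree.distinct (L.tree_nodup p hp)).ds_ys _ (L.a_mem p hp) h

/-- Register bits of a piece are not used as workspace by another piece of the same parity. -/
theorem xs_wires (L : Layout ps) {p q : Piece m} (hp : p ∈ ps) (hq : q ∈ ps) (hpq : p ≠ q)
    (h : p.par = q.par) : ∀ w ∈ p.xs, w ∉ q.tree.wires := fun w hw hw' => by
  rcases L.mem_wires hq hw' with h' | h' | ⟨r, hr, hrp, h'⟩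
  · exact hpq (L.eq_of_mem hp hq hw h')
  · exact L.a_notMem_xs hq hp (h' ▸ hw)
  · exact hrp (h ▸ congrArg Piece.par (L.eq_of_mem hp hr hw h').symm)

end Layout

/-! ### Conjunctions of all pieces, one parity at a time -/

/-- The pieces of parity `π`, class by class. -/
def sel (π : Bool) (ps : List (Piece m)) : List (Piece m) :=
  (List.range 6).flatMap fun i => ps.filter fun p => p.par = π ∧ p.idx = i

/-- The register bits of the pieces of the other parity. -/
def oth (π : Bool) (ps : List (Piece m)) : List (Fin m) := bits (ps.filter fun p => p.par = !π)

theorem mem_sel {π : Bool} {ps : List (Piece m)} (L : Layout ps) {p : Piece m} :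
    p ∈ sel π ps ↔ p ∈ ps ∧ p.par = π := by
  have := L.idx_lt p
  simp only [sel, List.mem_flatMap, List.mem_range, List.mem_filter, decide_eq_true_eq]
  constructor
  · rintro ⟨i, _, h, h', _⟩; exact ⟨h, h'⟩
  · rintro ⟨h, h'⟩; exact ⟨p.idx, this h, h, h', rfl⟩

theorem mem_oth {π : Bool} {ps : List (Piece m)} {w : Fin m} :
    w ∈ oth π ps ↔ ∃ p ∈ ps, p.par = !π ∧ w ∈ p.xs := by
  simp [oth, bits, and_assoc]

theorem nodup_sel {π : Bool} {ps : List (Piece m)} (L : Layout ps) : (sel π ps).Nodup := by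
  rw [sel, List.nodup_flatMap]
  refine ⟨fun i _ => L.nodup.filter _, List.nodup_range.imp fun {i j} hij => ?_⟩
  intro p hi hj
  simp only [List.mem_filter, decide_eq_true_eq] at hi hj
  exact hij (hi.2.2.symm.trans hj.2.2)

theorem nodup_oth {π : Bool} {ps : List (Piece m)} (L : Layout ps) : (oth π ps).Nodup :=
  L.bits_nodup.sublist (List.Sublist.flatMap List.filter_sublist _)

theorem oth_length_le (π : Bool) (ps : List (Piece m)) :
    (oth π ps).length ≤ (bits ps).length :=
  (List.Sublist.flatMap List.filter_sublist Piece.xs).length_le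

/-- All wires of the trees. -/
abbrev treeWires (ps : List (Piece m)) : Set (Fin m) := {w | w ∈ bits ps ∨ ∃ p ∈ ps, w = p.a}

/-- Cost of running a circuit on every piece of given parity. -/
theorem cost_sel {π : Bool} {ps : List (Piece m)} (L : Layout ps) {F : Piece m → Circuit m}
    {S : Piece m → Set (Fin m)} {T : Set (Fin m)} {k s : ℕ}
    (hF : ∀ p ∈ ps, Cost (F p) (S p) k (s * p.xs.length)) (hT : ∀ p ∈ ps, S p ⊆ T)
    (hS : ∀ p ∈ ps, ∀ q ∈ ps, p ≠ q → (∀ w ∈ p.tree.wires, w ∉ q.tree.wires) →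
      Disjoint (S p) (S q)) :
    Cost ((sel π ps).flatMap F) T (6 * k) (6 * (s * (bits ps).length)) := by
  rw [sel, List.flatMap_assoc]
  have hsum : ∀ l : List (Piece m), l.Sublist ps →
      (l.map fun p => s * p.xs.length).sum ≤ s * (bits ps).length := by
    intro l hl
    rw [List.sum_map_mul_left, bits, List.length_flatMap]
    exact Nat.mul_le_mul_left _ ((hl.map _).sum_le_sum (by simp))
  have h1 : ∀ i ∈ List.range 6,
      Cost ((ps.filter fun p => p.par = π ∧ p.idx = i).flatMap F) T k (s * (bits ps).length) := by
    intro i _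
    have sub : (ps.filter fun p => p.par = π ∧ p.idx = i).Sublist ps := List.filter_sublist
    refine (Cost.flatMap (fun p hp => hF p (sub.subset hp)) ?_).mono ?_ le_rfl (hsum _ sub)
    · have hpw := (L.parallel.and L.nodup).sublist sub
      refine hpw.imp_of_mem fun {p q} hp hq hpq => ?_
      simp only [List.mem_filter, decide_eq_true_eq] at hp hq
      exact hS p hp.1 q hq.1 hpq.2
        (hpq.1 (hp.2.1.trans hq.2.1.symm) (hp.2.2.trans hq.2.2.symm))
    · rintro w ⟨p, hp, hw⟩
      exact hT p (sub.subset hp) hw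
  exact (Cost.flatMap_seq h1).mono subset_rfl (by simp)
    (by rw [List.map_const', List.sum_replicate, List.length_range, smul_eq_mul])

/-- The XORed bits depend on the wires `xs` and `ys` only, and no `a` is among these, so all of them
can be evaluated in the initial state. -/
theorem ev_flatMap_conj {qs : List (Piece m)} (hn : (qs.map Piece.a).Nodup)
    (hx : ∀ p ∈ qs, ∀ q ∈ qs, p.a ∉ q.xs) (hy : ∀ p ∈ qs, ∀ q ∈ qs, p.a ∉ q.tree.ys)
    (b : Fin m → Bool) :
    (∀ w, (∀ p ∈ qs, w ≠ p.a) → ev (qs.flatMap fun p => p.tree.conj p.a) b w = b w) ∧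
      ∀ p ∈ qs, ev (qs.flatMap fun p => p.tree.conj p.a) b p.a =
        xor (b p.a) (p.tree.conjVal b) := by
  induction qs generalizing b with
  | nil => simp
  | cons q qs ih =>
    rw [List.map_cons, List.nodup_cons] at hn
    have hqx := hx q List.mem_cons_self
    have hqy := hy q List.mem_cons_self
    simp only [List.flatMap_cons, ev_append, PTree.conj_spec (hqx q List.mem_cons_self)
      (hqy q List.mem_cons_self)]
    set b1 := Function.update b q.a (xor (b q.a) (q.tree.conjVal b)) with hb1
    have f1 : ∀ w, w ≠ q.a → b1 w = b w := fun w hw => Function.update_of_ne hw _ _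
    obtain ⟨i1, i2⟩ := ih hn.2
      (fun p hp r hr => hx p (List.mem_cons_of_mem _ hp) r (List.mem_cons_of_mem _ hr))
      (fun p hp r hr => hy p (List.mem_cons_of_mem _ hp) r (List.mem_cons_of_mem _ hr)) b1
    refine ⟨fun w hw => ?_, fun p hp => ?_⟩
    · rw [i1 w fun p hp => hw p (List.mem_cons_of_mem _ hp), f1 w (hw q List.mem_cons_self)]
    · rcases List.mem_cons.1 hp with rfl | hp'
      · rw [i1 p.a fun r hr e => hn.1 (e ▸ List.mem_map_of_mem hr), hb1, Function.update_self]
      · rw [i2 p hp', f1 p.a fun e => hn.1 (e ▸ List.mem_map_of_mem hp')]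
        congr 1
        exact PTree.conjVal_congr (fun w hw => f1 w fun e => hqx p hp (e ▸ hw))
          (fun w hw => f1 w fun e => hqy p hp (e ▸ hw))

/-- Compute the conjunctions of the pieces of parity `π`. -/
def conjPhase (π : Bool) (ps : List (Piece m)) : Circuit m :=
  nots (oth π ps) ++ ((sel π ps).flatMap fun p => p.tree.conj p.a) ++ nots (oth π ps)

theorem conjPhase_cost {ps : List (Piece m)} (L : Layout ps) {h : ℕ}
    (hh : ∀ p ∈ ps, p.tree.height ≤ h) (π : Bool) :
    Cost (conjPhase π ps) (treeWires ps) (12 * h + 8) (14 * (bits ps).length) := by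
  have hl := oth_length_le π ps
  have c1 : Cost (nots (oth π ps)) (treeWires ps) 1 (bits ps).length := by
    refine (nots_cost (nodup_oth L)).mono ?_ le_rfl (oth_length_le π ps)
    intro w hw
    obtain ⟨p, hp, _, hw⟩ := mem_oth.1 hw
    exact Or.inl (mem_bits.2 ⟨p, hp, hw⟩)
  have c2 := cost_sel (π := π) L (F := fun p => p.tree.conj p.a)
    (S := fun p => {w | w ∈ p.tree.wires}) (T := treeWires ps) (k := 2 * h + 1) (s := 2)
    (fun p hp => (PTree.conj_cost (L.tree_nodup p hp) p.a).mono (by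
      rintro w (rfl | hw)
      · exact PTree.ds_sub (L.a_mem p hp)
      · exact hw) (by have := hh p hp; omega) le_rfl)
    (fun p hp w hw => (L.wires_sub hp hw).imp id fun e => ⟨p, hp, e⟩)
    (fun p _ q _ _ h => Set.disjoint_left.2 h)
  exact ((c1.seq c2).seq c1).mono subset_rfl (by omega) (by omega)

/-- The negations serve to make the workspace of a piece clean in case all earlier bits are 1, the
only case in which its conjunction matters. -/
theorem conjPhase_spec {ps : List (Piece m)} (L : Layout ps) (π : Bool) (b : Fin m → Bool) :
    (∀ w, (∀ p ∈ ps, p.par = π → w ≠ p.a) → ev (conjPhase π ps) b w = b w) ∧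
      ∀ p ∈ ps, p.par = π → ev (conjPhase π ps) b p.a =
        xor (b p.a) (p.tree.conjVal (flp (oth π ps) b)) := by
  have hno : ∀ p ∈ ps, p.a ∉ oth π ps := fun p hp h => by
    obtain ⟨q, hq, _, h⟩ := mem_oth.1 h
    exact L.a_notMem_xs hp hq h
  obtain ⟨h1, h2⟩ := ev_flatMap_conj (qs := sel π ps)
    ((nodup_sel L).map_on fun p hp q hq => L.a_inj ((mem_sel L).1 hp).1 ((mem_sel L).1 hq).1)
    (fun p hp q hq => L.a_notMem_xs ((mem_sel L).1 hp).1 ((mem_sel L).1 hq).1)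
    (fun p hp q hq => L.a_notMem_ys ((mem_sel L).1 hp).1 ((mem_sel L).1 hq).1) (flp (oth π ps) b)
  simp only [conjPhase, ev_append, ev_nots (nodup_oth L)]
  refine ⟨fun w hw => ?_, fun p hp hpi => ?_⟩
  · have h3 := h1 w fun p hp => hw p ((mem_sel L).1 hp).1 ((mem_sel L).1 hp).2
    by_cases ho : w ∈ oth π ps
    · rw [flp_mem ho, h3, flp_mem ho, Bool.not_not]
    · rw [flp_notMem ho, h3, flp_notMem ho]
  · rw [flp_notMem (hno p hp), h2 p ((mem_sel L).2 ⟨hp, hpi⟩), flp_notMem (hno p hp)]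

/-- Compute the conjunctions of all pieces. -/
def conjAll (ps : List (Piece m)) : Circuit m := conjPhase true ps ++ conjPhase false ps

theorem conjAll_cost {ps : List (Piece m)} (L : Layout ps) {h : ℕ}
    (hh : ∀ p ∈ ps, p.tree.height ≤ h) :
    Cost (conjAll ps) (treeWires ps) (24 * h + 16) (28 * (bits ps).length) :=
  ((conjPhase_cost L hh true).seq (conjPhase_cost L hh false)).mono subset_rfl
    (by omega) (by omega)

theorem conjAll_spec {ps : List (Piece m)} (L : Layout ps) (b : Fin m → Bool) :
    (∀ w, (∀ p ∈ ps, w ≠ p.a) → ev (conjAll ps) b w = b w) ∧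
      ∀ p ∈ ps, ev (conjAll ps) b p.a =
        xor (b p.a) (p.tree.conjVal (flp (oth p.par ps) b)) := by
  rw [conjAll, ev_append]
  obtain ⟨h1, h2⟩ := conjPhase_spec L true b
  obtain ⟨h3, h4⟩ := conjPhase_spec L false (ev (conjPhase true ps) b)
  refine ⟨fun w hw => ?_, fun p hp => ?_⟩
  · rw [h3 w fun p hp _ => hw p hp, h1 w fun p hp _ => hw p hp]
  · cases hpar : p.par
    · have key : ∀ w, (∀ q ∈ ps, w ≠ q.a) →
          flp (oth false ps) (ev (conjPhase true ps) b) w = flp (oth false ps) b w := by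
        intro w hw
        simp only [flp, h1 w fun q hq _ => hw q hq]
      rw [h4 p hp hpar, h1 p.a fun q hq hq' e => by
        rw [L.a_inj hp hq e, hq'] at hpar; simp at hpar]
      congr 1
      exact PTree.conjVal_congr (fun w hw => key w fun q hq e => L.a_notMem_xs hq hp (e ▸ hw))
        (fun w hw => key w fun q hq e => L.a_notMem_ys hq hp (e ▸ hw))
    · rw [h3 p.a fun q hq hq' e => by rw [L.a_inj hp hq e, hq'] at hpar; simp at hpar,
        h2 p hp hpar]

/-! ### The ladder of carries -/

/-- The ladder that computes the carries into the pieces from the conjunctions of the pieces. -/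
def lad : Finset (Fin m) → List (Piece m) → Circuit m
  | _, [] => []
  | cs, p :: ps => gt cs p.c ++ lad {p.c, p.a} ps

/-- The carries into the pieces in terms of the cells `a`. -/
def LadOK : Bool → List (Piece m) → (Fin m → Bool) → Prop
  | _, [], _ => True
  | κ, p :: ps, b => b p.c = κ ∧ LadOK (κ && b p.a) ps b

theorem lad_tgt (cs : Finset (Fin m)) (ps : List (Piece m)) :
    Tgt (lad cs ps) {w | ∃ p ∈ ps, w = p.c} := by
  induction ps generalizing cs with
  | nil => intro g hg; simp [lad] at hg
  | cons p ps ih =>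
    refine ((gt_tgt _ _).mono ?_).append ((ih _).mono ?_)
    · rintro w rfl; exact ⟨p, List.mem_cons_self, rfl⟩
    · rintro w ⟨q, hq, e⟩; exact ⟨q, List.mem_cons_of_mem _ hq, e⟩

theorem lad_cost (cs : Finset (Fin m)) (ps : List (Piece m)) :
    Cost (lad cs ps) Set.univ ps.length ps.length := by
  induction ps generalizing cs with
  | nil => exact Cost.nil _
  | cons p ps ih =>
    exact (((gt_cost _ _).mono (Set.subset_univ _) le_rfl le_rfl).seq (ih _)).mono subset_rfl
      (by simp; omega) (by simp; omega)

/-- With `cs = ∅` the first gate is an X, which writes the carry 1 into the register; each later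
gate is a Toffoli on the previous carry and conjunction. -/
theorem lad_spec {cs : Finset (Fin m)} {ps : List (Piece m)} (hn : (ps.map Piece.c).Nodup)
    (hac : ∀ p ∈ ps, ∀ q ∈ ps, p.a ≠ q.c) (hcs : cs.card ≤ 2) (hcc : ∀ p ∈ ps, p.c ∉ cs)
    {b : Fin m → Bool} (hb : ∀ p ∈ ps, b p.c = false) :
    LadOK (decide (∀ c ∈ cs, b c = true)) ps (ev (lad cs ps) b) := by
  induction ps generalizing cs b with
  | nil => trivial
  | cons p ps ih =>
    rw [List.map_cons, List.nodup_cons] at hn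
    rw [lad, ev_append]
    set b1 := ev (gt cs p.c) b with hb1
    have f1 : ∀ w, w ≠ p.c → b1 w = b w := fun w hw => (gt_tgt _ _).ev_eq _ hw
    have g1 : b1 p.c = decide (∀ c ∈ cs, b c = true) := by
      rw [hb1, ev_gt (hcc p List.mem_cons_self) hcs, if_pos rfl, hb p List.mem_cons_self]
      simp
    have f2 : ∀ w, (∀ q ∈ ps, w ≠ q.c) → ev (lad {p.c, p.a} ps) b1 w = b1 w := fun w hw =>
      (lad_tgt _ _).ev_eq _ (by rintro ⟨q, hq, e⟩; exact hw q hq e)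
    have hpc : ∀ q ∈ ps, p.c ≠ q.c := fun q hq e => hn.1 (e ▸ List.mem_map_of_mem hq)
    have hpa : ∀ q ∈ ps, p.a ≠ q.c := fun q hq =>
      hac p List.mem_cons_self q (List.mem_cons_of_mem _ hq)
    refine ⟨by rw [f2 _ hpc, g1], ?_⟩
    have := ih hn.2 (cs := {p.c, p.a}) (b := b1)
      (fun q hq r hr => hac q (List.mem_cons_of_mem _ hq) r (List.mem_cons_of_mem _ hr))
      Finset.card_le_two (fun q hq => by
        simp only [Finset.mem_insert, Finset.mem_singleton, not_or]
        exact ⟨(hpc q hq).symm, (hpa q hq).symm⟩)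
      (fun q hq => by rw [f1 _ (hpc q hq).symm]; exact hb q (List.mem_cons_of_mem _ hq))
    rw [f2 _ hpa, ← g1]
    convert this using 1
    simp

/-- Compute the carries into all the pieces. -/
def carries (ps : List (Piece m)) : Circuit m := conjAll ps ++ lad ∅ ps ++ (conjAll ps).reverse

theorem carries_cost {ps : List (Piece m)} (L : Layout ps) {h : ℕ}
    (hh : ∀ p ∈ ps, p.tree.height ≤ h) :
    Cost (carries ps) Set.univ (48 * h + 32 + ps.length) (56 * (bits ps).length + ps.length) := by
  have c := (conjAll_cost L hh).mono (Set.subset_univ _) le_rfl le_rfl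
  exact ((c.seq (lad_cost _ _)).seq c.reverse).mono subset_rfl (by omega) (by omega)

theorem carries_spec {ps : List (Piece m)} (L : Layout ps) {b : Fin m → Bool}
    (ha : ∀ p ∈ ps, b p.a = false) (hc : ∀ p ∈ ps, b p.c = false) :
    CarryOK true ps (ev (carries ps) b) ∧
      ∀ w, (∀ p ∈ ps, w ≠ p.c) → ev (carries ps) b w = b w := by
  obtain ⟨a1, a2⟩ := conjAll_spec L b
  have hon : On (conjAll ps) (treeWires ps) :=
    (conjAll_cost L (h := (ps.map fun p => p.tree.height).sum)
      (fun p hp => List.single_le_sum (by simp) _ (List.mem_map_of_mem hp))).on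
  have hdis : Disjoint (treeWires ps) {w | ∃ p ∈ ps, w = p.c} := by
    rw [Set.disjoint_right]
    rintro w ⟨p, hp, rfl⟩ (h | ⟨q, hq, h⟩)
    · exact L.c_bits p hp h
    · exact L.a_ne_c hq hp h.symm
  have key := ev_conj hon (lad_tgt ∅ ps) hdis b
  set s1 := ev (conjAll ps) b with hs1
  have f2 : ∀ w, (∀ q ∈ ps, w ≠ q.c) → ev (lad ∅ ps) s1 w = s1 w := fun w hw =>
    (lad_tgt _ _).ev_eq _ (by rintro ⟨q, hq, e⟩; exact hw q hq e)
  have hL := lad_spec (cs := ∅) (ps := ps) (b := s1)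
    (List.nodup_append.1 (List.nodup_append.1 L.cells_nodup).2.1).1
    (fun p hp q hq => L.a_ne_c hp hq) (by simp) (by simp)
    (fun p hp => by rw [a1 _ fun q hq e => L.a_ne_c hq hp e.symm, hc p hp])
  simp only [Finset.notMem_empty, false_imp_iff, implies_true, decide_true] at hL
  have hfr : ∀ w, (∀ p ∈ ps, w ≠ p.c) → ev (carries ps) b w = b w := fun w hw => by
    by_cases hw' : w ∈ treeWires ps
    · exact (key w).1 hw'
    · rw [carries, (key w).2 hw', f2 w hw, a1 w fun p hp e => hw' (Or.inr ⟨p, hp, e⟩)]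
  refine ⟨?_, hfr⟩
  have hcv : ∀ p ∈ ps, ev (carries ps) b p.c = ev (lad ∅ ps) s1 p.c := fun p hp =>
    (key p.c).2 fun h => Set.disjoint_left.1 hdis h ⟨p, hp, rfl⟩
  have hbits : ∀ w ∈ bits ps, ev (carries ps) b w = b w := fun w hw =>
    hfr w fun p hp e => L.c_bits p hp (e ▸ hw)
  have hav : ∀ p ∈ ps, ev (lad ∅ ps) s1 p.a = p.tree.conjVal (flp (oth p.par ps) b) :=
    fun p hp => by rw [f2 _ fun q hq => L.a_ne_c hp hq, a2 p hp, ha p hp, Bool.false_xor]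
  have main : ∀ (l r : List (Piece m)), ps = l ++ r →
      LadOK ((bits l).all b) r (ev (lad ∅ ps) s1) →
      CarryOK ((bits l).all b) r (ev (carries ps) b) := by
    intro l r
    induction r generalizing l with
    | nil => intros; trivial
    | cons p r ih =>
      intro e hr
      have hp : p ∈ ps := by rw [e]; simp
      refine ⟨by rw [hcv p hp]; exact hr.1, ?_⟩
      have hall : p.xs.all (ev (carries ps) b) = p.xs.all b :=
        all_congr fun w hw => hbits w (mem_bits.2 ⟨p, hp, hw⟩)
      have e2 : (bits (l ++ [p])).all b = ((bits l).all b && p.xs.all b) := by simp [bits]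
      -- If some earlier bit is 0, the carry dies whatever junk `p.a` contains. If all are 1, the
      -- negated workspace is clean and `p.a` holds the true conjunction.
      have e3 : ((bits l).all b && ev (lad ∅ ps) s1 p.a) = ((bits l).all b && p.xs.all b) := by
        by_cases hl : (bits l).all b = true
        · rw [hl, Bool.true_and, Bool.true_and, hav p hp]
          have hx : ∀ w ∈ p.xs, flp (oth p.par ps) b w = b w := fun w hw => by
            refine flp_notMem fun h => ?_
            obtain ⟨q, hq, hqp, hwq⟩ := mem_oth.1 h
            rw [L.eq_of_mem hp hq hw hwq] at hqp
            simp at hqp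
          rw [PTree.conjVal_clean (L.tree_nodup p hp), all_congr hx]
          intro w hw
          have hwd := PTree.distinct (L.tree_nodup p hp)
          rcases L.work l p r e w (PTree.ys_sub hw) with h | h | ⟨q, hq, hqp, h⟩
          · exact absurd hw (hwd.xs_ys w h)
          · exact absurd hw (h ▸ hwd.ds_ys _ (L.a_mem p hp))
          · have hqps : q ∈ ps := by rw [e]; exact List.mem_append_left _ hq
            rw [flp_mem (mem_oth.2 ⟨q, hqps, by cases h1 : q.par <;> cases h2 : p.par <;> simp_all,
              h⟩), List.all_eq_true.1 hl w (mem_bits.2 ⟨q, hq, h⟩)]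
            rfl
        · simp only [Bool.not_eq_true] at hl
          simp [hl]
      rw [hall, ← e2]
      refine ih (l ++ [p]) (by simp [e]) ?_
      rw [e2, ← e3]
      exact hr.2
  exact main [] ps rfl (by simpa using hL)

/-! ### Incrementing all pieces -/

/-- Running controlled increments on pieces that do not interfere. -/
theorem ev_flatMap_core {qs : List (Piece m)} {core : Piece m → Circuit m}
    (h0 : ∀ p ∈ qs, ∀ b, b p.v = false → ev (core p) b = b)
    (h1 : ∀ p ∈ qs, ∀ b, b p.v = true → (∀ w ∈ p.tree.wires, w ∉ p.xs → b w = false) →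
      ev (core p) b = addc p.xs true b)
    (hn : qs.Nodup) (hd : ∀ p ∈ qs, ∀ q ∈ qs, p ≠ q → ∀ w ∈ p.xs, w ∉ q.tree.wires)
    (hv : ∀ p ∈ qs, ∀ q ∈ qs, p.v ∉ q.xs) {b : Fin m → Bool}
    (hb : ∀ p ∈ qs, b p.v = true → ∀ w ∈ p.tree.wires, w ∉ p.xs → b w = false) :
    (∀ w, w ∉ bits qs → ev (qs.flatMap core) b w = b w) ∧
      ∀ p ∈ qs, ∀ w ∈ p.xs, ev (qs.flatMap core) b w = addc p.xs (b p.v) b w := by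
  induction qs generalizing b with
  | nil => simp
  | cons q qs ih =>
    have hq : q ∈ q :: qs := List.mem_cons_self
    have tl : ∀ {p}, p ∈ qs → p ∈ q :: qs := List.mem_cons_of_mem q
    rw [List.nodup_cons] at hn
    have hne : ∀ p ∈ qs, q ≠ p := fun p hp e => hn.1 (e ▸ hp)
    have e1 : ev (core q) b = addc q.xs (b q.v) b := by
      cases hc : b q.v
      · rw [h0 q hq b hc, addc_false]
      · exact h1 q hq b hc (hb q hq hc)
    rw [List.flatMap_cons, ev_append, e1]
    set b1 := addc q.xs (b q.v) b with hb1
    have f1 : ∀ w, w ∉ q.xs → b1 w = b w := fun w hw => addc_notMem hw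
    obtain ⟨i1, i2⟩ := ih (fun p hp => h0 p (tl hp)) (fun p hp => h1 p (tl hp)) hn.2
      (fun p hp r hr => hd p (tl hp) r (tl hr)) (fun p hp r hr => hv p (tl hp) r (tl hr)) (b := b1)
      (fun p hp hpv w hw hwx => by
        rw [f1 _ (hv p (tl hp) q hq)] at hpv
        rw [f1 w fun h => hd q hq p (tl hp) (hne p hp) w h hw]
        exact hb p (tl hp) hpv w hw hwx)
    refine ⟨fun w hw => ?_, fun p hp w hw => ?_⟩
    · have hw' : w ∉ q.xs ∧ w ∉ bits qs := by simpa [bits] using hw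
      rw [i1 w hw'.2, f1 w hw'.1]
    · rcases List.mem_cons.1 hp with rfl | hp'
      · refine i1 w fun h => ?_
        obtain ⟨r, hr, hwr⟩ := mem_bits.1 h
        exact hd p hq r (tl hr) (hne r hr) w hw (PTree.xs_sub hwr)
      · rw [i2 p hp' w hw, f1 _ (hv p hp q hq)]
        exact addc_congr (fun v hv => f1 v fun h =>
          hd q hq p hp (hne p hp') v h (PTree.xs_sub hv)) w hw

/-- Add the carries `v` to all pieces. -/
theorem exists_addCarries {ps : List (Piece m)} (L : Layout ps) {h : ℕ}
    (hh : ∀ p ∈ ps, p.tree.height ≤ h) :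
    ∃ Q, Cost Q Set.univ (168 * h + 74) (242 * (bits ps).length) ∧ Tgt Q (treeWires ps) ∧
      (∀ b, (∀ p ∈ ps, b p.v = false) → ev Q b = b) ∧
      ∀ b, CarryOK true ps b → (∀ p ∈ ps, b p.v = b p.c) → (∀ p ∈ ps, b p.a = false) →
        ev Q b = addc (bits ps) true b := by
  have hex : ∀ p : Piece m, ∃ C : Circuit m, p ∈ ps →
      Cost C {w | w = p.v ∨ w ∈ p.tree.wires} (14 * h + 6) (20 * p.xs.length) ∧
      Tgt C {w | w ∈ p.tree.wires} ∧ (∀ b, b p.v = false → ev C b = b) ∧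
      ∀ b, b p.v = true → (∀ w ∈ p.tree.wires, w ∉ p.xs → b w = false) →
        ev C b = addc p.xs true b := by
    intro p
    by_cases hp : p ∈ ps
    · have hn := L.tree_nodup p hp
      have hD := PTree.distinct hn
      obtain ⟨C, c1, c2, c3, c4⟩ := PTree.exists_core hn (L.v_notMem hp hp)
      refine ⟨C, fun _ => ⟨c1.mono subset_rfl (by have := hh p hp; omega) le_rfl, c2, c3,
        fun b hb hw => c4 b hb ?_ ?_ ?_⟩⟩
      · exact fun w h => hw w (PTree.ds_sub h) fun h' => hD.xs_ds w h' h
      · exact fun w h => hw w (PTree.ys_sub h) fun h' => hD.xs_ys w h' h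
      · exact fun w h => hw w (PTree.ts_sub h) fun h' => hD.xs_ts w h' h
    · exact ⟨[], fun h => absurd h hp⟩
  choose core hcore using hex
  have hphase : ∀ π, Cost ((sel π ps).flatMap core) Set.univ (6 * (14 * h + 6))
      (6 * (20 * (bits ps).length)) := fun π =>
    cost_sel L (fun p hp => (hcore p hp).1) (fun _ _ => Set.subset_univ _)
      fun p hp q hq hpq hw => by
        rw [Set.disjoint_left]
        rintro w (rfl | h) (e | h')
        · exact hpq (L.v_inj hp hq e)
        · exact L.v_notMem hp hq h'
        · exact L.v_notMem hq hp (e ▸ h)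
        · exact hw w h h'
  have hnots : Cost (nots (oth true ps)) Set.univ 1 (bits ps).length :=
    (nots_cost (nodup_oth L)).mono (Set.subset_univ _) le_rfl (oth_length_le _ _)
  have hnt : Tgt (nots (oth true ps)) (treeWires ps) :=
    (nots_cost (nodup_oth L)).on.tgt.mono fun w hw => by
      obtain ⟨p, hp, _, hw⟩ := mem_oth.1 hw
      exact Or.inl (mem_bits.2 ⟨p, hp, hw⟩)
  have hpt : ∀ π, Tgt ((sel π ps).flatMap core) (treeWires ps) := fun π g hg => by
    obtain ⟨p, hp, hg⟩ := List.mem_flatMap.1 hg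
    have hp' := ((mem_sel L).1 hp).1
    exact (L.wires_sub hp' ((hcore p hp').2.1 g hg)).imp id fun e => ⟨p, hp', e⟩
  have spec : ∀ (π : Bool) (b : Fin m → Bool),
      (∀ p ∈ ps, p.par = π → b p.v = true → ∀ w ∈ p.tree.wires, w ∉ p.xs → b w = false) →
      (∀ w, (∀ p ∈ ps, p.par = π → w ∉ p.xs) → ev ((sel π ps).flatMap core) b w = b w) ∧
      ∀ p ∈ ps, p.par = π → ∀ w ∈ p.xs,
        ev ((sel π ps).flatMap core) b w = addc p.xs (b p.v) b w := by
    intro π b hb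
    have mem : ∀ {p}, p ∈ sel π ps → p ∈ ps ∧ p.par = π := fun h => (mem_sel L).1 h
    obtain ⟨i1, i2⟩ := ev_flatMap_core (qs := sel π ps) (core := core)
      (fun p hp => (hcore p (mem hp).1).2.2.1) (fun p hp => (hcore p (mem hp).1).2.2.2)
      (nodup_sel L)
      (fun p hp q hq hpq => L.xs_wires (mem hp).1 (mem hq).1 hpq
        ((mem hp).2.trans (mem hq).2.symm))
      (fun p hp q hq h => L.v_bits p (mem hp).1 (mem_bits.2 ⟨q, (mem hq).1, h⟩))
      (b := b) (fun p hp => hb p (mem hp).1 (mem hp).2)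
    refine ⟨fun w hw => i1 w fun h => ?_, fun p hp hpi => i2 p ((mem_sel L).2 ⟨hp, hpi⟩)⟩
    obtain ⟨p, hp, h⟩ := mem_bits.1 h
    exact hw p (mem hp).1 (mem hp).2 h
  have hoth : ∀ w, w ∉ bits ps → w ∉ oth true ps := fun w hw h => by
    obtain ⟨p, hp, _, h⟩ := mem_oth.1 h
    exact hw (mem_bits.2 ⟨p, hp, h⟩)
  -- Only the first parity needs negations: a piece that receives a carry finds ones in its
  -- workspace, which is not yet incremented. The workspace of the second parity has already been
  -- incremented, which turned these ones into zeros.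
  refine ⟨nots (oth true ps) ++ ((sel true ps).flatMap core ++ (nots (oth true ps) ++
    (sel false ps).flatMap core)), ?_, ?_, fun b hb => ?_, fun b hC hvc ha => ?_⟩
  · exact (hnots.seq ((hphase true).seq (hnots.seq (hphase false)))).mono subset_rfl
      (by omega) (by omega)
  · exact hnt.append ((hpt true).append (hnt.append (hpt false)))
  · have id : ∀ (π : Bool) (s : Fin m → Bool), (∀ p ∈ ps, s p.v = false) →
        ev ((sel π ps).flatMap core) s = s := by
      intro π s hs
      obtain ⟨i1, i2⟩ := spec π s fun p hp _ h => by rw [hs p hp] at h; simp at h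
      funext w
      by_cases hw : ∃ p ∈ ps, p.par = π ∧ w ∈ p.xs
      · obtain ⟨p, hp, hpi, hw⟩ := hw
        rw [i2 p hp hpi w hw, hs p hp, addc_false]
      · push Not at hw
        exact i1 w hw
    simp only [ev_append, ev_nots (nodup_oth L)]
    rw [id true _ fun p hp => by rw [flp_notMem (hoth _ (L.v_bits p hp)), hb p hp], flp_flp,
      id false _ hb]
  · simp only [ev_append, ev_nots (nodup_oth L)]
    have hone : ∀ l p r, ps = l ++ p :: r → b p.v = true → ∀ q ∈ l, ∀ w ∈ q.xs, b w = true := by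
      intro l p r e hpv q hq w hw
      have hp : p ∈ ps := by rw [e]; simp
      have h1 : b p.c = (true && (bits l).all b) := CarryOK.split (e ▸ hC)
      rw [← hvc p hp, hpv, Bool.true_and] at h1
      exact List.all_eq_true.1 h1.symm w (mem_bits.2 ⟨q, hq, hw⟩)
    have hxo : ∀ p ∈ ps, p.par = true → ∀ w ∈ p.xs, w ∉ oth true ps := fun p hp hpt w hw h => by
      obtain ⟨q, hq, hqp, hwq⟩ := mem_oth.1 h
      rw [L.eq_of_mem hp hq hw hwq, hqp] at hpt
      simp at hpt
    set s1 := flp (oth true ps) b with hs1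
    have v1 : ∀ p ∈ ps, s1 p.v = b p.v := fun p hp => flp_notMem (hoth _ (L.v_bits p hp))
    obtain ⟨i1, i2⟩ := spec true s1 fun p hp hpt hpv w hw hwx => by
      rw [v1 p hp] at hpv
      obtain ⟨l, r, e⟩ := List.append_of_mem hp
      rcases L.work l p r e w hw with h | rfl | ⟨q, hq, hqp, h⟩
      · exact absurd h hwx
      · rw [hs1, flp_notMem (hoth _ (L.a_bits p hp)), ha p hp]
      · have hq' : q ∈ ps := by rw [e]; exact List.mem_append_left _ hq
        rw [hs1, flp_mem (mem_oth.2 ⟨q, hq', by simpa [hpt] using hqp, h⟩),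
          hone l p r e hpv q hq w h]
        rfl
    set s2 := ev ((sel true ps).flatMap core) s1 with hs2
    set s3 := flp (oth true ps) s2 with hs3
    have t3 : ∀ p ∈ ps, p.par = true → ∀ w ∈ p.xs, s3 w = addc p.xs (b p.v) b w := by
      intro p hp hpt w hw
      rw [hs3, flp_notMem (hxo p hp hpt w hw), i2 p hp hpt w hw, v1 p hp]
      exact addc_congr (fun v hv => flp_notMem (hxo p hp hpt v hv)) w hw
    have f3 : ∀ w, (∀ p ∈ ps, p.par = true → w ∉ p.xs) → s3 w = b w := by
      intro w hw
      have := i1 w hw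
      by_cases ho : w ∈ oth true ps
      · rw [hs3, flp_mem ho, this, hs1, flp_mem ho, Bool.not_not]
      · rw [hs3, flp_notMem ho, this, hs1, flp_notMem ho]
    have nb : ∀ w, w ∉ bits ps → s3 w = b w := fun w hw =>
      f3 w fun p hp _ h => hw (mem_bits.2 ⟨p, hp, h⟩)
    have g3 : ∀ p ∈ ps, p.par = false → ∀ w ∈ p.xs, s3 w = b w := fun p hp hpf w hw =>
      f3 w fun q hq hqt h => by
        rw [L.eq_of_mem hp hq hw h, hqt] at hpf; simp at hpf
    obtain ⟨j1, j2⟩ := spec false s3 fun p hp hpf hpv w hw hwx => by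
      rw [nb _ (L.v_bits p hp)] at hpv
      obtain ⟨l, r, e⟩ := List.append_of_mem hp
      rcases L.work l p r e w hw with h | rfl | ⟨q, hq, hqp, h⟩
      · exact absurd h hwx
      · rw [nb _ (L.a_bits p hp), ha p hp]
      · have hq' : q ∈ ps := by rw [e]; exact List.mem_append_left _ hq
        have hqt : q.par = true := by simpa [hpf] using hqp
        -- The carry that reaches `p` has passed through `q`.
        have hqv : b q.v = true := by
          obtain ⟨l1, l2, rfl⟩ := List.append_of_mem hq
          rw [hvc q hq', CarryOK.split (b := b) (l := l1) (p := q) (r := l2 ++ p :: r) (κ := true)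
            (by simpa [e] using hC), Bool.true_and, List.all_eq_true]
          intro u hu
          obtain ⟨q', hq1, hu⟩ := mem_bits.1 hu
          exact hone _ p r e hpv q' (List.mem_append_left _ hq1) u hu
        rw [t3 q hq' hqt w h, hqv]
        exact addc_true_of_all (PTree.distinct (L.tree_nodup q hq')).nodup_xs
          (List.all_eq_true.2 (hone l p r e hpv q hq)) w h
    funext w
    by_cases hw : w ∈ bits ps
    · obtain ⟨p, hp, hwp⟩ := mem_bits.1 hw
      rw [hC.addc_eq L.bits_nodup hp hwp, ← hvc p hp]
      cases hpar : p.par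
      · rw [j2 p hp hpar w hwp, nb _ (L.v_bits p hp)]
        exact addc_congr (fun v hv => g3 p hp hpar v hv) w hwp
      · rw [j1 w, t3 p hp hpar w hwp]
        intro q hq hqf h
        rw [L.eq_of_mem hp hq hwp h, hqf] at hpar; simp at hpar
    · rw [addc_notMem hw, j1 w fun p hp _ h => hw (mem_bits.2 ⟨p, hp, h⟩), nb w hw]

/-! ### Controlled increment of a register cut into pieces -/

/-- Copy the carries to the cells `v`, controlled by `z`. -/
def copyCarries (z : Fin m) (ps : List (Piece m)) : Circuit m :=
  ps.flatMap fun p => gt {z, p.c} p.v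

theorem copyCarries_cost (z : Fin m) (ps : List (Piece m)) :
    Cost (copyCarries z ps) Set.univ ps.length ps.length := by
  refine (Cost.flatMap_seq (S := Set.univ) (k := 1) (s := fun _ => 1)
    fun p _ => (gt_cost _ _).mono (Set.subset_univ _) le_rfl le_rfl).mono subset_rfl
    (by simp) (by simp)

theorem copyCarries_tgt (z : Fin m) (ps : List (Piece m)) :
    Tgt (copyCarries z ps) {w | ∃ p ∈ ps, w = p.v} := fun g hg => by
  obtain ⟨p, hp, hg⟩ := List.mem_flatMap.1 hg
  exact ⟨p, hp, gt_tgt _ _ g hg⟩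

theorem ev_copyCarries_false {z : Fin m} {ps : List (Piece m)} {b : Fin m → Bool}
    (hb : b z = false) : ev (copyCarries z ps) b = b := by
  induction ps with
  | nil => rfl
  | cons p ps ih =>
    rw [copyCarries, List.flatMap_cons, ev_append, ev_gt_of_false (c := z) (by simp) _ hb]
    exact ih

theorem ev_copyCarries {z : Fin m} {ps : List (Piece m)} (hn : (ps.map Piece.v).Nodup)
    (hz : ∀ p ∈ ps, z ≠ p.v) (hcv : ∀ p ∈ ps, ∀ q ∈ ps, p.c ≠ q.v) {b : Fin m → Bool}
    (hb : b z = true) :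
    (∀ p ∈ ps, ev (copyCarries z ps) b p.v = xor (b p.v) (b p.c)) := by
  induction ps generalizing b with
  | nil => simp
  | cons p ps ih =>
    rw [List.map_cons, List.nodup_cons] at hn
    have e1 := ev_gt (cs := {z, p.c}) (t := p.v)
      (by
        simp only [Finset.mem_insert, Finset.mem_singleton, not_or]
        exact ⟨(hz p List.mem_cons_self).symm,
          (hcv p List.mem_cons_self p List.mem_cons_self).symm⟩)
      Finset.card_le_two b
    have h1 : copyCarries z (p :: ps) = gt {z, p.c} p.v ++ copyCarries z ps := rfl
    rw [h1, ev_append]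
    set b1 := ev (gt {z, p.c} p.v) b
    have f1 : ∀ w, w ≠ p.v → b1 w = b w := fun w hw => by rw [e1, if_neg hw]
    intro q hq
    rcases List.mem_cons.1 hq with rfl | hq'
    · rw [(copyCarries_tgt z ps).ev_eq, e1, if_pos rfl]
      · simp [hb]
      · rintro ⟨r, hr, e⟩
        exact hn.1 (e ▸ List.mem_map_of_mem hr)
    · rw [ih hn.2 (fun r hr => hz r (List.mem_cons_of_mem _ hr))
        (fun r hr t ht => hcv r (List.mem_cons_of_mem _ hr) t (List.mem_cons_of_mem _ ht))
        (by rw [f1 z (hz p List.mem_cons_self), hb]) q hq',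
        f1 _ fun e => hn.1 (e ▸ List.mem_map_of_mem hq'),
        f1 _ (hcv q hq p List.mem_cons_self)]

/-- An increment of a register decomposed into pieces, controlled by `z`: correct if the cells of
the pieces are clean, and without any effect if `z` is not set. -/
theorem exists_ctrlInc {ps : List (Piece m)} (L : Layout ps) {z : Fin m} (hz : z ∉ bits ps)
    (hza : ∀ p ∈ ps, z ≠ p.a) (hzc : ∀ p ∈ ps, z ≠ p.c) (hzv : ∀ p ∈ ps, z ≠ p.v) {h : ℕ}
    (hh : ∀ p ∈ ps, p.tree.height ≤ h) (hN : (bits ps).length ≤ 2 ^ h) :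
    ∃ F, Cost F Set.univ (500 * (h + ps.length + 1)) (700 * ((bits ps).length + ps.length + 1)) ∧
      (∀ b, ev F b z = b z) ∧ (∀ b, b z = false → ev F b = b) ∧
      ∀ b, b z = true → (∀ p ∈ ps, b p.a = false ∧ b p.c = false ∧ b p.v = false) →
        ev F b = addc (bits ps) true b := by
  obtain ⟨Q, q1, q2, q3, q4⟩ := exists_addCarries L hh
  obtain ⟨X, x1, x2, x3⟩ := exists_fan h L.bits_nodup hz hN
  have x4 := ev_reverse_of_fan hz x3
  set P := carries ps with hP
  set V := copyCarries z ps with hV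
  have cP : Cost P _ _ _ := carries_cost L hh
  have cV : Cost V _ _ _ := copyCarries_cost z ps
  have cX := x1.mono (Set.subset_univ _) le_rfl le_rfl
  have hzT : z ∉ treeWires ps := by
    rintro (h | ⟨p, hp, h⟩)
    · exact hz h
    · exact hza p hp h
  have tP : Tgt P {w | w ≠ z} := by
    have c1 : Tgt (conjAll ps) {w | w ≠ z} :=
      (conjAll_cost L hh).on.tgt.mono fun w hw e => hzT (e ▸ hw)
    have c2 : Tgt (lad ∅ ps) {w | w ≠ z} := (lad_tgt ∅ ps).mono (by
      rintro w ⟨p, hp, e⟩ e'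
      exact hzc p hp (e'.symm.trans e))
    exact (c1.append c2).append c1.reverse
  have tV : Tgt V {w | w ≠ z} := (copyCarries_tgt z ps).mono (by
    rintro w ⟨p, hp, e⟩ e'
    exact hzv p hp (e'.symm.trans e))
  have tQ : Tgt Q {w | w ≠ z} := q2.mono fun w hw e => hzT (e ▸ hw)
  have tX : Tgt X {w | w ≠ z} := x2.mono fun w hw e => hz (e ▸ hw)
  have nz : z ∉ {w : Fin m | w ≠ z} := fun h => h rfl
  -- The scheme of `PTree.exists_core` again: `V` copies the carries if `z` is set, `Q` adds the
  -- copies, the second `V` clears them so that Q⁻¹ is idle, and P⁻¹ on the complemented sum erases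
  -- the carries. If `z` is unset, `V` and `X` are idle and the rest cancels.
  refine ⟨P ++ (V ++ (Q ++ (V ++ (Q.reverse ++ (X ++ (P.reverse ++ X.reverse)))))), ?_,
    fun b => ?_, fun b hb => ?_, fun b hb hc => ?_⟩
  · exact (cP.seq (cV.seq (q1.seq (cV.seq (q1.reverse.seq (cX.seq
      (cP.reverse.seq cX.reverse))))))).mono subset_rfl (by omega) (by omega)
  · exact (tP.append (tV.append (tQ.append (tV.append (tQ.reverse.append (tX.append
      (tP.reverse.append tX.reverse))))))).ev_eq b nz
  · simp only [ev_append]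
    have e1 : ev P b z = false := by rw [tP.ev_eq b nz, hb]
    have e2 : ev Q (ev P b) z = false := by rw [tQ.ev_eq _ nz, e1]
    rw [ev_copyCarries_false e1, ev_copyCarries_false e2, ev_reverse_ev, x3, e1]
    simp only [Bool.false_eq_true, if_false, ev_reverse_ev, x4, hb]
  · simp only [ev_append]
    obtain ⟨p1, p2⟩ := carries_spec L (fun p hp => (hc p hp).1) fun p hp => (hc p hp).2.1
    set s1 := ev P b with hs1
    have z1 : s1 z = true := by rw [p2 z hzc, hb]
    have nodv := (List.nodup_append.1 (List.nodup_append.1 L.cells_nodup).2.1).2.1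
    have v1 : ∀ p ∈ ps, s1 p.v = false := fun p hp => by
      rw [p2 _ fun q hq => (L.c_ne_v hq hp).symm, (hc p hp).2.2]
    have a1 : ∀ p ∈ ps, s1 p.a = false := fun p hp => by
      rw [p2 _ fun q hq => L.a_ne_c hp hq, (hc p hp).1]
    set s2 := ev V s1 with hs2
    have f2 : ∀ w, (∀ p ∈ ps, w ≠ p.v) → s2 w = s1 w := fun w hw =>
      (copyCarries_tgt z ps).ev_eq _ (by rintro ⟨p, hp, e⟩; exact hw p hp e)
    have c2 : ∀ p ∈ ps, s2 p.c = s1 p.c := fun p hp => f2 _ fun q hq => L.c_ne_v hp hq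
    have b2 : ∀ w ∈ bits ps, s2 w = s1 w := fun w hw =>
      f2 w fun q hq e => L.v_bits q hq (e ▸ hw)
    have v2 : ∀ p ∈ ps, s2 p.v = s2 p.c := fun p hp => by
      rw [hs2, ev_copyCarries nodv hzv (fun p hp q hq => L.c_ne_v hp hq) z1 p hp, v1 p hp, ← hs2,
        c2 p hp, Bool.false_xor]
    have a2 : ∀ p ∈ ps, s2 p.a = false := fun p hp => by
      rw [f2 _ fun q hq => L.a_ne_v hp hq, a1 p hp]
    have OK2 : CarryOK true ps s2 :=
      p1.congr (fun p hp => (c2 p hp).symm) fun w hw => (b2 w hw).symm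
    rw [q4 s2 OK2 v2 a2]
    have e3 : ev V (addc (bits ps) true s2) = addc (bits ps) true s1 := by
      funext w
      by_cases hwv : ∃ p ∈ ps, w = p.v
      · obtain ⟨p, hp, rfl⟩ := hwv
        rw [ev_copyCarries nodv hzv (fun p hp q hq => L.c_ne_v hp hq)
          (by rw [addc_notMem hz, f2 z hzv, z1]) p hp, addc_notMem (L.v_bits p hp),
          addc_notMem (L.c_bits p hp), addc_notMem (L.v_bits p hp), v2 p hp, v1 p hp, Bool.xor_self]
      · rw [(copyCarries_tgt z ps).ev_eq _ hwv]
        push Not at hwv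
        by_cases hwb : w ∈ bits ps
        · exact addc_congr b2 w hwb
        · rw [addc_notMem hwb, addc_notMem hwb, f2 w hwv]
    have e4 : ev Q.reverse (addc (bits ps) true s1) = addc (bits ps) true s1 := by
      apply ev_injective Q
      rw [ev_ev_reverse, q3]
      intro p hp
      rw [addc_notMem (L.v_bits p hp), v1 p hp]
    rw [e3, e4, x3, if_pos (by rw [addc_notMem hz, z1])]
    set s4 := flp (bits ps) (addc (bits ps) true b) with hs4
    have n4 : ∀ w, w ∉ bits ps → s4 w = b w := fun w hw => by
      rw [hs4, flp_notMem hw, addc_notMem hw]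
    obtain ⟨r1, r2⟩ := carries_spec L (b := s4)
      (fun p hp => by rw [n4 _ (L.a_bits p hp), (hc p hp).1])
      (fun p hp => by rw [n4 _ (L.c_bits p hp), (hc p hp).2.1])
    have b1 : ∀ w ∈ bits ps, s1 w = b w := fun w hw => p2 w fun p hp e => L.c_bits p hp (e ▸ hw)
    have e5 : ∀ w, (∀ p ∈ ps, w ≠ p.c) → flp (bits ps) (addc (bits ps) true s1) w = s4 w := by
      intro w hw
      by_cases hwb : w ∈ bits ps
      · rw [hs4, flp_mem hwb, flp_mem hwb, addc_congr b1 w hwb]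
      · rw [n4 w hwb, flp_notMem hwb, addc_notMem hwb, p2 w hw]
    have e6 : flp (bits ps) (addc (bits ps) true s1) = ev P s4 := by
      funext w
      by_cases hwc : ∃ p ∈ ps, w = p.c
      · obtain ⟨p, hp, rfl⟩ := hwc
        refine (p1.flp_addc L.bits_nodup L.c_bits).unique r1 (fun w hw => ?_) p hp
        have hwc : ∀ p ∈ ps, w ≠ p.c := fun p hp e => L.c_bits p hp (e ▸ hw)
        rw [e5 w hwc, r2 w hwc]
      · push Not at hwc
        rw [e5 w hwc, r2 w hwc]
    rw [e6, ev_reverse_ev, x4, if_pos (by rw [n4 z hz, hb]), hs4, flp_flp]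

/-! ### Existence of decompositions -/

/-- A balanced tree over a register, with a given list of cells as workspace. -/
theorem PTree.exists_tree {α : Type*} (k : ℕ) : ∀ (xs : List α) (d : α) (cs : List α),
    0 < xs.length → xs.length ≤ 2 ^ k → cs.length = 3 * (xs.length - 1) →
    ∃ T : PTree α, T.xs = xs ∧ d ∈ T.ds ∧ T.height ≤ k ∧ T.wires.Perm (xs ++ d :: cs) := by
  have base : ∀ (xs : List α) (d : α) (cs : List α), xs.length = 1 →
      cs.length = 3 * (xs.length - 1) →
      ∃ T : PTree α, T.xs = xs ∧ d ∈ T.ds ∧ T.height = 0 ∧ T.wires.Perm (xs ++ d :: cs) := by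
    intro xs d cs h h'
    obtain ⟨x, rfl⟩ := List.length_eq_one_iff.1 h
    obtain rfl : cs = [] := List.eq_nil_of_length_eq_zero (by simpa using h')
    exact ⟨leaf x d, rfl, by simp [ds], rfl, by simp [wires]⟩
  induction k with
  | zero =>
    intro xs d cs h0 h1 h2
    obtain ⟨T, t1, t2, t3, t4⟩ := base xs d cs (by simp at h1; omega) h2
    exact ⟨T, t1, t2, t3.le, t4⟩
  | succ k ih =>
    intro xs d cs h0 h1 h2
    by_cases hs : xs.length ≤ 2 ^ k
    · obtain ⟨T, t1, t2, t3, t4⟩ := ih xs d cs h0 hs h2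
      exact ⟨T, t1, t2, by omega, t4⟩
    have hpos : 1 ≤ 2 ^ k := Nat.one_le_two_pow
    rw [pow_succ] at h1
    obtain ⟨l, r, rfl, hl, hr⟩ : ∃ l r, xs = l ++ r ∧ l.length = 2 ^ k ∧ 0 < r.length :=
      ⟨xs.take (2 ^ k), xs.drop (2 ^ k), (List.take_append_drop _ _).symm,
        by rw [List.length_take]; omega, by rw [List.length_drop]; omega⟩
    rw [List.length_append] at h1 h2
    -- An inner node consumes three cells: its own `y` and `t`, and `e`, which plays in the right
    -- subtree the part that `d` plays in the left one. Hence 3 * (number of leaves - 1) cells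
    -- besides `d`.
    rcases cs with _ | ⟨y, _ | ⟨t, _ | ⟨e, cs⟩⟩⟩
    · simp at h2; omega
    · simp at h2; omega
    · simp at h2; omega
    simp only [List.length_cons] at h2
    obtain ⟨cl, cr, rfl, hcl⟩ : ∃ cl cr, cs = cl ++ cr ∧ cl.length = 3 * (l.length - 1) :=
      ⟨cs.take (3 * (l.length - 1)), cs.drop (3 * (l.length - 1)), (List.take_append_drop _ _).symm,
        by rw [List.length_take]; omega⟩
    rw [List.length_append] at h2
    obtain ⟨A, a1, a2, a3, a4⟩ := ih l d cl (by omega) hl.le hcl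
    obtain ⟨B, b1, b2, b3, b4⟩ := ih r e cr hr (by omega) (by omega)
    refine ⟨node y t A B, by simp [xs, a1, b1], by simp [ds, a2], by simp [height, a3, b3], ?_⟩
    classical
    rw [List.perm_iff_count] at a4 b4 ⊢
    intro w
    have h3 := a4 w
    have h4 := b4 w
    simp only [wires, List.count_append, List.count_cons] at h3 h4 ⊢
    omega

/-- A list of pieces with given cells. -/
structure Shape (u v w : ℕ → Fin m) (h : ℕ) (ps : List (Piece m)) : Prop where
  a_eq : ps.map Piece.a = (List.range ps.length).map u
  c_eq : ps.map Piece.c = (List.range ps.length).map v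
  v_eq : ps.map Piece.v = (List.range ps.length).map w
  tree_nodup : ∀ p ∈ ps, p.tree.wires.Nodup
  a_mem : ∀ p ∈ ps, p.a ∈ p.tree.ds
  height_le : ∀ p ∈ ps, p.tree.height ≤ h
  idx_lt : ∀ p ∈ ps, p.idx < 6
  work : ∀ l p r, ps = l ++ p :: r → ∀ w ∈ p.tree.wires,
    w ∈ p.xs ∨ w = p.a ∨ ∃ q ∈ l, q.par ≠ p.par ∧ w ∈ q.xs
  parallel : ps.Pairwise fun p q => p.par = q.par → p.idx = q.idx →
    ∀ w ∈ p.tree.wires, w ≠ p.a → w ∉ q.tree.wires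

namespace Shape

variable {u v w : ℕ → Fin m} {h : ℕ}

theorem nil : Shape u v w h [] := by
  constructor <;> simp

theorem snoc {ps : List (Piece m)} (S : Shape u v w h ps) {p : Piece m}
    (ha : p.a = u ps.length) (hc : p.c = v ps.length) (hv : p.v = w ps.length)
    (hn : p.tree.wires.Nodup) (hm : p.a ∈ p.tree.ds) (hh : p.tree.height ≤ h) (hi : p.idx < 6)
    (hw : ∀ w ∈ p.tree.wires, w ∈ p.xs ∨ w = p.a ∨ ∃ q ∈ ps, q.par ≠ p.par ∧ w ∈ q.xs)
    (hp : ∀ q ∈ ps, q.par = p.par → q.idx = p.idx → ∀ w ∈ q.tree.wires, w ≠ q.a →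
      w ∉ p.tree.wires) : Shape u v w h (ps ++ [p]) where
  a_eq := by simp [List.range_succ, S.a_eq, ha]
  c_eq := by simp [List.range_succ, S.c_eq, hc]
  v_eq := by simp [List.range_succ, S.v_eq, hv]
  tree_nodup := by
    intro q hq
    rcases List.mem_append.1 hq with hq | hq
    · exact S.tree_nodup q hq
    · rwa [List.mem_singleton.1 hq]
  a_mem := by
    intro q hq
    rcases List.mem_append.1 hq with hq | hq
    · exact S.a_mem q hq
    · rwa [List.mem_singleton.1 hq]
  height_le := by
    intro q hq
    rcases List.mem_append.1 hq with hq | hq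
    · exact S.height_le q hq
    · rwa [List.mem_singleton.1 hq]
  idx_lt := by
    intro q hq
    rcases List.mem_append.1 hq with hq | hq
    · exact S.idx_lt q hq
    · rwa [List.mem_singleton.1 hq]
  work := by
    intro l q r e
    rcases List.eq_nil_or_concat r with rfl | ⟨r', z, rfl⟩
    · obtain ⟨rfl, h2⟩ := List.append_inj' e rfl
      obtain rfl : p = q := by simpa using h2
      exact hw
    · rw [List.concat_eq_append, ← List.cons_append, ← List.append_assoc] at e
      exact S.work l q r' (List.append_inj' e rfl).1
  parallel := by
    rw [List.pairwise_append]
    exact ⟨S.parallel, List.pairwise_singleton _ _, fun q hq r hr => by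
      rw [List.mem_singleton.1 hr]; exact hp q hq⟩

theorem wires_sub {ps : List (Piece m)} (S : Shape u v w h ps) {p : Piece m} (hp : p ∈ ps)
    {x : Fin m} (hx : x ∈ p.tree.wires) (hxa : x ≠ p.a) : x ∈ bits ps := by
  obtain ⟨l, r, e⟩ := List.append_of_mem hp
  rcases S.work l p r e x hx with h | h | ⟨q, hq, _, h⟩
  · exact mem_bits.2 ⟨p, hp, h⟩
  · exact absurd h hxa
  · exact mem_bits.2 ⟨q, by rw [e]; exact List.mem_append_left _ hq, h⟩

theorem exists_a {ps : List (Piece m)} (S : Shape u v w h ps) {p : Piece m} (hp : p ∈ ps) :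
    ∃ k, p.a = u k := by
  have : p.a ∈ ps.map Piece.a := List.mem_map_of_mem hp
  rw [S.a_eq] at this
  obtain ⟨k, _, hk⟩ := List.mem_map.1 this
  exact ⟨k, hk.symm⟩

/-- Append up to six pieces that share the workspace `B`. -/
theorem extend {X B : List (Fin m)} (huX : ∀ k, u k ∉ X) (hBX : ∀ x ∈ B, x ∈ X) (hB : B.Nodup)
    {s : ℕ} (hs : 3 * (s - 1) ≤ B.length) (hsh : s ≤ 2 ^ h) {π : Bool} (j : ℕ) :
    ∀ (i : ℕ) (ps : List (Piece m)) (Y : List (Fin m)), i + j ≤ 6 → Y.length ≤ j * s →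
      Shape u v w h ps → (bits ps ++ Y).Nodup → (∀ x ∈ bits ps ++ Y, x ∈ X) →
      (∀ x ∈ B, ∃ q ∈ ps, q.par = π ∧ x ∈ q.xs) →
      (∀ p ∈ ps, p.par = (!π) → i ≤ p.idx → ∀ x ∈ p.tree.wires, x ∉ B) →
      ∃ qs, Shape u v w h (ps ++ qs) ∧ bits qs = Y ∧ qs.length ≤ j ∧ ∀ q ∈ qs, q.par = !π := by
  induction j with
  | zero =>
    intro i ps Y _ hY S _ _ _ _
    obtain rfl : Y = [] := List.eq_nil_of_length_eq_zero (by omega)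
    exact ⟨[], by simpa using S, rfl, le_rfl, by simp⟩
  | succ j ih =>
    intro i ps Y hij hY S hn hX hBp hfree
    rcases Nat.eq_zero_or_pos Y.length with h0 | hpos
    · obtain rfl : Y = [] := List.eq_nil_of_length_eq_zero h0
      exact ⟨[], by simpa using S, rfl, by simp, by simp⟩
    have hs0 : 0 < s := by
      rcases Nat.eq_zero_or_pos s with rfl | h
      · omega
      · exact h
    obtain ⟨Y1, Y2, rfl, hY1, hY1s, hY2⟩ : ∃ Y1 Y2, Y = Y1 ++ Y2 ∧ 0 < Y1.length ∧
        Y1.length ≤ s ∧ Y2.length ≤ j * s :=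
      ⟨Y.take s, Y.drop s, (List.take_append_drop _ _).symm, by rw [List.length_take]; omega,
        by rw [List.length_take]; omega, by
          rw [List.length_drop]; rw [Nat.succ_mul] at hY; omega⟩
    have hcs : (B.take (3 * (Y1.length - 1))).length = 3 * (Y1.length - 1) := by
      rw [List.length_take]; omega
    -- The cell `a` doubles as a control cell of the tree, so that a piece of one bit needs nothing
    -- from `B`.
    obtain ⟨T, t1, t2, t3, t4⟩ := PTree.exists_tree h Y1 (u ps.length) _ hY1
      (hY1s.trans hsh) hcs
    have tB : ∀ x ∈ B.take (3 * (Y1.length - 1)), x ∈ B := fun x hx => List.mem_of_mem_take hx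
    have hBb : ∀ x ∈ B, x ∈ bits ps := fun x hx => by
      obtain ⟨q, hq, _, h⟩ := hBp x hx
      exact mem_bits.2 ⟨q, hq, h⟩
    rw [← List.append_assoc, List.nodup_append] at hn
    obtain ⟨hn1, hn2, hn3⟩ := hn
    rw [List.nodup_append] at hn1
    obtain ⟨hnb, hnY, hnd⟩ := hn1
    have hY1X : ∀ x ∈ Y1, x ∈ X := fun x hx => hX x (by simp [hx])
    have hTn : T.wires.Nodup := by
      rw [t4.nodup_iff, List.nodup_append, List.nodup_cons]
      refine ⟨hnY, ⟨fun hx => huX _ (hBX _ (tB _ hx)), hB.sublist (List.take_sublist _ _)⟩, ?_⟩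
      intro x hx y hy e
      subst e
      rcases List.mem_cons.1 hy with rfl | hy
      · exact huX _ (hY1X _ hx)
      · exact hnd x (hBb x (tB x hy)) x hx rfl
    have hTw : ∀ x, x ∈ T.wires → x ∈ Y1 ∨ x = u ps.length ∨ x ∈ B := fun x hx => by
      rw [t4.mem_iff, List.mem_append, List.mem_cons] at hx
      exact hx.imp id (Or.imp id (tB x))
    -- The pieces appended here share `B`, hence get different indices and run one after another.
    set p : Piece m := ⟨T, u ps.length, v ps.length, w ps.length, !π, i⟩ with hp
    have S' : Shape u v w h (ps ++ [p]) := by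
      refine S.snoc rfl rfl rfl hTn t2 t3 (show i < 6 by omega) (fun x hx => ?_)
        fun q hq hqp hqi x hx hxa hx' => ?_
      · rcases hTw x hx with h1 | h1 | h1
        · exact Or.inl (show x ∈ T.xs by rw [t1]; exact h1)
        · exact Or.inr (Or.inl h1)
        · obtain ⟨q, hq, hqπ, h⟩ := hBp x h1
          exact Or.inr (Or.inr ⟨q, hq, by rw [hqπ, hp]; simp, h⟩)
      · have hxb := S.wires_sub hq hx hxa
        rcases hTw x hx' with h1 | h1 | h1
        · exact hnd x hxb x h1 rfl
        · exact huX _ (h1 ▸ hX x (List.mem_append_left _ hxb))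
        · exact hfree q hq hqp (le_of_eq hqi.symm) x hx h1
    have hb' : bits (ps ++ [p]) = bits ps ++ Y1 := by
      simp only [bits, List.flatMap_append, List.flatMap_cons, List.flatMap_nil, List.append_nil]
      congr 1
    obtain ⟨qs, r1, r2, r3, r4⟩ := ih (i + 1) (ps ++ [p]) Y2 (by omega) hY2 S'
      (by
        rw [hb', List.nodup_append, List.nodup_append]
        exact ⟨⟨hnb, hnY, hnd⟩, hn2, hn3⟩)
      (fun x hx => hX x (by rw [hb'] at hx; simpa using hx))
      (fun x hx => by
        obtain ⟨q, hq, h⟩ := hBp x hx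
        exact ⟨q, List.mem_append_left _ hq, h⟩)
      (fun q hq hqp hqi => by
        rcases List.mem_append.1 hq with hq | hq
        · exact hfree q hq hqp (by omega)
        · rw [List.mem_singleton.1 hq, hp] at hqi
          simp at hqi)
    refine ⟨p :: qs, by simpa using r1, ?_, by simp; omega, ?_⟩
    · rw [← r2]
      change T.xs ++ bits qs = Y1 ++ bits qs
      rw [t1]
    · intro q hq
      rcases List.mem_cons.1 hq with rfl | hq
      · rfl
      · exact r4 q hq

/-- Decompositions of registers with workspace in the register itself. The list `B` consists of
the bits of the last level of pieces. -/
theorem exists_shape (N : ℕ) : ∀ X : List (Fin m), X.length = N → 0 < N → N ≤ 2 ^ h → X.Nodup →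
    (∀ k, u k ∉ X) → ∃ ps, Shape u v w h ps ∧ bits ps = X ∧ ps.length ≤ 6 * Nat.clog 2 N + 1 ∧
      ∃ (B : List (Fin m)) (π : Bool), B.Nodup ∧ N / 2 ≤ B.length ∧
        (∀ x ∈ B, ∃ q ∈ ps, q.par = π ∧ x ∈ q.xs) ∧
        ∀ p ∈ ps, p.par = (!π) → ∀ x ∈ p.tree.wires, x ∉ B := by
  induction N using Nat.strong_induction_on with
  | _ N ih =>
    intro X hXN hN hNh hn huX
    by_cases h1 : N = 1
    · subst h1
      obtain ⟨x, rfl⟩ := List.length_eq_one_iff.1 hXN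
      have hux : u 0 ≠ x := fun e => huX 0 (by simp [e])
      refine ⟨[⟨.leaf x (u 0), u 0, v 0, w 0, true, 0⟩], ?_, by simp [bits, Piece.xs, PTree.xs], by simp,
        [x], true, by simp, by simp, by simp [Piece.xs, PTree.xs], by simp⟩
      refine (Shape.nil (u := u) (v := v) (w := w) (h := h)).snoc rfl rfl rfl ?_ ?_ ?_ ?_ ?_ ?_
      · simpa [PTree.wires] using hux.symm
      · simp [PTree.ds]
      · simp [PTree.height]
      · simp
      · simp [PTree.wires, Piece.xs, PTree.xs]
      · simp
    · obtain ⟨X1, X2, rfl, hX1, hX2⟩ : ∃ X1 X2, X = X1 ++ X2 ∧ X1.length = (N + 1) / 2 ∧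
          X2.length = N / 2 :=
        ⟨X.take ((N + 1) / 2), X.drop ((N + 1) / 2), (List.take_append_drop _ _).symm,
          by rw [List.length_take]; omega, by rw [List.length_drop]; omega⟩
      have hn' := List.nodup_append.1 hn
      obtain ⟨ps, S, hb, hlen, B, π, b1, b2, b3, b4⟩ := ih ((N + 1) / 2) (by omega) X1 hX1
        (by omega) (by omega) hn'.1 fun k hk => huX k (List.mem_append_left _ hk)
      have hBX : ∀ x ∈ B, x ∈ X1 ++ X2 := fun x hx => by
        obtain ⟨q, hq, _, h⟩ := b3 x hx
        rw [← hb]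
        exact List.mem_append_left _ (mem_bits.2 ⟨q, hq, h⟩)
      -- The new level consists of the last N / 2 bits, in pieces of size at most s = ⌈(N / 2) / 6⌉.
      -- Six pieces suffice because 3 * (s - 1) ≤ ((N + 1) / 2) / 2, a lower bound for the length of
      -- `B`.
      obtain ⟨qs, q1, q2, q3, q4⟩ := S.extend huX hBX b1 (s := (N / 2 + 5) / 6) (by omega)
        (by omega) 6 0 ps X2 le_rfl (by omega) (by rw [hb]; exact hn) (by simp [hb]) b3
        (fun p hp hpπ _ => b4 p hp hpπ)
      -- `X2` becomes the workspace of the next level. Only the new pieces touch it, and they have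
      -- parity `!π`, so the parities of the levels alternate.
      refine ⟨ps ++ qs, q1, by simp [hb, q2], ?_, X2, !π, hn'.2.1, hX2.ge, ?_, ?_⟩
      · have : Nat.clog 2 N = Nat.clog 2 ((N + 1) / 2) + 1 :=
          Nat.clog_of_two_le (by norm_num) (by omega)
        rw [this, List.length_append]
        omega
      · intro x hx
        rw [← q2] at hx
        obtain ⟨q, hq, hxq⟩ := mem_bits.1 hx
        exact ⟨q, List.mem_append_right _ hq, q4 q hq, hxq⟩
      · intro p hp hpπ x hx hx2
        rcases List.mem_append.1 hp with hp' | hp'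
        · by_cases hxa : x = p.a
          · obtain ⟨k, hk⟩ := S.exists_a hp'
            exact huX k (by rw [← hk, ← hxa]; exact List.mem_append_right _ hx2)
          · have := S.wires_sub hp' hx hxa
            rw [hb] at this
            exact hn'.2.2 x this x hx2 rfl
        · rw [q4 p hp'] at hpπ
          simp at hpπ

theorem layout {ps : List (Piece m)} (S : Shape u v w h ps) (hb : (bits ps).Nodup)
    (hc : ((List.range ps.length).map u ++ ((List.range ps.length).map v ++
      (List.range ps.length).map w)).Nodup) (hu : ∀ k, u k ∉ bits ps) (hv : ∀ k, v k ∉ bits ps)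
    (hw : ∀ k, w k ∉ bits ps) : Layout ps := by
  rw [← S.a_eq, ← S.c_eq, ← S.v_eq] at hc
  have ha : ∀ p ∈ ps, p.a ∉ bits ps := fun p hp => by
    obtain ⟨k, hk⟩ := S.exists_a hp
    rw [hk]; exact hu k
  refine ⟨S.tree_nodup, hb, hc, ha, fun p hp => ?_, fun p hp => ?_, S.a_mem, S.work, S.idx_lt, ?_⟩
  · have : p.c ∈ ps.map Piece.c := List.mem_map_of_mem hp
    rw [S.c_eq] at this
    obtain ⟨k, _, hk⟩ := List.mem_map.1 this
    rw [← hk]; exact hv k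
  · have : p.v ∈ ps.map Piece.v := List.mem_map_of_mem hp
    rw [S.v_eq] at this
    obtain ⟨k, _, hk⟩ := List.mem_map.1 this
    rw [← hk]; exact hw k
  · have hna : ps.Pairwise fun p q => p.a ≠ q.a := List.pairwise_map.1 (List.nodup_append.1 hc).1
    refine (S.parallel.and hna).imp_of_mem fun {p q} hp hq hpq e1 e2 x hx hx' => ?_
    by_cases hxa : x = p.a
    · subst hxa
      by_cases h2 : p.a = q.a
      · exact hpq.2 h2
      · exact ha p hp (S.wires_sub hq hx' h2)
    · exact hpq.1 e1 e2 x hx hxa hx'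

end Shape

/-! ### Moving circuits to other wires -/

/-- A gate moved to other wires. -/
def Gate.embed {n : ℕ} (f : Fin n ↪ Fin m) (g : Gate n) : Gate m where
  controls := g.controls.map f
  target := f g.target
  target_notMem := by simpa using g.target_notMem
  card_controls_le := by simpa using g.card_controls_le

theorem ev_embed_comp {n : ℕ} (f : Fin n ↪ Fin m) (C : Circuit n) (b : Fin m → Bool) :
    ev (C.map (Gate.embed f)) b ∘ f = ev C (b ∘ f) := by
  induction C generalizing b with
  | nil => rfl
  | cons g C ih =>
    rw [List.map_cons, ev, ih, ev]
    congr 1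
    simp only [ckxMap, Gate.embed, Finset.forall_mem_map, Function.comp_apply]
    exact Function.update_comp_eq_of_injective _ f.injective _ _

theorem Cost.embed {n : ℕ} (f : Fin n ↪ Fin m) {C : Circuit n} {S : Set (Fin n)} {k s : ℕ}
    (h : Cost C S k s) : Cost (C.map (Gate.embed f)) (f '' S) k s := by
  induction h with
  | nil S => exact Cost.nil _
  | gate g =>
    refine (Cost.gate _).mono ?_ le_rfl le_rfl
    intro w hw
    simp only [Gate.wires, Gate.embed, Finset.mem_insert, Finset.mem_map, Set.mem_ofPred_eq] at hw
    rcases hw with rfl | ⟨c, hc, rfl⟩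
    · exact ⟨g.target, by simp [Gate.wires], rfl⟩
    · exact ⟨c, by simp [Gate.wires, hc], rfl⟩
  | seq _ _ ih ih' => rw [List.map_append]; exact ih.seq ih'
  | par hd _ _ ih ih' =>
    rw [List.map_append, Set.image_union]
    exact ih.par ((Set.disjoint_image_iff f.injective).2 hd) ih'
  | mono _ hS hk hs ih => exact ih.mono (Set.image_mono hS) hk hs

theorem addc_map_comp {n : ℕ} (f : Fin n ↪ Fin m) (l : List (Fin n)) (κ : Bool)
    (b : Fin m → Bool) : addc (l.map f) κ b ∘ f = addc l κ (b ∘ f) := by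
  induction l generalizing κ b with
  | nil => rfl
  | cons x l ih =>
    rw [List.map_cons, addc, addc, ih]
    congr 1
    exact Function.update_comp_eq_of_injective _ f.injective _ _

/-- The first `n` of `n + 1` wires. -/
abbrev firstWires (n : ℕ) : List (Fin (n + 1)) := (List.finRange n).map Fin.castSucc

/-- An increment circuit can be placed on any wires. -/
theorem exists_inc_on {n k s : ℕ} {C : Circuit (n + 1)} (hC : Cost C Set.univ k s)
    (hI : ∀ b, ev C b = addc (firstWires n) true b) {xs : List (Fin m)} {a : Fin m}
    (hxs : xs.length = n) (hn : xs.Nodup) (ha : a ∉ xs) :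
    ∃ D : Circuit m, Cost D Set.univ k s ∧ ∀ b, ev D b = addc xs true b := by
  subst hxs
  have hn' : (xs ++ [a]).Nodup := by
    rw [List.nodup_append]
    refine ⟨hn, by simp, fun x hx y hy e => ?_⟩
    rw [List.mem_singleton] at hy
    exact ha (by rw [← hy, ← e]; exact hx)
  let f : Fin (xs.length + 1) ↪ Fin m :=
    ⟨fun i => (xs ++ [a]).get (i.cast (by simp)), fun i j h => by
      have := List.nodup_iff_injective_get.1 hn' h
      exact Fin.cast_injective _ this⟩
  have hf : (firstWires xs.length).map f = xs := by
    refine List.ext_getElem (by simp) fun i h1 h2 => ?_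
    simp [f, h2]
  refine ⟨C.map (Gate.embed f), (hC.embed f).mono (Set.subset_univ _) le_rfl le_rfl, fun b => ?_⟩
  have h1 : ev (C.map (Gate.embed f)) b ∘ f = addc xs true b ∘ f := by
    rw [ev_embed_comp, hI, ← addc_map_comp, hf]
  funext w
  by_cases hw : w ∈ Set.range f
  · obtain ⟨i, rfl⟩ := hw
    exact congrFun h1 i
  · rw [(hC.embed f).on.ev_eq b fun h => hw (Set.image_subset_range _ _ h), addc_notMem]
    intro h
    rw [← hf, List.mem_map] at h
    obtain ⟨i, _, rfl⟩ := h
    exact hw ⟨i, rfl⟩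

/-! ### Increments of unbounded cost, for small registers -/

/-- A multi-controlled negation, with one dirty ancilla. -/
theorem exists_mcx (cs : List (Fin m)) : ∀ t a : Fin m, t ∉ cs → a ∉ cs → t ≠ a → cs.Nodup →
    ∃ C, ∀ b, ev C b = Function.update b t (xor (b t) (cs.all b)) := by
  induction cs with
  | nil =>
    intro t a _ _ _ _
    refine ⟨gt ∅ t, fun b => ?_⟩
    funext w
    rw [ev_gt (by simp) (by simp), Function.update_apply]
    simp
  | cons c cs ih =>
    intro t a ht ha hta hn
    rw [List.mem_cons, not_or] at ht ha
    rw [List.nodup_cons] at hn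
    -- Target and dirty ancilla exchange roles in the recursion.
    obtain ⟨C, hC⟩ := ih a t ha.2 ht.2 hta.symm hn.2
    have hg := ev_gt (cs := {a, c}) (t := t) (by simp [hta, ht.1]) Finset.card_le_two
    -- The bit `t` is toggled by `(a ^^ v) && c` and then by `a && c`, in total by `v && c`. The
    -- length more than doubles with each control, which is harmless since only finitely many sizes
    -- are used.
    refine ⟨C ++ gt {a, c} t ++ C ++ gt {a, c} t, fun b => ?_⟩
    simp only [ev_append]
    rw [hC b]
    set v := cs.all b with hv
    set b1 := Function.update b a (xor (b a) v) with hb1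
    set b2 := ev (gt {a, c} t) b1 with hb2
    have e2 : ∀ w, b2 w = if w = t then xor (b t) ((b a ^^ v) && b c) else b1 w := by
      intro w
      have ea : b1 a = xor (b a) v := Function.update_self _ _ _
      have ec : b1 c = b c := Function.update_of_ne (Ne.symm ha.1) _ _
      have et : b1 t = b t := Function.update_of_ne hta _ _
      rw [hb2, hg]
      simp only [Finset.mem_insert, Finset.mem_singleton, forall_eq_or_imp, forall_eq, ea, ec, et,
        Bool.decide_and, Bool.decide_eq_true]
    have v2 : cs.all b2 = v := all_congr fun w hw => by
      rw [e2, if_neg (fun e : w = t => ht.2 (e ▸ hw)), hb1,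
        Function.update_of_ne (fun e : w = a => ha.2 (e ▸ hw))]
    rw [hC b2, v2]
    funext w
    rw [hg]
    have hca : c ≠ a := Ne.symm ha.1
    have hct : c ≠ t := Ne.symm ht.1
    simp only [Function.update_apply, e2, hb1, hta, hta.symm, hca, hct, if_true, if_false,
      Finset.mem_insert, Finset.mem_singleton, forall_eq_or_imp, forall_eq, List.all_cons, ← hv]
    by_cases hwt : w = t
    · subst hwt
      simp only [if_true]
      cases b w <;> cases b a <;> cases b c <;> cases v <;> rfl
    · by_cases hwa : w = a
      · subst hwa
        simp [hwt]
      · simp [hwt, hwa]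

/-- An increment with one dirty ancilla, without any bound on the number of gates. -/
theorem exists_inc (xs : List (Fin m)) (a : Fin m) (ha : a ∉ xs) (hn : xs.Nodup) :
    ∃ C, ∀ b, ev C b = addc xs true b := by
  induction xs using List.reverseRecOn with
  | nil => exact ⟨[], fun b => rfl⟩
  | append_singleton xs x ih =>
    have hn' := List.nodup_append.1 hn
    have hx : x ∉ xs := fun h => hn'.2.2 x h x (by simp) rfl
    rw [List.mem_append, not_or] at ha
    have hax : x ≠ a := fun e => ha.2 (by simp [e])
    obtain ⟨C, hC⟩ := ih ha.1 hn'.1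
    obtain ⟨D, hD⟩ := exists_mcx xs x a hx ha.1 hax hn'.1
    -- The top bit is treated first, while the lower bits still tell whether the carry reaches it.
    refine ⟨D ++ C, fun b => ?_⟩
    rw [ev_append, hD, hC, addc_append hn, Bool.true_and]
    funext w
    simp only [addc, Function.update_apply]
    by_cases hw : w ∈ xs
    · rw [if_neg fun e : w = x => hx (e ▸ hw)]
      refine addc_congr (fun u hu => ?_) w hw
      rw [Function.update_of_ne fun e : u = x => hx (e ▸ hu)]
    · rw [addc_notMem hw, Function.update_apply, addc_notMem hx, addc_notMem hw]

/-! ### From short registers to long ones, with a dirty ancilla -/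

theorem addc_update {xs : List (Fin m)} {z : Fin m} (hz : z ∉ xs) (κ v : Bool)
    (b : Fin m → Bool) :
    addc xs κ (Function.update b z v) = Function.update (addc xs κ b) z v := by
  funext w
  by_cases hw : w ∈ xs
  · have hwz : w ≠ z := fun e => hz (e ▸ hw)
    rw [Function.update_of_ne hwz]
    exact addc_congr (fun u hu => Function.update_of_ne (fun e : u = z => hz (e ▸ hu)) _ _) w hw
  · simp only [addc_notMem hw, Function.update_apply]

theorem addc_comm {xs ys : List (Fin m)} (h : ∀ w ∈ xs, w ∉ ys) (κ κ' : Bool)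
    (b : Fin m → Bool) : addc xs κ (addc ys κ' b) = addc ys κ' (addc xs κ b) := by
  funext w
  by_cases hx : w ∈ xs
  · rw [addc_notMem (h w hx)]
    exact addc_congr (fun v hv => addc_notMem (h v hv)) w hx
  · rw [addc_notMem hx]
    by_cases hy : w ∈ ys
    · exact (addc_congr (fun v hv => addc_notMem fun hv' => h v hv' hv) w hy).symm
    · rw [addc_notMem hy, addc_notMem hy, addc_notMem hx]

/-- An increment of a long register `lo ++ hi` with the dirty ancilla `z` from increments of the
short registers `lo` and `lo ++ [z]`. -/
theorem exists_inc_of_short {lo hi : List (Fin m)} {z : Fin m} (hn : (lo ++ hi).Nodup)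
    (hz : z ∉ lo ++ hi) (hpos : 0 < hi.length)
    (hlo : 3 * (6 * Nat.clog 2 hi.length + 1) ≤ lo.length) {k s : ℕ} {D E : Circuit m}
    (hD : Cost D Set.univ k s) (hDe : ∀ b, ev D b = addc lo true b)
    (hE : Cost E Set.univ k s) (hEe : ∀ b, ev E b = addc (lo ++ [z]) true b) :
    ∃ C, Cost C Set.univ (7100 * (Nat.clog 2 hi.length + 1) + 5 * k)
        (1500 * (hi.length + lo.length + 1) + 5 * s) ∧
      ∀ b, ev C b = addc (lo ++ hi) true b := by
  obtain ⟨nlo, nhi, nlh⟩ := List.nodup_append.1 hn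
  have dlh : ∀ w ∈ lo, w ∉ hi := fun w hw hw' => nlh w hw w hw' rfl
  rw [List.mem_append, not_or] at hz
  set H := Nat.clog 2 hi.length with hH
  have hHp : hi.length ≤ 2 ^ H := Nat.le_pow_clog (by norm_num) _
  set M := 6 * H + 1 with hM
  have lpos : 0 < lo.length := by omega
  -- Beyond the end of `lo` the sequence repeats `lo[0]`: there only membership in `lo` is needed.
  let u : ℕ → Fin m := fun i => lo.getD i lo[0]
  have umem : ∀ i, u i ∈ lo := fun i => by
    simp only [u, List.getD_eq_getElem?_getD]
    cases h : lo[i]? with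
    | none => exact List.getElem_mem _
    | some y => exact List.mem_of_getElem? h
  have uinj : ∀ i < lo.length, ∀ j < lo.length, u i = u j → i = j := fun i hi' j hj h => by
    simp only [u, List.getD_eq_getElem _ _ hi', List.getD_eq_getElem _ _ hj] at h
    exact (nlo.getElem_inj_iff).1 h
  -- The cells `a`, `c` and `v` occupy three consecutive blocks of `M` bits of `lo`, and there are
  -- at most `M` pieces.
  obtain ⟨ps, S, hb, hlen, -⟩ := Shape.exists_shape (u := u) (v := fun i => u (M + i))
    (w := fun i => u (2 * M + i)) (h := H) hi.length hi rfl hpos hHp nhi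
    (fun i h => dlh _ (umem i) h)
  have hlen' : ps.length ≤ M := hlen
  have L : Layout ps := by
    refine S.layout (by rw [hb]; exact nhi) ?_ (fun i => by rw [hb]; exact dlh _ (umem i))
      (fun i => by rw [hb]; exact dlh _ (umem _)) (fun i => by rw [hb]; exact dlh _ (umem _))
    rw [List.nodup_append, List.nodup_append]
    refine ⟨?_, ⟨?_, ?_, ?_⟩, ?_⟩
    · refine List.nodup_range.map_on fun i hi' j hj h => ?_
      rw [List.mem_range] at hi' hj
      exact uinj _ (by omega) _ (by omega) h
    · refine List.nodup_range.map_on fun i hi' j hj h => ?_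
      rw [List.mem_range] at hi' hj
      have := uinj _ (by omega) _ (by omega) h
      omega
    · refine List.nodup_range.map_on fun i hi' j hj h => ?_
      rw [List.mem_range] at hi' hj
      have := uinj _ (by omega) _ (by omega) h
      omega
    · intro x hx y hy h
      simp only [List.mem_map, List.mem_range] at hx hy
      obtain ⟨i, hi', rfl⟩ := hx
      obtain ⟨j, hj, rfl⟩ := hy
      have := uinj _ (by omega) _ (by omega) h
      omega
    · intro x hx y hy h
      simp only [List.mem_append, List.mem_map, List.mem_range] at hx hy
      obtain ⟨i, hi', rfl⟩ := hx
      rcases hy with ⟨j, hj, rfl⟩ | ⟨j, hj, rfl⟩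
      · have := uinj _ (by omega) _ (by omega) h
        omega
      · have := uinj _ (by omega) _ (by omega) h
        omega
  have cell : ∀ p ∈ ps, p.a ∈ lo ∧ p.c ∈ lo ∧ p.v ∈ lo := fun p hp => by
    have h1 : p.a ∈ ps.map Piece.a := List.mem_map_of_mem hp
    have h2 : p.c ∈ ps.map Piece.c := List.mem_map_of_mem hp
    have h3 : p.v ∈ ps.map Piece.v := List.mem_map_of_mem hp
    rw [S.a_eq, List.mem_map] at h1
    rw [S.c_eq, List.mem_map] at h2
    rw [S.v_eq, List.mem_map] at h3
    obtain ⟨i, _, e1⟩ := h1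
    obtain ⟨j, _, e2⟩ := h2
    obtain ⟨l, _, e3⟩ := h3
    exact ⟨e1 ▸ umem _, e2 ▸ umem _, e3 ▸ umem _⟩
  have nez : ∀ w ∈ lo, z ≠ w := fun w hw e => hz.1 (e ▸ hw)
  obtain ⟨F0, F0c, F0z, F0f, F0t⟩ := exists_ctrlInc L (z := z) (h := H) (by rw [hb]; exact hz.2)
    (fun p hp => nez _ (cell p hp).1) (fun p hp => nez _ (cell p hp).2.1)
    (fun p hp => nez _ (cell p hp).2.2) S.height_le (by rw [hb]; exact hHp)
  rw [hb] at F0c F0t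
  obtain ⟨K, Kc, -, Ke⟩ := exists_fan H nhi hz.2 hHp
  have Kr := ev_reverse_of_fan hz.2 Ke
  have cK := Kc.mono (Set.subset_univ _) le_rfl le_rfl
  have cN := (nots_cost nlo).mono (Set.subset_univ _) le_rfl le_rfl
  obtain ⟨F, cF, Fz, Ff, Ft⟩ : ∃ F : Circuit m,
      Cost F Set.univ (500 * (H + ps.length + 1) + 2)
        (700 * (hi.length + ps.length + 1) + 2 * lo.length) ∧
      (∀ b, ev F b z = b z) ∧ (∀ b, b z = false → ev F b = b) ∧
      ∀ b, b z = true → lo.all b = true → ev F b = addc hi true b := by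
    -- If `lo` is all ones, negating it supplies the clean cells.
    refine ⟨nots lo ++ (F0 ++ nots lo), ?_, fun b => ?_, fun b hbz => ?_, fun b hbz hbl => ?_⟩
    · exact (cN.seq (F0c.seq cN)).mono subset_rfl (by omega) (by omega)
    · simp only [ev_append, ev_nots nlo]
      rw [flp_notMem hz.1, F0z, flp_notMem hz.1]
    · simp only [ev_append, ev_nots nlo]
      rw [F0f _ (by rw [flp_notMem hz.1, hbz]), flp_flp]
    · simp only [ev_append, ev_nots nlo]
      have hcl : ∀ w ∈ lo, flp lo b w = false := fun w hw => by
        rw [flp_mem hw, List.all_eq_true.1 hbl w hw]; rfl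
      rw [F0t _ (by rw [flp_notMem hz.1, hbz]) fun p hp =>
        ⟨hcl _ (cell p hp).1, hcl _ (cell p hp).2.1, hcl _ (cell p hp).2.2⟩]
      funext w
      by_cases hw : w ∈ lo
      · rw [flp_mem hw, addc_notMem (dlh w hw), flp_mem hw, addc_notMem (dlh w hw), Bool.not_not]
      · rw [flp_notMem hw]
        by_cases hw' : w ∈ hi
        · exact addc_congr (fun v hv => flp_notMem fun h => dlh v h hv) w hw'
        · rw [addc_notMem hw', addc_notMem hw', flp_notMem hw]
  have Fr : ∀ b, b z = false → ev F.reverse b = b := fun b h => by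
    apply ev_injective F
    rw [ev_ev_reverse, Ff b h]
  -- Incrementing `lo ++ [z]` and then decrementing `lo` leaves only the carry from `lo` into `z`.
  set A := E ++ D.reverse with hA
  have cA : Cost A Set.univ (k + k) (s + s) := hE.seq hD.reverse
  have hzlo : (lo ++ [z]).Nodup := by
    rw [List.nodup_append]
    exact ⟨nlo, by simp, fun x hx y hy e => nez x hx (e.trans (List.mem_singleton.1 hy)).symm⟩
  have Ae : ∀ b, ev A b = Function.update b z (xor (b z) (lo.all b)) := by
    intro b
    apply ev_injective D
    rw [hA, ev_append, ev_ev_reverse, hEe, hDe, addc_append hzlo, addc_update hz.1]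
    simp only [addc, Bool.true_and, addc_notMem hz.1]
  have addcInv : ∀ b, addc hi true (flp hi (addc hi true b)) = flp hi b := fun b => by
    have := flp_addc_flp_addc nhi true b
    rw [← this, flp_flp, this]
  have loall : ∀ b b' : Fin m → Bool, (∀ w, w ∉ hi → b w = b' w) → lo.all b = lo.all b' :=
    fun b b' h => all_congr fun w hw => h w (dlh w hw)
  have floall : ∀ b, lo.all (flp hi b) = lo.all b := fun b =>
    loall _ _ fun w hw => flp_notMem hw
  have aloall : ∀ κ b, lo.all (addc hi κ b) = lo.all b := fun κ b =>
    loall _ _ fun w hw => addc_notMem hw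
  have uloall : ∀ b v, lo.all (Function.update b z v) = lo.all b := fun b v =>
    all_congr fun w hw => Function.update_of_ne (nez w hw).symm _ _
  -- If `lo` is not all ones, `A` is idle, F and F⁻¹ cancel, and so do K and K⁻¹. If it is, F sees
  -- the toggled `z` and F⁻¹ the original one. Starting from `z = 0`, F increments `hi`; starting
  -- from `z = 1`, F⁻¹ decrements the complement of `hi` prepared by `K`. Finally `D` increments
  -- `lo`.
  refine ⟨K ++ (A ++ (F ++ (A ++ (F.reverse ++ (K.reverse ++ D))))), ?_, fun b => ?_⟩
  · exact (cK.seq (cA.seq (cF.seq (cA.seq (cF.reverse.seq (cK.reverse.seq hD)))))).mono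
      subset_rfl (by omega) (by omega)
  simp only [ev_append]
  rw [addc_append hn, Bool.true_and]
  cases hall : lo.all b
  · set s1 := ev K b with hs1
    have l1 : lo.all s1 = false := by
      rw [hs1, Ke]
      split_ifs
      · rw [floall, hall]
      · exact hall
    have A1 : ∀ c : Fin m → Bool, lo.all c = false → ev A c = c := fun c hc => by
      rw [Ae, hc, Bool.xor_false, Function.update_eq_self]
    -- F maps the set of states with `z` set and `lo` all ones onto itself, so by injectivity no
    -- state enters it from outside.
    have l2 : lo.all (ev F s1) = false := by
      by_contra hcon
      rw [Bool.not_eq_false] at hcon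
      cases hsz : s1 z
      · rw [Ff s1 hsz, l1] at hcon
        simp at hcon
      · set c := flp hi (addc hi true (flp hi (ev F s1))) with hc
        have hcz : c z = true := by
          rw [hc, flp_notMem hz.2, addc_notMem hz.2, flp_notMem hz.2, Fz, hsz]
        have hcl : lo.all c = true := by rw [hc, floall, aloall, floall, hcon]
        have h1 : ev F c = ev F s1 := by rw [Ft c hcz hcl, hc, addcInv, flp_flp]
        rw [ev_injective F h1, l1] at hcl
        simp at hcl
    rw [A1 _ l1, A1 _ l2, ev_reverse_ev, hs1, ev_reverse_ev, hDe, addc_false]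
  · have goal2 : addc lo true (addc hi true b) = addc hi true (addc lo true b) :=
      addc_comm dlh _ _ _
    rw [hDe, ← goal2]
    congr 1
    cases hbz : b z
    · have k1 : ev K b = b := by rw [Ke, if_neg (by simp [hbz])]
      have k2 : ev A b = Function.update b z true := by rw [Ae, hbz, hall]; rfl
      have k3 : ev A (Function.update (addc hi true b) z true) = addc hi true b := by
        rw [Ae, uloall, aloall, hall, Function.update_self, Function.update_idem]
        refine Function.update_eq_self_iff.2 ?_
        rw [addc_notMem hz.2, hbz]; rfl
      have k4 : addc hi true b z = false := by rw [addc_notMem hz.2, hbz]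
      rw [k1, k2, Ft _ (Function.update_self _ _ _) (by rw [uloall, hall]), addc_update hz.2, k3,
        Fr _ k4, Kr, if_neg (by simp [k4])]
    · have fz : flp hi b z = true := by rw [flp_notMem hz.2, hbz]
      have k1 : ev K b = flp hi b := by rw [Ke, if_pos hbz]
      have k2 : ev A (flp hi b) = Function.update (flp hi b) z false := by
        rw [Ae, fz, floall, hall]; rfl
      have k3 : ev A (Function.update (flp hi b) z false) = flp hi b := by
        rw [Ae, uloall, floall, hall, Function.update_self, Function.update_idem]
        refine Function.update_eq_self_iff.2 ?_
        rw [fz]; rfl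
      set c := flp hi (addc hi true b) with hc
      have hcz : c z = true := by rw [hc, flp_notMem hz.2, addc_notMem hz.2, hbz]
      have k4 : ev F.reverse (flp hi b) = c := by
        apply ev_injective F
        rw [ev_ev_reverse, Ft c hcz (by rw [hc, floall, aloall, hall]), hc, addcInv]
      rw [k1, k2, Ff _ (Function.update_self _ _ _), k3, k4, Kr, if_pos hcz, hc, flp_flp]

/-! ### The recursion -/

theorem firstWires_nodup (n : ℕ) : (firstWires n).Nodup :=
  (List.nodup_finRange n).map (Fin.castSucc_injective n)

theorem last_notMem_firstWires (n : ℕ) : Fin.last n ∉ firstWires n := by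
  simp [firstWires, Fin.castSucc_ne_last]

theorem linear_lt_two_pow (q : ℕ) (hq : 13 ≤ q) : 180 * q + 148 ≤ 2 ^ (q - 1) := by
  induction q, hq using Nat.le_induction with
  | base => norm_num
  | succ q hq ih =>
    have : 2 ^ (q + 1 - 1) = 2 ^ (q - 1) * 2 := by rw [← pow_succ]; congr 1; omega
    omega

/-- For large `n`, the low part of the register is short. -/
theorem short_bounds {n c : ℕ} (hc : c = Nat.clog 2 n) (h : 129 ≤ c) :
    10 * (Nat.clog 2 (18 * c + 4) + 1) ≤ c + 1 ∧ 10 * (18 * c + 5) ≤ n := by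
  constructor
  -- With q = (c + 1) / 10 one has c ≤ 10 q + 8, hence 18 c + 4 ≤ 180 q + 148; and c ≥ 129 gives q ≥
  -- 13.
  · have h1 := linear_lt_two_pow ((c + 1) / 10) (by omega)
    have h2 : Nat.clog 2 (18 * c + 4) ≤ (c + 1) / 10 - 1 :=
      Nat.clog_le_of_le_pow (by omega)
    omega
  · have h1 := linear_lt_two_pow c (by omega)
    have hn : 1 < n := by
      by_contra hn
      rw [Nat.clog_of_right_le_one (by omega)] at hc
      omega
    have h2 : 2 ^ (c - 1) < n := by
      rw [hc]; exact Nat.pow_pred_clog_lt_self (by norm_num) hn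
    omega

/-- Increment circuits with one dirty ancilla, of linear size and logarithmic depth. -/
theorem exists_inc_log : ∃ K : ℕ, ∀ n : ℕ, ∃ C : Circuit (n + 1),
    Cost C Set.univ (K * (Nat.clog 2 n + 1)) (K * (n + 1)) ∧
      ∀ b, ev C b = addc (firstWires n) true b := by
  choose C0 hC0 using fun n : ℕ =>
    exists_inc (firstWires n) (Fin.last n) (last_notMem_firstWires n) (firstWires_nodup n)
  -- 14200 is twice the constant 7100 of `exists_inc_of_short`: half of `K` pays for the work at one
  -- level, half for the five recursive increments. The sum covers all small registers.
  set K := 14200 + ∑ n ∈ Finset.range (2 ^ 129), (C0 n).length with hK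
  refine ⟨K, fun n => ?_⟩
  induction n using Nat.strong_induction_on with
  | _ n ih =>
    by_cases hsmall : n < 2 ^ 129
    · have h1 : (C0 n).length ≤ K := by
        have : (C0 n).length ≤ ∑ n ∈ Finset.range (2 ^ 129), (C0 n).length :=
          Finset.single_le_sum (f := fun n => (C0 n).length) (fun _ _ => Nat.zero_le _)
            (Finset.mem_range.2 hsmall)
        omega
      refine ⟨C0 n, (Cost.of_length _).mono subset_rfl ?_ ?_, hC0 n⟩
      · exact h1.trans (Nat.le_mul_of_pos_right _ (by omega))
      · exact h1.trans (Nat.le_mul_of_pos_right _ (by omega))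
    · have hc129 : 129 ≤ Nat.clog 2 n := by
        by_contra hlt
        have h1 : n ≤ 2 ^ Nat.clog 2 n := Nat.le_pow_clog (by norm_num) n
        have h2 : 2 ^ Nat.clog 2 n ≤ 2 ^ 128 := Nat.pow_le_pow_right (by norm_num) (by omega)
        have h3 : (2 : ℕ) ^ 128 < 2 ^ 129 := Nat.pow_lt_pow_right (by norm_num) (by norm_num)
        omega
      set c := Nat.clog 2 n with hc
      obtain ⟨b1, b2⟩ := short_bounds hc hc129
      -- Three cells for each of at most 6 c + 1 pieces.
      set ℓ := 18 * c + 3 with hℓ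
      set lo := (firstWires n).take ℓ with hlo
      set hi := (firstWires n).drop ℓ with hhi
      have happ : lo ++ hi = firstWires n := List.take_append_drop _ _
      have hlen : (firstWires n).length = n := by simp
      have llo : lo.length = ℓ := by rw [hlo, List.length_take, hlen]; omega
      have lhi : hi.length = n - ℓ := by rw [hhi, List.length_drop, hlen]
      have hn := firstWires_nodup n
      rw [← happ] at hn
      have hz := last_notMem_firstWires n
      rw [← happ] at hz
      -- Any bit of `hi` serves as the dirty ancilla of the recursive increments.
      obtain ⟨x, hx⟩ : ∃ x, x ∈ hi := List.exists_mem_of_length_pos (by omega)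
      have hn' := List.nodup_append.1 hn
      have hxlo : x ∉ lo := fun h => hn'.2.2 x h x hx rfl
      have hzlo : Fin.last n ∉ lo := fun h => hz (List.mem_append_left _ h)
      have hzhi : Fin.last n ∉ hi := fun h => hz (List.mem_append_right _ h)
      have hcm : Nat.clog 2 ℓ ≤ Nat.clog 2 (ℓ + 1) := Nat.clog_mono_right _ (by omega)
      obtain ⟨D0, D0c, D0e⟩ := ih ℓ (by omega)
      obtain ⟨D, Dc, De⟩ := exists_inc_on D0c D0e llo hn'.1 hxlo
      obtain ⟨E0, E0c, E0e⟩ := ih (ℓ + 1) (by omega)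
      obtain ⟨E, Ec, Ee⟩ := exists_inc_on E0c E0e (xs := lo ++ [Fin.last n]) (a := x)
        (by simp [llo])
        (by
          rw [List.nodup_append]
          refine ⟨hn'.1, by simp, fun y hy w hw e => hzlo ?_⟩
          rw [← List.mem_singleton.1 hw, ← e]; exact hy)
        (by
          rw [List.mem_append, not_or]
          exact ⟨hxlo, fun h => hzhi (List.mem_singleton.1 h ▸ hx)⟩)
      have hclog : Nat.clog 2 hi.length ≤ c := Nat.clog_mono_right _ (by omega)
      obtain ⟨C, Cc, Ce⟩ := exists_inc_of_short hn hz (by omega) (by omega)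
        (k := K * (Nat.clog 2 (ℓ + 1) + 1)) (s := K * (ℓ + 1 + 1))
        (Dc.mono subset_rfl (Nat.mul_le_mul_left _ (by omega)) (Nat.mul_le_mul_left _ (by omega)))
        De Ec Ee
      refine ⟨C, Cc.mono subset_rfl ?_ ?_, fun b => by rw [Ce, happ]⟩
      -- The factor 10 is twice the number of recursive increments, so that these use up at most
      -- half of the bound.
      · have e1 : K * (10 * (Nat.clog 2 (ℓ + 1) + 1)) ≤ K * (c + 1) := Nat.mul_le_mul_left _ b1
        have e2 : 14200 * (c + 1) ≤ K * (c + 1) := Nat.mul_le_mul_right _ (by omega)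
        have e3 : K * (10 * (Nat.clog 2 (ℓ + 1) + 1)) =
            10 * (K * (Nat.clog 2 (ℓ + 1) + 1)) := by ring
        omega
      · have e1 : K * (10 * (ℓ + 1 + 1)) ≤ K * (n + 1) := Nat.mul_le_mul_left _ (by omega)
        have e2 : 14200 * (n + 1) ≤ K * (n + 1) := Nat.mul_le_mul_right _ (by omega)
        have e3 : K * (10 * (ℓ + 1 + 1)) = 10 * (K * (ℓ + 1 + 1)) := by ring
        omega

/-! ### Bit strings and the numbers they represent -/

/-- The number whose binary digits are the bits `l`, least significant bit first. -/
def bv : List (Fin m) → (Fin m → Bool) → ℕ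
  | [], _ => 0
  | x :: l, b => (b x).toNat + 2 * bv l b

theorem bv_congr {l : List (Fin m)} {b b' : Fin m → Bool} (h : ∀ w ∈ l, b w = b' w) :
    bv l b = bv l b' := by
  induction l with
  | nil => rfl
  | cons x l ih =>
    rw [bv, bv, h x List.mem_cons_self, ih fun w hw => h w (List.mem_cons_of_mem _ hw)]

theorem bv_lt (l : List (Fin m)) (b : Fin m → Bool) : bv l b < 2 ^ l.length := by
  induction l with
  | nil => simp [bv]
  | cons x l ih =>
    have := Bool.toNat_le (b x)
    rw [bv, List.length_cons, pow_succ]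
    omega

/-- Recording the carry out makes the identity exact, so that the induction needs no reduction
modulo a power of 2. -/
theorem bv_addc {l : List (Fin m)} (hn : l.Nodup) (κ : Bool) (b : Fin m → Bool) :
    bv l (addc l κ b) + 2 ^ l.length * (κ && l.all b).toNat = bv l b + κ.toNat := by
  induction l generalizing κ b with
  | nil => simp [bv]
  | cons x l ih =>
    rw [List.nodup_cons] at hn
    have h1 : bv l (addc (x :: l) κ b) = bv l (addc l (κ && b x) b) :=
      bv_congr fun w hw => addc_cons_mem hn.1 hw κ b
    have h2 := ih hn.2 (κ && b x) b
    rw [bv, bv, h1, addc_cons_self hn.1, List.all_cons, List.length_cons, ← Bool.and_assoc,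
      pow_succ]
    have h3 : (b x ^^ κ).toNat + 2 * (κ && b x).toNat = (b x).toNat + κ.toNat := by
      cases κ <;> cases b x <;> rfl
    have h4 : 2 ^ l.length * 2 * (κ && b x && l.all b).toNat =
        2 * (2 ^ l.length * (κ && b x && l.all b).toNat) := by ring
    omega

theorem bv_addc_true {l : List (Fin m)} (hn : l.Nodup) (b : Fin m → Bool) :
    bv l (addc l true b) = (bv l b + 1) % 2 ^ l.length := by
  have h := bv_addc hn true b
  rw [Bool.toNat_true] at h
  rw [← h, Nat.add_mul_mod_self_left, Nat.mod_eq_of_lt (bv_lt _ _)]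

theorem testBit_bv (l : List (Fin m)) (b : Fin m → Bool) (i : ℕ) (hi : i < l.length) :
    (bv l b).testBit i = b l[i] := by
  induction l generalizing i with
  | nil => simp at hi
  | cons x l ih =>
    have key : (bv (x :: l) b) = Nat.bit (b x) (bv l b) := by
      rw [bv, Nat.bit_val]; omega
    rw [key]
    cases i with
    | zero => simp
    | succ i =>
      rw [Nat.testBit_bit_succ, ih i (by simpa using hi)]
      rfl

theorem bv_map_finRange (n : ℕ) (f : Fin n → Fin m) (b : Fin m → Bool) :
    bv ((List.finRange n).map f) b = bitsVal (fun i => b (f i)) := by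
  induction n with
  | zero => simp [bv, bitsVal]
  | succ n ih =>
    rw [List.finRange_succ, List.map_cons, List.map_map, bv, ih, bitsVal, bitsVal,
      Fin.sum_univ_succ, Finset.mul_sum]
    simp only [Function.comp_apply, Fin.val_zero, pow_zero, mul_one, Fin.val_succ, pow_succ]
    congr 1
    refine Finset.sum_congr rfl fun i _ => by ring

theorem addc_firstWires {n : ℕ} (b : Fin (n + 1) → Bool) (i : Fin n) :
    addc (firstWires n) true b i.castSucc =
      natBits n ((bitsVal (fun i => b (Fin.castSucc i)) + 1) % 2 ^ n) i := by
  have hlen : (firstWires n).length = n := by simp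
  have h1 := bv_addc_true (firstWires_nodup n) b
  have h2 : bv (firstWires n) b = bitsVal (fun i => b (Fin.castSucc i)) := bv_map_finRange n _ b
  rw [hlen, h2] at h1
  rw [natBits, ← h1, testBit_bv _ _ _ (by rw [hlen]; exact i.2)]
  simp

/-! ### From bit strings to states -/

/-- The product state of basis states is a basis state. -/
theorem tensor_ket {n k : ℕ} (x : Fin n → Bool) (y : Fin k → Bool) :
    tensor (ket x) (ket y) = ket (Fin.append x y) := by
  ext b
  have h : b = Fin.append x y ↔ (fun i => b (Fin.castAdd k i)) = x ∧
      (fun j => b (Fin.natAdd n j)) = y := by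
    constructor
    · rintro rfl
      exact ⟨funext fun i => by simp, funext fun j => by simp⟩
    · rintro ⟨rfl, rfl⟩
      exact (Fin.append_castAdd_natAdd).symm
  simp only [tensor, ket, PiLp.single_apply, EuclideanSpace.single, h]
  by_cases h1 : (fun i => b (Fin.castAdd k i)) = x <;>
    by_cases h2 : (fun j => b (Fin.natAdd n j)) = y <;> simp [h1, h2]

/-- The tensor product as a bilinear map. -/
noncomputable def tensorHom (n k : ℕ) : State n →ₗ[ℂ] State k →ₗ[ℂ] State (n + k) :=
  LinearMap.mk₂ ℂ tensor
    (fun φ φ' ψ => by ext b; simp [tensor, add_mul])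
    (fun a φ ψ => by ext b; simp [tensor, mul_assoc])
    (fun φ ψ ψ' => by ext b; simp [tensor, mul_add])
    (fun a φ ψ => by ext b; simp [tensor, mul_left_comm])

theorem ev_append_eq {n : ℕ} {C : Circuit (n + 1)}
    (hC : ∀ b, ev C b = addc (firstWires n) true b) (x : Fin n → Bool) (y : Fin 1 → Bool) :
    ev C (Fin.append x y) = Fin.append (natBits n ((bitsVal x + 1) % 2 ^ n)) y := by
  rw [hC]
  funext w
  refine Fin.lastCases ?_ (fun i => ?_) w
  · rw [addc_notMem (last_notMem_firstWires n)]
    have : Fin.last n = Fin.natAdd n (0 : Fin 1) := rfl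
    rw [this, Fin.append_right, Fin.append_right]
  · rw [addc_firstWires]
    have h1 : ∀ (z : Fin n → Bool) (i : Fin n), Fin.append z y i.castSucc = z i :=
      fun z i => Fin.append_left z y i
    simp only [h1]

/-- Both sides are bilinear in the two states, so basis states suffice. -/
theorem implements_of_ev {n : ℕ} {C : Circuit (n + 1)}
    (hC : ∀ b, ev C b = addc (firstWires n) true b) :
    ImplementsWithDirtyAncilla C (incrementOp n) := by
  have h : (tensorHom n 1).compr₂ C.op = (tensorHom n 1) ∘ₗ incrementOp n := by
    refine ext_ket fun x => ext_ket fun y => ?_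
    change C.op (tensor (ket x) (ket y)) = tensor (incrementOp n (ket x)) (ket y)
    rw [incrementOp, basisOp_ket, tensor_ket, tensor_ket, op_ket, ev_append_eq hC]
  intro φ ψ
  exact LinearMap.congr_fun (LinearMap.congr_fun h φ) ψ

/-! ### Lower bounds for size and depth -/

/-- Every register bit is the target of a gate. -/
theorem le_length {n : ℕ} {C : Circuit (n + 1)}
    (hC : ∀ b, ev C b = addc (firstWires n) true b) : n ≤ C.length := by
  have h : ∀ i : Fin n, i.castSucc ∈ (C.map Gate.target).toFinset := by
    intro i
    by_contra hi
    have ht : Tgt C {w | w ≠ i.castSucc} := fun g hg e =>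
      hi (List.mem_toFinset.2 (List.mem_map.2 ⟨g, hg, e⟩))
    -- The increment turns all ones into all zeros, so no register bit may stay unchanged.
    have h1 := ht.ev_eq (fun _ => true) (w := i.castSucc) fun h => h rfl
    rw [hC, addc_true_of_all (firstWires_nodup n) (by simp) _ (by simp)] at h1
    simp at h1
  calc n = (Finset.univ.map (Fin.castSuccEmb (n := n))).card := by simp
    _ ≤ (C.map Gate.target).toFinset.card := Finset.card_le_card fun w hw => by
        obtain ⟨i, _, rfl⟩ := Finset.mem_map.1 hw
        exact h i
    _ ≤ (C.map Gate.target).length := List.toFinset_card_le _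
    _ = C.length := by simp

/-- Light cones: an output bit that is available after `d` layers depends on at most `3 ^ d` input
bits. -/
theorem exists_lightCone (C : Circuit m) : ∃ D : Fin m → Finset (Fin m), ∀ w,
    (D w).card ≤ 3 ^ (C.foldl Gate.schedule (fun _ => 0) w) ∧
      ∀ b b' : Fin m → Bool, (∀ u ∈ D w, b u = b' u) → ev C b w = ev C b' w := by
  classical
  induction C using List.reverseRecOn with
  | nil => exact ⟨fun w => {w}, fun w => ⟨by simp, fun b b' h => h w (by simp)⟩⟩
  | append_singleton C g ih =>
    obtain ⟨D, hD⟩ := ih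
    -- After `g`, a wire of `g` depends on the union of the cones of its at most three wires, while
    -- its time exceeds all of theirs.
    refine ⟨fun w => if w ∈ g.wires then g.wires.biUnion D else D w, fun w => ?_⟩
    rw [List.foldl_append, List.foldl_cons, List.foldl_nil]
    set d := C.foldl Gate.schedule (fun _ => 0)
    simp only [ev_append]
    by_cases hw : w ∈ g.wires
    · simp only [if_pos hw, Gate.schedule]
      refine ⟨?_, fun b b' h => ?_⟩
      · have h3 : g.wires.card ≤ 3 :=
          (Finset.card_insert_le _ _).trans (by have := g.card_controls_le; omega)
        calc (g.wires.biUnion D).card ≤ g.wires.card * 3 ^ (g.wires.sup d) :=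
              Finset.card_biUnion_le_card_mul _ _ _ fun u hu => (hD u).1.trans
                (Nat.pow_le_pow_right (by norm_num) (Finset.le_sup (f := d) hu))
          _ ≤ 3 * 3 ^ (g.wires.sup d) := Nat.mul_le_mul_right _ h3
          _ = 3 ^ (g.wires.sup d + 1) := by rw [pow_succ, mul_comm]
      · have hon : On [g] {w | w ∈ g.wires} := (Cost.gate g).on
        exact hon.ev_congr (fun u hu => (hD u).2 b b' fun v hv =>
          h v (Finset.mem_biUnion.2 ⟨u, hu, hv⟩)) w hw
    · simp only [if_neg hw, Gate.schedule]
      refine ⟨(hD w).1, fun b b' h => ?_⟩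
      have hon : On [g] {w | w ∈ g.wires} := (Cost.gate g).on
      rw [hon.ev_eq _ hw, hon.ev_eq _ hw]
      exact (hD w).2 b b' h

/-- The top output bit is the top input bit XORed with the conjunction of the others. Switching off
any single bit of the all-ones input changes it, so its light cone contains the whole register. -/
theorem le_three_pow_depth {n : ℕ} {C : Circuit (n + 1)}
    (hC : ∀ b, ev C b = addc (firstWires n) true b) : n ≤ 3 ^ C.depth := by
  rcases n with _ | n
  · exact Nat.zero_le _
  obtain ⟨D, hD⟩ := exists_lightCone C
  have hsplit : firstWires (n + 1) =
      (List.finRange n).map (fun i => i.castSucc.castSucc) ++ [(Fin.last n).castSucc] := by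
    rw [firstWires, List.finRange_succ_last, List.map_append, List.map_map]
    rfl
  set l := (List.finRange n).map (fun i : Fin n => i.castSucc.castSucc) with hl
  set j : Fin (n + 1 + 1) := (Fin.last n).castSucc with hj
  have hn := firstWires_nodup (n + 1)
  rw [hsplit] at hn
  have hjl : j ∉ l := fun h => (List.nodup_append.1 hn).2.2 j h j (by simp) rfl
  have out : ∀ b, ev C b j = xor (b j) (l.all b) := fun b => by
    rw [hC, hsplit, addc_append hn, addc_cons_self (by simp), addc_notMem hjl, Bool.true_and]
  have h : ∀ i : Fin (n + 1), i.castSucc ∈ D j := by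
    intro i
    by_contra hi
    have h1 := (hD j).2 (fun _ => true) (Function.update (fun _ => true) i.castSucc false)
      fun u hu => by rw [Function.update_of_ne fun e : u = i.castSucc => hi (e ▸ hu)]
    rw [out, out] at h1
    have e1 : (l.all fun _ => true) = true := by simp
    rw [e1] at h1
    by_cases hij : i.castSucc = j
    · rw [hij, Function.update_self] at h1
      have e2 : l.all (Function.update (fun _ => true) j false) = l.all fun _ => true :=
        all_congr fun w hw => Function.update_of_ne (fun e : w = j => hjl (e ▸ hw)) _ _
      rw [e2, e1] at h1
      simp at h1
    · rw [Function.update_of_ne (Ne.symm hij)] at h1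
      have hil : i.castSucc ∈ l := by
        have : i.castSucc ∈ firstWires (n + 1) := by simp
        rw [hsplit, List.mem_append, List.mem_singleton] at this
        exact this.resolve_right hij
      have e2 : l.all (Function.update (fun _ => true) i.castSucc false) = false := by
        rw [← Bool.not_eq_true, List.all_eq_true]
        intro hall
        have := hall _ hil
        rw [Function.update_self] at this
        simp at this
      rw [e2] at h1
      simp at h1
  calc n + 1 = (Finset.univ.map (Fin.castSuccEmb (n := n + 1))).card := by simp
    _ ≤ (D j).card := Finset.card_le_card fun w hw => by
        obtain ⟨i, _, rfl⟩ := Finset.mem_map.1 hw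
        exact h i
    _ ≤ 3 ^ (C.foldl Gate.schedule (fun _ => 0) j) := (hD j).1
    _ ≤ 3 ^ C.depth := Nat.pow_le_pow_right (by norm_num)
        (Finset.le_sup (f := C.foldl Gate.schedule (fun _ => 0)) (Finset.mem_univ j))

/-! ### Asymptotics -/

/-- The ceiling logarithm is at most log n / log 2 + 1, and the additive constants are absorbed
using log n ≥ log 2. -/
theorem clog_le_log {n : ℕ} (hn : 2 ≤ n) :
    ((Nat.clog 2 n + 1 : ℕ) : ℝ) ≤ 6 * Real.log n := by
  have hn' : (2 : ℝ) ≤ n := by exact_mod_cast hn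
  have h1 : 2 ^ (Nat.clog 2 n - 1) < n := Nat.pow_pred_clog_lt_self (by norm_num) (by omega)
  have h2 : ((2 : ℝ) ^ (Nat.clog 2 n - 1)) ≤ n := by exact_mod_cast h1.le
  have h3 := Real.log_le_log (by positivity) h2
  rw [Real.log_pow] at h3
  have h4 : Real.log 2 ≤ Real.log n := Real.log_le_log (by norm_num) hn'
  have h5 := Real.log_two_gt_d9
  have h6 : ((Nat.clog 2 n - 1 : ℕ) : ℝ) + 1 ≥ Nat.clog 2 n := by
    have : Nat.clog 2 n ≤ (Nat.clog 2 n - 1) + 1 := by omega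
    exact_mod_cast this
  have h7 : (0 : ℝ) ≤ ((Nat.clog 2 n - 1 : ℕ) : ℝ) := Nat.cast_nonneg _
  push_cast
  nlinarith

end QCircuit

theorem theorem3 :
    ∃ C : (n : ℕ) → QCircuit.Circuit (n + 1),
      (∀ n : ℕ, QCircuit.ImplementsWithDirtyAncilla (C n) (QCircuit.incrementOp n)) ∧
      (fun n : ℕ => ((C n).gateCount : ℝ)) =Θ[atTop] (fun n : ℕ => (n : ℝ)) ∧
      (fun n : ℕ => ((C n).depth : ℝ)) =Θ[atTop] (fun n : ℕ => Real.log (n : ℝ)) := by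
  obtain ⟨K, hK⟩ := QCircuit.exists_inc_log
  choose C hC hI using hK
  refine ⟨C, fun n => QCircuit.implements_of_ev (hI n), ⟨?_, ?_⟩, ?_, ?_⟩
  · refine IsBigO.of_bound (2 * K : ℝ) ?_
    filter_upwards [eventually_ge_atTop 1] with n hn
    rw [Real.norm_of_nonneg (Nat.cast_nonneg _), Real.norm_of_nonneg (Nat.cast_nonneg _)]
    have h1 : (C n).length ≤ 2 * K * n :=
      (hC n).length_le.trans (by nlinarith [Nat.zero_le K])
    exact_mod_cast h1
  · refine IsBigO.of_bound 1 (Eventually.of_forall fun n => ?_)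
    rw [Real.norm_of_nonneg (Nat.cast_nonneg _), Real.norm_of_nonneg (Nat.cast_nonneg _), one_mul]
    exact_mod_cast QCircuit.le_length (hI n)
  · refine IsBigO.of_bound (6 * K : ℝ) ?_
    filter_upwards [eventually_ge_atTop 2] with n hn
    have hlog : 0 ≤ Real.log n := Real.log_natCast_nonneg n
    rw [Real.norm_of_nonneg (Nat.cast_nonneg _), Real.norm_of_nonneg hlog]
    have h1 : ((C n).depth : ℝ) ≤ K * ((Nat.clog 2 n + 1 : ℕ) : ℝ) := by
      exact_mod_cast (hC n).depth_le
    have h2 := mul_le_mul_of_nonneg_left (QCircuit.clog_le_log hn) (Nat.cast_nonneg (α := ℝ) K)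
    linarith
  · refine IsBigO.of_bound (Real.log 3) ?_
    filter_upwards [eventually_ge_atTop 1] with n hn
    have hlog : 0 ≤ Real.log n := Real.log_natCast_nonneg n
    rw [Real.norm_of_nonneg (Nat.cast_nonneg _), Real.norm_of_nonneg hlog]
    have hn' : (0 : ℝ) < n := by exact_mod_cast hn
    have h1 : (n : ℝ) ≤ 3 ^ (C n).depth := by
      exact_mod_cast QCircuit.le_three_pow_depth (hI n)
    have h2 := Real.log_le_log hn' h1
    rw [Real.log_pow] at h2
    linarith
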